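/- Let $N\ge 1$, let $\Omega\subset\mathbb{R}^N$ be a bounded open set with Lipschitz boundary (for instance a bounded open set of class $C^1$ or $C^\infty$), and let $s\in(0,1)$, $d>0$, $T>0$, $Q_T=(0,T)\times\Omega$. Fix the homogeneous Dirichlet or Neumann boundary condition on $\partial\Omega$; let $(\lambda_k)_{k\ge1}$ be the eigenvalues of $-\Delta$ in $\Omega$ with this boundary condition (in the weak sense, in $H^1_0(\Omega)$, respectively $H^1(\Omega)$) and $(e_k)_{k\ge1}$ a corresponding orthonormal basis of $L^2(\Omega)$ of eigenfunctions. Let $(-\Delta)^s_{Sp}u=\sum_k\lambda_k^s u_k e_k$, with $u_k=\int_\Omega u\,e_k$, be the spectral fractional Laplacian and let $$T_s(t)u=\sum_k e^{-t d\lambda_k^s}u_k e_k,\qquad t\ge 0,$$ be the semigroup generated by $-d(-\Delta)^s_{Sp}$ on $L^2(\Omega)$, extended by continuity from $L^2(\Omega)\cap L^p(\Omega)$ to $L^p(\Omega)$ for $1\le p<\infty$. Let $\frac{N+2s}{2s}<p<\infty$. Then there is a constant $C>0$, depending only on $\Omega$ (hence on $N$), the boundary condition, $s$, $d$, $T$ and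 $p$, with the following property. Let $w_0\in L^\infty(\Omega)$ and $h\in L^p(Q_T)$, and let $w\in\mathcal{C}([0,T];L^p(\Omega))$ be the weak solution of $$\partial_t w+d(-\Delta)^s_{Sp}w=h\ \text{ in } Q_T,\qquad w(0,\cdot)=w_0\ \text{ in }\Omega,$$ with the chosen boundary condition, that is, $$w(t)=T_s(t)w_0+\int_0^t T_s(t-\tau)h(\tau)\,d\tau\ \text{ in } L^p(\Omega),\qquad 0\le t<T.$$ Then $$\|w\|_{L^\infty(Q_T)}\le\|w_0\|_{L^\infty(\Omega)}+C\,\|h\|_{L^p(Q_T)}.$$ -/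

import Mathlib

open MeasureTheory Set Filter Topology
open scoped ENNReal NNReal

noncomputable section

namespace SpectralFractional

/-- `ℝ^N` with its Euclidean norm. -/
abbrev Space (N : ℕ) : Type := EuclideanSpace ℝ (Fin N)

/-- A bounded open set with Lipschitz boundary: near each boundary point, after a rotation that sends
some unit vector `ν` to the last coordinate direction, `Ω` is the strict epigraph of a Lipschitz
function of the remaining `N - 1` coordinates (`y - ⟪ν, y⟫ ν` is the projection of `y` to `ν^⊥`).
All bounded open sets of class `C^1`, `C^2`, ..., `C^∞` are of this kind. -/
structure IsBoundedRegularOpen {N : ℕ} (Ω : Set (Space N)) : Prop where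
  isOpen : IsOpen Ω
  isBounded : Bornology.IsBounded Ω
  boundary : ∀ x ∈ frontier Ω, ∃ ν : Space N, ‖ν‖ = 1 ∧ ∃ r : ℝ, 0 < r ∧
    ∃ (K : ℝ≥0) (g : Space N → ℝ), LipschitzWith K g ∧
      ∀ y ∈ Metric.ball x r, y ∈ Ω ↔ g (y - inner ℝ ν y • ν) < inner ℝ ν y

/-- The homogeneous boundary condition: `u = 0` or `∂u/∂ν = 0` on `∂Ω`. -/
inductive BoundaryCondition where
  | dirichlet
  | neumann

/-- `φ ∈ C_c^∞(Ω)`. -/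
structure IsTestFunction {N : ℕ} (Ω : Set (Space N)) (φ : Space N → ℝ) : Prop where
  contDiff : ContDiff ℝ (⊤ : ℕ∞) φ
  hasCompactSupport : HasCompactSupport φ
  tsupport_subset : tsupport φ ⊆ Ω

/-- `L^2(Ω)`. -/
abbrev L2 {N : ℕ} (Ω : Set (Space N)) : Type := Lp ℝ 2 (volume.restrict Ω)

/-- `L^2(Ω; ℝ^N)`. -/
abbrev L2Vec {N : ℕ} (Ω : Set (Space N)) : Type := Lp (Space N) 2 (volume.restrict Ω)

theorem IsTestFunction.memLp {N : ℕ} {Ω : Set (Space N)} {φ : Space N → ℝ}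
    (hφ : IsTestFunction Ω φ) : MemLp φ 2 (volume.restrict Ω) :=
  (hφ.contDiff.continuous.memLp_of_hasCompactSupport hφ.hasCompactSupport).restrict Ω

theorem IsTestFunction.memLp_gradient {N : ℕ} {Ω : Set (Space N)} {φ : Space N → ℝ}
    (hφ : IsTestFunction Ω φ) : MemLp (gradient φ) 2 (volume.restrict Ω) := by
  have h1 : Continuous (gradient φ) :=
    (InnerProductSpace.toDual ℝ (Space N)).symm.continuous.comp
      (hφ.contDiff.continuous_fderiv (by simp))
  have h2 : HasCompactSupport (gradient φ) :=
    (hφ.hasCompactSupport.fderiv (𝕜 := ℝ)).comp_left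
      (g := (InnerProductSpace.toDual ℝ (Space N)).symm) (map_zero _)
  exact (h1.memLp_of_hasCompactSupport h2).restrict Ω

/-- The Sobolev space `H^1(Ω)`, as the space of pairs `(u, ∇u)` where `u ∈ L^2(Ω)` has the weak
gradient `∇u ∈ L^2(Ω; ℝ^N)`: `∫ u ∇φ = - ∫ φ ∇u` for all `φ ∈ C_c^∞(Ω)`. -/
def sobolevH1 {N : ℕ} (Ω : Set (Space N)) : Submodule ℝ (L2 Ω × L2Vec Ω) where
  carrier := {z | ∀ φ : Space N → ℝ, IsTestFunction Ω φ →
    ∫ x in Ω, z.1 x • gradient φ x = - ∫ x in Ω, φ x • z.2 x}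
  zero_mem' := by
    intro φ _
    have e1 : ∫ x in Ω, (0 : L2 Ω) x • gradient φ x = 0 := by
      rw [← integral_zero (Space N) (Space N) (μ := volume.restrict Ω)]
      apply integral_congr_ae
      filter_upwards [Lp.coeFn_zero ℝ 2 (volume.restrict Ω)] with x hx
      rw [hx, Pi.zero_apply, zero_smul]
    have e2 : ∫ x in Ω, φ x • (0 : L2Vec Ω) x = 0 := by
      rw [← integral_zero (Space N) (Space N) (μ := volume.restrict Ω)]
      apply integral_congr_ae
      filter_upwards [Lp.coeFn_zero (Space N) 2 (volume.restrict Ω)] with x hx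
      rw [hx, Pi.zero_apply, smul_zero]
    simp only [Prod.fst_zero, Prod.snd_zero, e1, e2, neg_zero]
  add_mem' := by
    rintro ⟨u, G⟩ ⟨v, H⟩ hu hv φ hφ
    have hu' := hu φ hφ
    have hv' := hv φ hφ
    dsimp only at hu' hv'
    have i1 : ∀ u : L2 Ω, Integrable (fun x => u x • gradient φ x) (volume.restrict Ω) :=
      fun u => memLp_one_iff_integrable.1 (hφ.memLp_gradient.smul (Lp.memLp u))
    have i2 : ∀ G : L2Vec Ω, Integrable (fun x => φ x • G x) (volume.restrict Ω) :=
      fun G => memLp_one_iff_integrable.1 ((Lp.memLp G).smul hφ.memLp)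
    have e1 : ∫ x in Ω, (u + v) x • gradient φ x
        = ∫ x in Ω, u x • gradient φ x + v x • gradient φ x := by
      apply integral_congr_ae
      filter_upwards [Lp.coeFn_add u v] with x hx
      rw [hx, Pi.add_apply, add_smul]
    have e2 : ∫ x in Ω, φ x • (G + H) x = ∫ x in Ω, φ x • G x + φ x • H x := by
      apply integral_congr_ae
      filter_upwards [Lp.coeFn_add G H] with x hx
      rw [hx, Pi.add_apply, smul_add]
    simp only [Prod.mk_add_mk]
    rw [e1, e2, integral_add (i1 u) (i1 v), integral_add (i2 G) (i2 H), hu', hv', neg_add]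
  smul_mem' := by
    rintro c ⟨u, G⟩ hu φ hφ
    have hu' := hu φ hφ
    dsimp only at hu'
    have e1 : ∫ x in Ω, (c • u) x • gradient φ x = ∫ x in Ω, c • (u x • gradient φ x) := by
      apply integral_congr_ae
      filter_upwards [Lp.coeFn_smul c u] with x hx
      rw [hx, Pi.smul_apply, smul_assoc]
    have e2 : ∫ x in Ω, φ x • (c • G) x = ∫ x in Ω, c • (φ x • G x) := by
      apply integral_congr_ae
      filter_upwards [Lp.coeFn_smul c G] with x hx
      rw [hx, Pi.smul_apply, smul_comm]
    simp only [Prod.smul_mk]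
    rw [e1, e2, integral_smul, integral_smul, hu', smul_neg]

/-- `H^1_0(Ω)`, as the closure in `H^1(Ω)` of the pairs `(φ, ∇φ)` with `φ ∈ C_c^∞(Ω)`. -/
def sobolevH10 {N : ℕ} (Ω : Set (Space N)) : Submodule ℝ (L2 Ω × L2Vec Ω) :=
  (Submodule.span ℝ {z : L2 Ω × L2Vec Ω | ∃ φ : Space N → ℝ, ∃ hφ : IsTestFunction Ω φ,
    z = (hφ.memLp.toLp φ, hφ.memLp_gradient.toLp (gradient φ))}).topologicalClosure

/-- The form domain of the Laplacian: `H^1_0(Ω)` for the Dirichlet condition and `H^1(Ω)` for the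
Neumann condition. -/
def formDomain {N : ℕ} (Ω : Set (Space N)) :
    BoundaryCondition → Submodule ℝ (L2 Ω × L2Vec Ω)
  | .dirichlet => sobolevH10 Ω
  | .neumann => sobolevH1 Ω

/-- The solutions `e` of `-Δ e = lam e` in `Ω` with the homogeneous Dirichlet or Neumann boundary
condition, in the weak sense: `∫ ∇e · ∇v = lam ∫ e v` for all `v` in the form domain. It is `{0}`
unless `lam` is an eigenvalue. -/
def eigenspace {N : ℕ} (Ω : Set (Space N)) (bc : BoundaryCondition) (lam : ℝ) :
    Submodule ℝ (L2 Ω) where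
  carrier := {e | ∃ G : L2Vec Ω, (e, G) ∈ formDomain Ω bc ∧
    ∀ z ∈ formDomain Ω bc, inner ℝ G z.2 = lam * inner ℝ e z.1}
  zero_mem' := ⟨0, (formDomain Ω bc).zero_mem, fun z _ => by simp⟩
  add_mem' := by
    rintro e f ⟨G, hG, hG'⟩ ⟨H, hH, hH'⟩
    refine ⟨G + H, (formDomain Ω bc).add_mem hG hH, fun z hz => ?_⟩
    rw [inner_add_left, inner_add_left, hG' z hz, hH' z hz, mul_add]
  smul_mem' := by
    rintro c e ⟨G, hG, hG'⟩
    refine ⟨c • G, (formDomain Ω bc).smul_mem c hG, fun z hz => ?_⟩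
    rw [real_inner_smul_left, real_inner_smul_left, hG' z hz]
    ring

/-- The orthogonal projection of `L^2(Ω)` to the eigenspace of `lam`, `u ↦ ∑ u_k e_k` over an
orthonormal basis of it. Eigenspaces are closed, so the closure only serves to make the projection
available. -/
def eigenprojection {N : ℕ} (Ω : Set (Space N)) (bc : BoundaryCondition) (lam : ℝ) :
    L2 Ω →L[ℝ] L2 Ω :=
  (eigenspace Ω bc lam).topologicalClosure.starProjection

/-- The spectral fractional Laplacian `(-Δ)^s u = ∑_k λ_k^s u_k e_k`, the terms of the series
being grouped by the distinct eigenvalues (all the other terms vanish); its domain is the set of `u`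
for which the series converges in `L^2(Ω)`. -/
def fractionalLaplacian {N : ℕ} (Ω : Set (Space N)) (bc : BoundaryCondition) (s : ℝ)
    (u : L2 Ω) : L2 Ω :=
  ∑' lam : ℝ, lam ^ s • eigenprojection Ω bc lam u

/-- The semigroup `T_s(t) = exp(- t d (-Δ)^s)` on `L^2(Ω)`:
`T_s(t) u = ∑_k exp(- t d λ_k^s) u_k e_k`, the terms being grouped by the distinct eigenvalues. -/
def semigroupL2 {N : ℕ} (Ω : Set (Space N)) (bc : BoundaryCondition) (s d t : ℝ)
    (u : L2 Ω) : L2 Ω :=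
  ∑' lam : ℝ, Real.exp (-(t * (d * lam ^ s))) • eigenprojection Ω bc lam u

/-- The class in `L^p` of a function that belongs to `L^p` (and `0` for other functions). -/
def toLpOrZero {X : Type*} [MeasurableSpace X] (p : ℝ≥0∞) (μ : Measure X) (f : X → ℝ) :
    Lp ℝ p μ :=
  open Classical in if hf : MemLp f p μ then hf.toLp f else 0

/-- The operator `T_s(t)` on `L^p(Ω)`: the continuous extension of the restriction of `T_s(t)` to
`L^2(Ω) ∩ L^p(Ω)`, that is, `T_s(t) f` is the limit in `L^p(Ω)` of `T_s(t) g` as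
`g ∈ L^2(Ω) ∩ L^p(Ω)` tends to `f` in `L^p(Ω)`. -/
def semigroupLp {N : ℕ} (Ω : Set (Space N)) (bc : BoundaryCondition) (s d : ℝ)
    (p : ℝ≥0∞) [Fact (1 ≤ p)] (t : ℝ) (f : Lp ℝ p (volume.restrict Ω)) :
    Lp ℝ p (volume.restrict Ω) :=
  limUnder
    (comap (Subtype.val : {g : Lp ℝ p (volume.restrict Ω) // MemLp g 2 (volume.restrict Ω)} → _)
      (𝓝 f))
    (fun g => toLpOrZero p (volume.restrict Ω)
      (semigroupL2 Ω bc s d t (toLpOrZero 2 (volume.restrict Ω) g.1)))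

/-- The cylinder `Q_T = (0, T) × Ω`. -/
def cylinder {N : ℕ} (Ω : Set (Space N)) (T : ℝ) : Set (ℝ × Space N) := Ioo 0 T ×ˢ Ω

/-- `w ∈ C([0, T]; L^p(Ω))` is the weak solution of `∂_t w + d (-Δ)^s w = h` in `Q_T` with the
boundary condition `bc` and the initial value `w₀`:
`w(t) = T_s(t) w₀ + ∫_0^t T_s(t - τ) h(τ) dτ` in `L^p(Ω)` for `0 ≤ t < T` (Bochner integral).
The measurable function `w` of `(t, x)` represents the curve `t ↦ w(t, ·)` in `L^p(Ω)`. -/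
structure IsWeakSolution {N : ℕ} (Ω : Set (Space N)) (bc : BoundaryCondition) (s d T : ℝ)
    (p : ℝ≥0∞) [Fact (1 ≤ p)] (w₀ : Space N → ℝ) (h w : ℝ × Space N → ℝ) : Prop where
  aestronglyMeasurable : AEStronglyMeasurable w (volume.restrict (cylinder Ω T))
  memLp : ∀ t ∈ Icc 0 T, MemLp (fun x => w (t, x)) p (volume.restrict Ω)
  continuousOn :
    ContinuousOn (fun t => toLpOrZero p (volume.restrict Ω) (fun x => w (t, x))) (Icc 0 T)
  mild : ∀ t ∈ Ico 0 T,
    toLpOrZero p (volume.restrict Ω) (fun x => w (t, x)) =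
      semigroupLp Ω bc s d p t (toLpOrZero p (volume.restrict Ω) w₀) +
        ∫ τ in (0 : ℝ)..t, semigroupLp Ω bc s d p (t - τ)
          (toLpOrZero p (volume.restrict Ω) (fun x => h (τ, x)))

end SpectralFractional

end

/-! By Duhamel's formula, everything reduces to two properties of the semigroup: it contracts `L^∞`,
which handles `w₀`, and it maps `L^p` into `L^∞` with norm at most `K t^(-γ)` on `(0, T]`, where `γ
= N / (2 s p)`. The Duhamel term is then at most `K ∫ (t - τ)^(-γ) ‖h(τ)‖_p dτ`, and Hölder's
inequality in time bounds it by the norm of `h` in `L^p(Q_T)` as soon as `γ p / (p - 1) < 1`. This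
says `N / (2 s) + 1 < p`, which is the hypothesis on `p` (`exists_weakSolution_bound`).

Contraction. Testing the resolvent equation with a smooth cutoff of `u` above the level `c` gives
the weak maximum principle (`supBound_resolvent`); the chain rule in the form domain makes this
legitimate. Positive combinations, products, exponentials and limits keep such bounds. Since the
binomial series of `1 - (1 - x)^s` has nonnegative coefficients, inserting nearly `R / (R + a)` for
`x`, exponentiating and letting `R → ∞` carries the bound from resolvents to `exp(-t a^s)`
(`SupBound.exp_neg_rpow`), a discrete form of subordination. Symmetry then gives the contraction in
`L^1`.

Smoothing. Nash's inequality at scale `τ`, `‖u‖_2² ≤ C (τ^(-N) ‖u‖_1² + τ² ‖∇u‖_2²)`, comes from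
comparing `u` with its means over small balls displaced into `Ω`; a Lipschitz boundary provides the
cones of admissible displacements (`IsBoundedRegularOpen.exists_nash`). It holds on `H^1`, hence for
both boundary conditions. For `u = T_s(t) g` and `τ` proportional to `t^(1/(2s))`, the gradient term
is controlled by `T_s(t/2) g` with a small factor, and iterated halving of the time removes it. This
is the bound from `L^1` to `L^2`; duality improves it to `L^1` to `L^∞`, and truncation of the data
to `L^p` to `L^∞`.

The same means provide compact approximations of the identity on `H^1`
(`IsBoundedRegularOpen.exists_compact_approx`), so the resolvent is compact and the eigenspaces span
`L^2`. Hence the series defining the semigroup is a true functional calculus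
(`isSpectralFamily_eigenprojection`). -/

open MeasureTheory Set Filter Topology
open scoped ENNReal NNReal

noncomputable section

namespace SpectralFractional

section

/-! ### Functional calculus for a discrete resolution of the identity -/

section FunctionalCalculus

variable {H : Type*} [NormedAddCommGroup H] [InnerProductSpace ℝ H]

/-- A discrete resolution of the identity indexed by a nonnegative spectrum. -/
structure IsSpectralFamily (P : ℝ → H →L[ℝ] H) : Prop where
  symm : ∀ a u v, inner ℝ (P a u) v = inner ℝ u (P a v)
  idem : ∀ a u, P a (P a u) = P a u
  orth : ∀ a b u, a ≠ b → P a (P b u) = 0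
  hasSum : ∀ u, HasSum (fun a => P a u) u
  neg : ∀ a u, a < 0 → P a u = 0

/-- `f(L) u = ∑ f(a) P_a u`. -/
def spectralCalculus (P : ℝ → H →L[ℝ] H) (f : ℝ → ℝ) (u : H) : H := ∑' a, f a • P a u

namespace IsSpectralFamily

variable {P : ℝ → H →L[ℝ] H} (hP : IsSpectralFamily P)

include hP

theorem inner_self_apply (a : ℝ) (u : H) : inner ℝ u (P a u) = ‖P a u‖ ^ 2 := by
  rw [← real_inner_self_eq_norm_sq, hP.symm, hP.idem]

theorem hasSum_norm_sq (u : H) : HasSum (fun a => ‖P a u‖ ^ 2) (‖u‖ ^ 2) := by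
  have := (hP.hasSum u).mapL (innerSL ℝ u)
  simpa [hP.inner_self_apply, real_inner_self_eq_norm_sq] using this

theorem eq_of_forall {u v : H} (h : ∀ a, P a u = P a v) : u = v := by
  have h1 := hP.hasSum u
  simp only [h] at h1
  exact h1.unique (hP.hasSum v)

theorem orthogonalFamily : OrthogonalFamily ℝ (fun a => LinearMap.range (P a).toLinearMap)
    (fun a => (LinearMap.range (P a).toLinearMap).subtypeₗᵢ) := by
  rintro a b hab ⟨_, u, rfl⟩ ⟨_, v, rfl⟩
  simp [hP.symm, hP.orth a b v hab]

theorem summable_norm_sq_smul {f : ℝ → ℝ} {M : ℝ} (hf : ∀ a, 0 ≤ a → |f a| ≤ M) (u : H) :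
    Summable (fun a => ‖f a • P a u‖ ^ 2) := by
  refine Summable.of_nonneg_of_le (fun a => by positivity) (fun a => ?_)
    ((hP.hasSum_norm_sq u).summable.mul_left (M ^ 2))
  rcases lt_or_ge a 0 with ha | ha
  · simp [hP.neg a u ha]
  · rw [norm_smul, mul_pow, Real.norm_eq_abs]
    gcongr
    exact hf a ha

variable [CompleteSpace H]

/-- The terms are mutually orthogonal, so the series converges as soon as the squared norms are
summable, and these are dominated by Parseval's series. Bounds on `f` are needed only on `[0, ∞)`,
because the projections vanish at negative indices. -/
theorem hasSum_calculus {f : ℝ → ℝ} {M : ℝ} (hf : ∀ a, 0 ≤ a → |f a| ≤ M) (u : H) :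
    HasSum (fun a => f a • P a u) (spectralCalculus P f u) := by
  refine Summable.hasSum ?_
  have := (hP.orthogonalFamily.summable_iff_norm_sq_summable
    (fun a => ⟨f a • P a u, f a • u, by simp⟩)).2 (hP.summable_norm_sq_smul hf u)
  simpa using this

theorem apply_calculus {f : ℝ → ℝ} {M : ℝ} (hf : ∀ a, 0 ≤ a → |f a| ≤ M) (u : H) (b : ℝ) :
    P b (spectralCalculus P f u) = f b • P b u := by
  have h1 := (hP.hasSum_calculus hf u).mapL (P b)
  refine h1.unique ?_
  have h2 := hasSum_single (f := fun a => P b (f a • P a u)) b (fun a hab => by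
    simp [hP.orth b a u hab.symm])
  simpa [hP.idem] using h2

/-- A vector is determined by its components, so identities of the calculus may be checked on each
component; the algebraic rules below all follow in this way. -/
theorem calculus_eq {f : ℝ → ℝ} {M : ℝ} (hf : ∀ a, 0 ≤ a → |f a| ≤ M) {u v : H}
    (h : ∀ a, 0 ≤ a → P a v = f a • P a u) : spectralCalculus P f u = v := by
  refine hP.eq_of_forall fun a => ?_
  rw [hP.apply_calculus hf]
  rcases lt_or_ge a 0 with ha | ha
  · simp [hP.neg a _ ha]
  · exact (h a ha).symm

theorem norm_sq_calculus {f : ℝ → ℝ} {M : ℝ} (hf : ∀ a, 0 ≤ a → |f a| ≤ M) (u : H) :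
    HasSum (fun a => f a ^ 2 * ‖P a u‖ ^ 2) (‖spectralCalculus P f u‖ ^ 2) := by
  have := hP.hasSum_norm_sq (spectralCalculus P f u)
  simpa [hP.apply_calculus hf, norm_smul, mul_pow] using this

theorem inner_calculus {f : ℝ → ℝ} {M : ℝ} (hf : ∀ a, 0 ≤ a → |f a| ≤ M) (u v : H) :
    inner ℝ (spectralCalculus P f u) v = inner ℝ u (spectralCalculus P f v) := by
  have h1 := (hP.hasSum_calculus hf u).mapL (innerSL ℝ v)
  have h2 := (hP.hasSum_calculus hf v).mapL (innerSL ℝ u)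
  simp only [innerSL_apply_apply, inner_smul_right] at h1 h2
  rw [real_inner_comm]
  refine h1.unique ?_
  convert h2 using 3 with a
  rw [← hP.symm, real_inner_comm]

theorem calculus_add_right {f : ℝ → ℝ} {M : ℝ} (hf : ∀ a, 0 ≤ a → |f a| ≤ M) (u v : H) :
    spectralCalculus P f (u + v) = spectralCalculus P f u + spectralCalculus P f v :=
  hP.calculus_eq hf fun a _ => by simp [hP.apply_calculus hf]

theorem calculus_smul_right {f : ℝ → ℝ} {M : ℝ} (hf : ∀ a, 0 ≤ a → |f a| ≤ M) (c : ℝ) (u : H) :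
    spectralCalculus P f (c • u) = c • spectralCalculus P f u :=
  hP.calculus_eq hf fun a _ => by
    rw [map_smul, map_smul, hP.apply_calculus hf, smul_comm]

theorem calculus_mul {f g : ℝ → ℝ} {M M' : ℝ} (hf : ∀ a, 0 ≤ a → |f a| ≤ M)
    (hg : ∀ a, 0 ≤ a → |g a| ≤ M') (u : H) :
    spectralCalculus P (fun a => f a * g a) u = spectralCalculus P f (spectralCalculus P g u) := by
  have hM : 0 ≤ M := (abs_nonneg _).trans (hf 0 le_rfl)
  refine hP.calculus_eq (M := M * M') (fun a ha => ?_) fun a _ => ?_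
  · rw [abs_mul]
    exact mul_le_mul (hf a ha) (hg a ha) (abs_nonneg _) hM
  · rw [hP.apply_calculus hf, hP.apply_calculus hg, smul_smul]

theorem calculus_add {f g : ℝ → ℝ} {M M' : ℝ} (hf : ∀ a, 0 ≤ a → |f a| ≤ M)
    (hg : ∀ a, 0 ≤ a → |g a| ≤ M') (u : H) :
    spectralCalculus P (fun a => f a + g a) u = spectralCalculus P f u + spectralCalculus P g u := by
  refine hP.calculus_eq (M := M + M') (fun a ha => ?_) fun a _ => ?_
  · exact (abs_add_le _ _).trans (add_le_add (hf a ha) (hg a ha))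
  · rw [map_add, hP.apply_calculus hf, hP.apply_calculus hg, add_smul]

theorem calculus_const_mul {f : ℝ → ℝ} {M : ℝ} (hf : ∀ a, 0 ≤ a → |f a| ≤ M) (c : ℝ) (u : H) :
    spectralCalculus P (fun a => c * f a) u = c • spectralCalculus P f u := by
  refine hP.calculus_eq (M := |c| * M) (fun a ha => ?_) fun a _ => ?_
  · rw [abs_mul]
    exact mul_le_mul_of_nonneg_left (hf a ha) (abs_nonneg _)
  · rw [map_smul, hP.apply_calculus hf, smul_smul]

theorem calculus_one (u : H) : spectralCalculus P (fun _ => 1) u = u :=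
  hP.calculus_eq (M := 1) (by simp) (by simp)

theorem norm_calculus_le {f : ℝ → ℝ} {M : ℝ} (hf : ∀ a, 0 ≤ a → |f a| ≤ M) (u : H) :
    ‖spectralCalculus P f u‖ ≤ M * ‖u‖ := by
  have hM : 0 ≤ M := (abs_nonneg _).trans (hf 0 le_rfl)
  refine abs_le_of_sq_le_sq' ?_ (by positivity) |>.2
  rw [mul_pow]
  refine hasSum_le (fun a => ?_) (hP.norm_sq_calculus hf u) ((hP.hasSum_norm_sq u).mul_left (M ^ 2))
  rcases lt_or_ge a 0 with ha | ha
  · simp [hP.neg a _ ha]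
  · exact mul_le_mul_of_nonneg_right (sq_le_sq' (abs_le.1 (hf a ha)).1 (abs_le.1 (hf a ha)).2)
      (by positivity)

/-- Dominated convergence in Parseval's series for the difference: bounded pointwise convergence of
symbols gives strong convergence of operators. -/
theorem tendsto_calculus {F : ℕ → ℝ → ℝ} {f : ℝ → ℝ} {M : ℝ}
    (hF : ∀ n a, 0 ≤ a → |F n a| ≤ M)
    (hlim : ∀ a, 0 ≤ a → Tendsto (fun n => F n a) atTop (𝓝 (f a))) (u : H) :
    Tendsto (fun n => spectralCalculus P (F n) u) atTop (𝓝 (spectralCalculus P f u)) := by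
  have hf : ∀ a, 0 ≤ a → |f a| ≤ M := fun a ha =>
    le_of_tendsto (hlim a ha).abs (Eventually.of_forall fun n => hF n a ha)
  have hd : ∀ n a, 0 ≤ a → |F n a + (-1) * f a| ≤ M + M := fun n a ha => by
    refine (abs_add_le _ _).trans (add_le_add (hF n a ha) ?_)
    simpa using hf a ha
  have hneg : ∀ a, 0 ≤ a → |(-1) * f a| ≤ M := fun a ha => by simpa using hf a ha
  rw [tendsto_iff_norm_sub_tendsto_zero]
  have key : Tendsto (fun n => ‖spectralCalculus P (F n) u - spectralCalculus P f u‖ ^ 2)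
      atTop (𝓝 0) := by
    have e : ∀ n, ‖spectralCalculus P (F n) u - spectralCalculus P f u‖ ^ 2
        = ∑' a, (F n a + (-1) * f a) ^ 2 * ‖P a u‖ ^ 2 := fun n => by
      rw [(hP.norm_sq_calculus (hd n) u).tsum_eq, hP.calculus_add (hF n) hneg,
        hP.calculus_const_mul hf]
      simp [sub_eq_add_neg]
    simp only [e]
    rw [show (0 : ℝ) = ∑' a : ℝ, (0 : ℝ) by simp]
    refine tendsto_tsum_of_dominated_convergence
      ((hP.hasSum_norm_sq u).summable.mul_left ((M + M) ^ 2)) (fun a => ?_)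
      (Eventually.of_forall fun n a => ?_)
    · rcases lt_or_ge a 0 with ha | ha
      · simp [hP.neg a _ ha]
      · have : Tendsto (fun n => (F n a + (-1) * f a) ^ 2 * ‖P a u‖ ^ 2) atTop
            (𝓝 ((f a + (-1) * f a) ^ 2 * ‖P a u‖ ^ 2)) :=
          (((hlim a ha).add_const _).pow 2).mul_const _
        simpa using this
    · rcases lt_or_ge a 0 with ha | ha
      · simp [hP.neg a _ ha]
      · rw [Real.norm_of_nonneg (by positivity)]
        exact mul_le_mul_of_nonneg_right
          (sq_le_sq' (abs_le.1 (hd n a ha)).1 (abs_le.1 (hd n a ha)).2) (by positivity)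
  have := key.sqrt
  simpa [Real.sqrt_sq (norm_nonneg _)] using this

end IsSpectralFamily

end FunctionalCalculus

/-! ### Sub-Markovian symbols and subordination -/

section SupBound

variable {X : Type*} [MeasurableSpace X] {μ : Measure X}

/-- A sequence converging in `L^2` has a subsequence converging almost everywhere. -/
theorem isClosed_ae_le (c : ℝ) : IsClosed {v : Lp ℝ 2 μ | ∀ᵐ x ∂μ, v x ≤ c} := by
  refine IsSeqClosed.isClosed fun v w hv hw => ?_
  have h1 := tendstoInMeasure_of_tendsto_Lp hw
  obtain ⟨ns, -, h2⟩ := h1.exists_seq_tendsto_ae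
  have h3 : ∀ᵐ x ∂μ, ∀ n, v n x ≤ c := ae_all_iff.2 hv
  filter_upwards [h2, h3] with x hx hx'
  exact le_of_tendsto hx (Eventually.of_forall fun n => hx' _)

/-- `f(L)` is positivity preserving and has norm at most `m` on `L^∞`, together with the
corresponding bounds of the symbol `f`. -/
structure SupBound (P : ℝ → Lp ℝ 2 μ →L[ℝ] Lp ℝ 2 μ) (m : ℝ) (f : ℝ → ℝ) : Prop where
  nonneg : ∀ a, 0 ≤ a → 0 ≤ f a
  le : ∀ a, 0 ≤ a → f a ≤ m
  ae_le : ∀ (u : Lp ℝ 2 μ) (c : ℝ), 0 ≤ c → (∀ᵐ x ∂μ, u x ≤ c) →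
    ∀ᵐ x ∂μ, spectralCalculus P f u x ≤ m * c

namespace SupBound

variable {P : ℝ → Lp ℝ 2 μ →L[ℝ] Lp ℝ 2 μ} {m m' : ℝ} {f g : ℝ → ℝ}

theorem abs_le (hf : SupBound P m f) (a : ℝ) (ha : 0 ≤ a) : |f a| ≤ m := by
  rw [abs_of_nonneg (hf.nonneg a ha)]
  exact hf.le a ha

theorem bound_nonneg (hf : SupBound P m f) : 0 ≤ m :=
  (hf.nonneg 0 le_rfl).trans (hf.le 0 le_rfl)

variable (hP : IsSpectralFamily P)

include hP

theorem one : SupBound P 1 (fun _ => 1) where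
  nonneg := by simp
  le := by simp
  ae_le u c _ hu := by simpa [hP.calculus_one] using hu

theorem add (hf : SupBound P m f) (hg : SupBound P m' g) :
    SupBound P (m + m') (fun a => f a + g a) where
  nonneg a ha := add_nonneg (hf.nonneg a ha) (hg.nonneg a ha)
  le a ha := add_le_add (hf.le a ha) (hg.le a ha)
  ae_le u c hc hu := by
    rw [hP.calculus_add hf.abs_le hg.abs_le]
    filter_upwards [hf.ae_le u c hc hu, hg.ae_le u c hc hu, Lp.coeFn_add
      (spectralCalculus P f u) (spectralCalculus P g u)] with x h1 h2 h3
    rw [h3, Pi.add_apply, add_mul]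
    exact add_le_add h1 h2

theorem mul (hf : SupBound P m f) (hg : SupBound P m' g) :
    SupBound P (m * m') (fun a => f a * g a) where
  nonneg a ha := mul_nonneg (hf.nonneg a ha) (hg.nonneg a ha)
  le a ha := mul_le_mul (hf.le a ha) (hg.le a ha) (hg.nonneg a ha) hf.bound_nonneg
  ae_le u c hc hu := by
    rw [hP.calculus_mul hf.abs_le hg.abs_le, mul_assoc]
    exact hf.ae_le _ _ (mul_nonneg hg.bound_nonneg hc) (hg.ae_le u c hc hu)

theorem const_mul (hf : SupBound P m f) {k : ℝ} (hk : 0 ≤ k) :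
    SupBound P (k * m) (fun a => k * f a) where
  nonneg a ha := mul_nonneg hk (hf.nonneg a ha)
  le a ha := mul_le_mul_of_nonneg_left (hf.le a ha) hk
  ae_le u c hc hu := by
    rw [hP.calculus_const_mul hf.abs_le]
    filter_upwards [hf.ae_le u c hc hu, Lp.coeFn_smul k (spectralCalculus P f u)] with x h1 h2
    rw [h2, Pi.smul_apply, smul_eq_mul, mul_assoc]
    exact mul_le_mul_of_nonneg_left h1 hk

theorem pow (hf : SupBound P m f) (n : ℕ) : SupBound P (m ^ n) (fun a => f a ^ n) := by
  induction n with
  | zero => simpa using SupBound.one hP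
  | succ n ih => simpa only [pow_succ] using ih.mul hP hf

theorem sum {F : ℕ → ℝ → ℝ} {M : ℕ → ℝ} (n : ℕ) (hF : ∀ k, SupBound P (M k) (F k)) :
    SupBound P (∑ k ∈ Finset.range n, M k) (fun a => ∑ k ∈ Finset.range n, F k a) := by
  induction n with
  | zero => simpa using (SupBound.one hP).const_mul hP (le_refl 0)
  | succ n ih => simpa only [Finset.sum_range_succ] using ih.add hP (hF n)

/-- Convergence of symbols on `[0, ∞)` gives `L^2` convergence of the images, and an almost
everywhere upper bound is closed in `L^2`. The convergent sequence of bounds also supplies the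
uniform bound on the symbols. -/
theorem of_tendsto {F : ℕ → ℝ → ℝ} {M : ℕ → ℝ} (hF : ∀ n, SupBound P (M n) (F n))
    (hM : Tendsto M atTop (𝓝 m))
    (hlim : ∀ a, 0 ≤ a → Tendsto (fun n => F n a) atTop (𝓝 (f a))) : SupBound P m f where
  nonneg a ha := ge_of_tendsto (hlim a ha) (Eventually.of_forall fun n => (hF n).nonneg a ha)
  le a ha := le_of_tendsto_of_tendsto (hlim a ha) hM
    (Eventually.of_forall fun n => (hF n).le a ha)
  ae_le u c hc hu := by
    obtain ⟨B, hB⟩ := hM.bddAbove_range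
    have hB' : ∀ n, M n ≤ B := fun n => hB ⟨n, rfl⟩
    have ht := hP.tendsto_calculus (F := F) (f := f) (M := B)
      (fun n a ha => ((hF n).abs_le a ha).trans (hB' n)) hlim u
    -- The bounds `M n * c` vary with `n`, whereas closedness concerns a fixed level; hence a margin
    -- `1 / (k + 1)`, removed at the end over countably many `k`.
    have key : ∀ᵐ x ∂μ, ∀ k : ℕ, spectralCalculus P f u x ≤ m * c + 1 / ((k : ℝ) + 1) := by
      refine ae_all_iff.2 fun k => ?_
      refine (isClosed_ae_le (μ := μ) _).mem_of_tendsto ht ?_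
      have h1 : Tendsto (fun n => M n * c) atTop (𝓝 (m * c)) := hM.mul_const c
      filter_upwards [h1.eventually_lt_const (lt_add_of_pos_right (m * c)
        (by positivity : (0 : ℝ) < 1 / ((k : ℝ) + 1)))] with n hn
      filter_upwards [(hF n).ae_le u c hc hu] with x hx
      exact hx.trans hn.le
    filter_upwards [key] with x hx
    have h2 : Tendsto (fun k : ℕ => m * c + 1 / ((k : ℝ) + 1)) atTop (𝓝 (m * c + 0)) :=
      tendsto_one_div_add_atTop_nhds_zero_nat.const_add _
    rw [add_zero] at h2
    exact ge_of_tendsto h2 (Eventually.of_forall hx)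

/-- The exponential is the limit of `(1 + f / n)^n`, which is built from sums, nonnegative multiples
and powers. -/
theorem exp (hf : SupBound P m f) : SupBound P (Real.exp m) (fun a => Real.exp (f a)) := by
  refine SupBound.of_tendsto hP (F := fun n a => (1 + f a / n) ^ n) (M := fun n => (1 + m / n) ^ n)
    (fun n => ?_) (Real.tendsto_one_add_div_pow_exp m)
    (fun a _ => Real.tendsto_one_add_div_pow_exp (f a))
  refine SupBound.pow hP ?_ n
  have := (SupBound.one hP).add hP (hf.const_mul hP (by positivity : (0 : ℝ) ≤ 1 / (n : ℝ)))
  simpa only [one_div, div_eq_inv_mul, mul_one] using this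

end SupBound

/-- The recursion that determines the signs of the binomial coefficients: for `0 < s < 1` the factor
`s - k` is negative from `k = 1` on. -/
theorem choose_succ_mul (s : ℝ) (k : ℕ) :
    Ring.choose s (k + 1) * (k + 1) = Ring.choose s k * (s - k) := by
  have h := Ring.choose_eq_smul (a := s) (n := k)
  have h' := Ring.choose_eq_smul (a := s) (n := k + 1)
  rw [h, h', descPochhammer_succ_right]
  simp only [smul_eq_mul, Nat.factorial_succ, Polynomial.smeval_mul, Polynomial.smeval_sub,
    Polynomial.smeval_X, Polynomial.smeval_natCast]
  have : ((k + 1 : ℕ) : ℝ) ≠ 0 := by positivity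
  have h2 : (k.factorial : ℝ) ≠ 0 := by positivity
  push_cast at *
  field_simp
  simp

/-- The coefficients of `1 - (1 - x)^s` are nonnegative for `0 < s < 1`. -/
theorem neg_one_pow_mul_choose_nonneg {s : ℝ} (hs0 : 0 < s) (hs1 : s < 1) (k : ℕ) :
    0 ≤ (-1) ^ k * Ring.choose s (k + 1) := by
  induction k with
  | zero => simpa [Ring.choose_one_right] using hs0.le
  | succ k ih =>
    have h := choose_succ_mul s (k + 1)
    push_cast at h
    have h1 : (0 : ℝ) < k + 1 + 1 := by positivity
    have h2 : (-1 : ℝ) ^ (k + 1) * Ring.choose s (k + 1 + 1)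
        = ((-1) ^ k * Ring.choose s (k + 1)) * ((k + 1 - s) / (k + 1 + 1)) := by
      rw [pow_succ, mul_div_assoc', eq_div_iff h1.ne', mul_assoc, h]
      ring
    rw [h2]
    exact mul_nonneg ih (div_nonneg (by linarith [(Nat.cast_nonneg k : (0 : ℝ) ≤ k)]) h1.le)

theorem hasSum_one_sub_one_sub_rpow {s x : ℝ} (hx0 : 0 ≤ x) (hx1 : x < 1) :
    HasSum (fun k : ℕ => ((-1) ^ k * Ring.choose s (k + 1)) * x ^ (k + 1)) (1 - (1 - x) ^ s) := by
  have h := (Real.one_add_rpow_hasFPowerSeriesOnBall_zero (a := s)).hasSum (y := -x) (by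
    simpa [abs_of_nonneg hx0, edist_dist, Real.dist_eq] using hx1)
  simp only [binomialSeries_apply, zero_add, List.ofFn_const, List.prod_replicate,
    smul_eq_mul] at h
  have h2 := (hasSum_nat_add_iff' 1).2 h
  simp only [Finset.range_one, Finset.sum_singleton, Ring.choose_zero_right, pow_zero, mul_one,
    ← sub_eq_add_neg] at h2
  have h3 := h2.neg
  rw [neg_sub] at h3
  have e : (fun k : ℕ => ((-1) ^ k * Ring.choose s (k + 1)) * x ^ (k + 1))
      = fun k : ℕ => -(Ring.choose s (k + 1) * (-x) ^ (k + 1)) := by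
    funext k
    rw [neg_pow x, pow_succ (-1 : ℝ)]
    ring
  rw [e]
  exact h3

/-- With `R = n + 2`, the expression equals `(a + 1/R) / (1 + a/R)`: a Yosida approximation of `a`,
perturbed by the factor `1 - 1/R²`. -/
theorem tendsto_mul_one_sub_shifted_resolvent (a : ℝ) :
    Tendsto (fun n : ℕ => ((n : ℝ) + 2) *
      (1 - (1 - 1 / ((n : ℝ) + 2) ^ 2) * (((n : ℝ) + 2) / ((n : ℝ) + 2 + a)))) atTop (𝓝 a) := by
  have h0 : Tendsto (fun n : ℕ => (n : ℝ) + 2) atTop atTop :=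
    tendsto_atTop_add_const_right _ _ tendsto_natCast_atTop_atTop
  have h1 : Tendsto (fun n : ℕ => ((n : ℝ) + 2)⁻¹) atTop (𝓝 0) := tendsto_inv_atTop_zero.comp h0
  have h2 : Tendsto (fun n : ℕ => (a + ((n : ℝ) + 2)⁻¹) / (1 + a * ((n : ℝ) + 2)⁻¹)) atTop
      (𝓝 ((a + 0) / (1 + a * 0))) :=
    (h1.const_add a).div ((h1.const_mul a).const_add 1) (by simp)
  simp only [add_zero, mul_zero, div_one] at h2
  refine h2.congr' ?_
  filter_upwards [h0.eventually_gt_atTop |a|] with n hn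
  have h3 : (0 : ℝ) < (n : ℝ) + 2 := by positivity
  have h4 : (0 : ℝ) < (n : ℝ) + 2 + a := by linarith [neg_abs_le a]
  field_simp
  ring

/-- Subordination through power series: `1 - (1 - x)^s` is a series in `x` with nonnegative
coefficients, so it may be applied to multiples of the resolvent; then `exp(-t R^s) exp(t R^s (1 -
(1 - x)^s)) = exp(-t (R (1 - x))^s)`, and `R (1 - x)` tends to `a`. -/
theorem SupBound.exp_neg_rpow {P : ℝ → Lp ℝ 2 μ →L[ℝ] Lp ℝ 2 μ} (hP : IsSpectralFamily P)
    (hres : ∀ r : ℝ, 0 < r → SupBound P 1 (fun a => r / (r + a)))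
    {s : ℝ} (hs0 : 0 < s) (hs1 : s < 1) {t : ℝ} (ht : 0 ≤ t) :
    SupBound P 1 (fun a => Real.exp (-(t * a ^ s))) := by
  -- The factor `ρ n < 1` keeps `x n a` strictly inside the disc of convergence of the binomial
  -- series, even at `a = 0`. The shift by `2` makes `R n > 1`, so that `ρ n ≥ 0`.
  let R : ℕ → ℝ := fun n => (n : ℝ) + 2
  let ρ : ℕ → ℝ := fun n => 1 - 1 / R n ^ 2
  let x : ℕ → ℝ → ℝ := fun n a => ρ n * (R n / (R n + a))
  have hR : ∀ n, 1 < R n := fun n => by simp only [R]; linarith [(Nat.cast_nonneg n : (0 : ℝ) ≤ n)]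
  have hρ0 : ∀ n, 0 ≤ ρ n := fun n => by
    have : 1 / R n ^ 2 ≤ 1 := by
      rw [div_le_one (by have := hR n; positivity)]
      exact one_le_pow₀ (hR n).le
    simp only [ρ]; linarith
  have hρ1 : ∀ n, ρ n < 1 := fun n => by
    have : 0 < 1 / R n ^ 2 := by have := hR n; positivity
    simp only [ρ]; linarith
  have hx : ∀ n, SupBound P (ρ n) (x n) := fun n => by
    simpa using (hres (R n) (by linarith [hR n])).const_mul hP (hρ0 n)
  have hG : ∀ n, SupBound P (1 - (1 - ρ n) ^ s) (fun a => 1 - (1 - x n a) ^ s) := fun n => by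
    refine SupBound.of_tendsto hP (fun N => SupBound.sum hP N
      (fun k => ((hx n).pow hP (k + 1)).const_mul hP (neg_one_pow_mul_choose_nonneg hs0 hs1 k)))
      (hasSum_one_sub_one_sub_rpow (hρ0 n) (hρ1 n)).tendsto_sum_nat
      (fun a ha => (hasSum_one_sub_one_sub_rpow ((hx n).nonneg a ha)
        (((hx n).le a ha).trans_lt (hρ1 n))).tendsto_sum_nat)
  have hE : ∀ n, SupBound P (Real.exp (-(t * R n ^ s)) * Real.exp (t * R n ^ s *
      (1 - (1 - ρ n) ^ s))) (fun a => Real.exp (-(t * R n ^ s)) *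
        Real.exp (t * R n ^ s * (1 - (1 - x n a) ^ s))) := fun n =>
    (((hG n).const_mul hP (mul_nonneg ht (Real.rpow_nonneg (by linarith [hR n]) s))).exp
      hP).const_mul hP (Real.exp_nonneg _)
  have conv : ∀ n y, y < 1 → Real.exp (-(t * R n ^ s)) * Real.exp (t * R n ^ s * (1 - (1 - y) ^ s))
      = Real.exp (-(t * (R n * (1 - y)) ^ s)) := fun n y hy => by
    rw [← Real.exp_add, Real.mul_rpow (by linarith [hR n]) (by linarith)]
    congr 1
    ring
  have lim : ∀ a : ℝ, ∀ F : ℕ → ℝ, Tendsto F atTop (𝓝 a) →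
      Tendsto (fun n => Real.exp (-(t * F n ^ s))) atTop (𝓝 (Real.exp (-(t * a ^ s)))) :=
    fun a F hF => ((Real.continuous_exp.tendsto _).comp
      (((hF.rpow_const (Or.inr hs0.le)).const_mul t).neg))
  refine SupBound.of_tendsto hP hE ?_ fun a ha => ?_
  -- The bounds are the symbols at `a = 0`, where `R (1 - ρ) = 1/R` tends to `0`; they tend to `exp
  -- 0 = 1`.
  · have h0 := lim 0 _ (by simpa using tendsto_mul_one_sub_shifted_resolvent 0)
    rw [Real.zero_rpow hs0.ne', mul_zero, neg_zero, Real.exp_zero] at h0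
    refine h0.congr fun n => ?_
    rw [conv n _ (hρ1 n)]
    have h3 : (0 : ℝ) < (n : ℝ) + 2 := by positivity
    simp only [R, ρ]
    congr 4
    field_simp
  · refine (lim a _ (tendsto_mul_one_sub_shifted_resolvent a)).congr fun n => ?_
    rw [conv n _ (((hx n).le a ha).trans_lt (hρ1 n))]

end SupBound

end

section

/-! ### Duality and weak convergence in `L^2` -/

section L2

variable {X : Type*} [MeasurableSpace X] {μ : Measure X}

theorem inner_toLp_toLp {f g : X → ℝ} (hf : MemLp f 2 μ) (hg : MemLp g 2 μ) :
    inner ℝ (hf.toLp f) (hg.toLp g) = ∫ x, f x * g x ∂μ := by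
  rw [L2.inner_def]
  refine integral_congr_ae ?_
  filter_upwards [hf.coeFn_toLp, hg.coeFn_toLp] with x h1 h2
  rw [h1, h2, real_inner_eq_re_inner, RCLike.inner_apply]
  simp [mul_comm]

theorem inner_eq_integral (f g : Lp ℝ 2 μ) : inner ℝ f g = ∫ x, f x * g x ∂μ := by
  rw [← inner_toLp_toLp (Lp.memLp f) (Lp.memLp g)]
  simp

theorem norm_toLp_sq {f : X → ℝ} (hf : MemLp f 2 μ) : ‖hf.toLp f‖ ^ 2 = ∫ x, f x ^ 2 ∂μ := by
  rw [← real_inner_self_eq_norm_sq, inner_toLp_toLp]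
  simp [sq]

theorem abs_integral_mul_le {f g : X → ℝ} (hf : MemLp f 2 μ) (hg : MemLp g 2 μ) :
    |∫ x, f x * g x ∂μ| ≤ ‖hf.toLp f‖ * ‖hg.toLp g‖ := by
  rw [← inner_toLp_toLp hf hg]
  exact abs_real_inner_le_norm _ _

theorem norm_le_of_forall_inner_le {H : Type*} [NormedAddCommGroup H] [InnerProductSpace ℝ H]
    {S : Set H} (hS : Dense S) {f : H} {C : ℝ} (hC : 0 ≤ C)
    (h : ∀ w ∈ S, inner ℝ w f ≤ C * ‖w‖) :
    ‖f‖ ≤ C := by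
  have h1 : ∀ w : H, inner ℝ w f ≤ C * ‖w‖ := by
    have hc : IsClosed {w : H | inner ℝ w f ≤ C * ‖w‖} :=
      isClosed_le (by fun_prop) (by fun_prop)
    exact fun w => hc.closure_subset_iff.2 h (hS w)
  have h2 := h1 f
  rw [real_inner_self_eq_norm_sq, sq] at h2
  rcases eq_or_ne f 0 with hf | hf
  · rwa [hf, norm_zero]
  · exact le_of_mul_le_mul_right h2 (norm_pos_iff.2 hf)

/-- Weak convergence of an eventually bounded family need only be tested on a dense set: the error
of replacing `w` by a nearby `v` is uniform in the family. -/
theorem tendsto_inner_of_dense {H ι : Type*} [NormedAddCommGroup H] [InnerProductSpace ℝ H]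
    {S : Set H} (hS : Dense S) {l : Filter ι} {W : ι → H} {g : H} {M : ℝ}
    (hW : ∀ᶠ i in l, ‖W i‖ ≤ M)
    (h : ∀ w ∈ S, Tendsto (fun i => inner ℝ w (W i)) l (𝓝 (inner ℝ w g))) (w : H) :
    Tendsto (fun i => inner ℝ w (W i)) l (𝓝 (inner ℝ w g)) := by
  rw [Metric.tendsto_nhds]
  intro ε hε
  have hM : 0 < |M| + ‖g‖ + 1 := by positivity
  obtain ⟨v, hv, hvw⟩ := hS.exists_dist_lt w (ε := ε / 2 / (|M| + ‖g‖ + 1)) (by positivity)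
  filter_upwards [hW, Metric.tendsto_nhds.1 (h v hv) (ε / 2) (by positivity)] with i h1 h2
  rw [Real.dist_eq] at h2 ⊢
  have e : inner ℝ w (W i) - inner ℝ w g
      = inner ℝ (w - v) (W i - g) + (inner ℝ v (W i) - inner ℝ v g) := by
    simp only [inner_sub_left, inner_sub_right]
    ring
  rw [e]
  have h3 : |inner ℝ (w - v) (W i - g)| ≤ ε / 2 := by
    refine (abs_real_inner_le_norm _ _).trans ?_
    rw [dist_eq_norm] at hvw
    have h4 : ‖W i - g‖ ≤ |M| + ‖g‖ + 1 := by
      linarith [norm_sub_le (W i) g, le_abs_self M]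
    calc ‖w - v‖ * ‖W i - g‖ ≤ ε / 2 / (|M| + ‖g‖ + 1) * (|M| + ‖g‖ + 1) := by gcongr
      _ = ε / 2 := by field_simp
  exact (abs_add_le _ _).trans_lt (by linarith)

end L2

variable {N : ℕ} {Ω U : Set (Space N)}

/-! ### Test functions and their density -/

section TestFunctions

theorem IsTestFunction.differentiable {φ : Space N → ℝ} (hφ : IsTestFunction Ω φ) :
    Differentiable ℝ φ := hφ.contDiff.differentiable (by simp)

theorem IsTestFunction.mono {φ : Space N → ℝ} (hφ : IsTestFunction U φ) (h : U ⊆ Ω) :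
    IsTestFunction Ω φ := ⟨hφ.contDiff, hφ.hasCompactSupport, hφ.tsupport_subset.trans h⟩

theorem IsTestFunction.eq_zero {φ : Space N → ℝ} (hφ : IsTestFunction Ω φ) {x : Space N}
    (hx : x ∉ Ω) : φ x = 0 :=
  image_eq_zero_of_notMem_tsupport fun h => hx (hφ.tsupport_subset h)

theorem IsTestFunction.memLp_volume {φ : Space N → ℝ} (hφ : IsTestFunction Ω φ) (p : ℝ≥0∞) :
    MemLp φ p volume :=
  hφ.contDiff.continuous.memLp_of_hasCompactSupport hφ.hasCompactSupport

theorem IsTestFunction.fderiv_apply {φ : Space N → ℝ} (hφ : IsTestFunction Ω φ) (e : Space N) :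
    IsTestFunction Ω (fun x => fderiv ℝ φ x e) where
  contDiff := (hφ.contDiff.fderiv_right (m := ((⊤ : ℕ∞) : WithTop ℕ∞)) (by simp)).clm_apply
    contDiff_const
  hasCompactSupport := hφ.hasCompactSupport.fderiv_apply (𝕜 := ℝ) e
  tsupport_subset := (tsupport_fderiv_apply_subset ℝ e).trans hφ.tsupport_subset

theorem IsTestFunction.smul {φ : Space N → ℝ} (hφ : IsTestFunction Ω φ) (c : ℝ) :
    IsTestFunction Ω (fun x => c * φ x) where
  contDiff := contDiff_const.mul hφ.contDiff
  hasCompactSupport := hφ.hasCompactSupport.mul_left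
  tsupport_subset := (tsupport_mul_subset_right).trans hφ.tsupport_subset

theorem IsTestFunction.add {φ ψ : Space N → ℝ} (hφ : IsTestFunction Ω φ)
    (hψ : IsTestFunction Ω ψ) : IsTestFunction Ω (fun x => φ x + ψ x) where
  contDiff := hφ.contDiff.add hψ.contDiff
  hasCompactSupport := hφ.hasCompactSupport.add hψ.hasCompactSupport
  tsupport_subset := (tsupport_add φ ψ).trans (union_subset hφ.tsupport_subset hψ.tsupport_subset)

theorem IsTestFunction.comp_sub {φ : Space N → ℝ} (hφ : IsTestFunction U φ) {z : Space N}
    (h : ∀ x ∈ U, x + z ∈ Ω) : IsTestFunction Ω (fun y => φ (y - z)) where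
  contDiff := hφ.contDiff.comp (contDiff_id.sub contDiff_const)
  hasCompactSupport := hφ.hasCompactSupport.comp_homeomorph (Homeomorph.subRight z)
  tsupport_subset := by
    have := tsupport_comp_eq_preimage φ (Homeomorph.subRight z)
    simp only [Function.comp_def, Homeomorph.coe_subRight] at this
    rw [this]
    intro y hy
    simpa using h _ (hφ.tsupport_subset hy)

theorem IsTestFunction.comp {φ : Space N → ℝ} (hφ : IsTestFunction Ω φ) {Φ : ℝ → ℝ}
    (hΦ : ContDiff ℝ (⊤ : ℕ∞) Φ) (h0 : Φ 0 = 0) : IsTestFunction Ω (fun x => Φ (φ x)) where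
  contDiff := hΦ.comp hφ.contDiff
  hasCompactSupport := hφ.hasCompactSupport.comp_left h0
  tsupport_subset := (closure_mono (Function.support_comp_subset h0 φ)).trans hφ.tsupport_subset

/-- The test functions in `U`, as a subspace of `L^2(U)`. -/
def testSpace (U : Set (Space N)) : Submodule ℝ (L2 U) where
  carrier := {w | ∃ (ψ : Space N → ℝ) (hψ : IsTestFunction U ψ), w = hψ.memLp.toLp ψ}
  zero_mem' := ⟨fun _ => 0, ⟨contDiff_const, HasCompactSupport.zero, by simp [tsupport]⟩,
    (MemLp.toLp_zero _).symm⟩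
  add_mem' := by
    rintro _ _ ⟨φ, hφ, rfl⟩ ⟨ψ, hψ, rfl⟩
    exact ⟨_, hφ.add hψ, (MemLp.toLp_add _ _).symm⟩
  smul_mem' := by
    rintro c _ ⟨φ, hφ, rfl⟩
    exact ⟨_, hφ.smul c, (MemLp.toLp_const_smul c _).symm⟩

/-- The fundamental lemma of the calculus of variations, applied to a vector orthogonal to all test
functions. -/
theorem dense_testSpace (hU : IsOpen U) : Dense (testSpace U : Set (L2 U)) := by
  rw [Submodule.dense_iff_topologicalClosure_eq_top, Submodule.topologicalClosure_eq_top_iff,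
    Submodule.eq_bot_iff]
  intro v hv
  rw [Submodule.mem_orthogonal] at hv
  have hloc : LocallyIntegrableOn v U volume := by
    exact locallyIntegrableOn_of_locallyIntegrable_restrict
      ((Lp.memLp v).locallyIntegrable (by norm_num))
  have h2 := hU.ae_eq_zero_of_integral_contDiff_smul_eq_zero hloc (fun g h1 h2 h3 => by
    have hg : IsTestFunction U g := ⟨h1, h2, h3⟩
    have h4 := hv _ ⟨g, hg, rfl⟩
    rw [← Lp.toLp_coeFn v (Lp.memLp v), inner_toLp_toLp] at h4
    rw [← h4]
    refine (setIntegral_eq_integral_of_forall_compl_eq_zero fun x hx => ?_).symm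
    rw [hg.eq_zero hx, zero_smul])
  refine (Lp.eq_zero_iff_ae_eq_zero).2 ?_
  exact (ae_restrict_iff' hU.measurableSet).2 h2

end TestFunctions

/-! ### Form domains -/

section Sobolev

/-- The vector identity paired with a fixed direction `e`: the scalar form suited to translations
along `e`. -/
theorem mem_sobolevH1_iff {z : L2 Ω × L2Vec Ω} : z ∈ sobolevH1 Ω ↔
    ∀ φ : Space N → ℝ, IsTestFunction Ω φ → ∀ e : Space N,
      ∫ x in Ω, z.1 x * fderiv ℝ φ x e = - ∫ x in Ω, φ x * inner ℝ (z.2 x) e := by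
  have key : ∀ φ : Space N → ℝ, IsTestFunction Ω φ → ∀ e : Space N,
      inner ℝ e (∫ x in Ω, z.1 x • gradient φ x) = ∫ x in Ω, z.1 x * fderiv ℝ φ x e ∧
      inner ℝ e (-∫ x in Ω, φ x • z.2 x) = - ∫ x in Ω, φ x * inner ℝ (z.2 x) e := by
    intro φ hφ e
    have i1 : Integrable (fun x => z.1 x • gradient φ x) (volume.restrict Ω) :=
      memLp_one_iff_integrable.1 (hφ.memLp_gradient.smul (Lp.memLp z.1))
    have i2 : Integrable (fun x => φ x • z.2 x) (volume.restrict Ω) :=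
      memLp_one_iff_integrable.1 ((Lp.memLp z.2).smul hφ.memLp)
    refine ⟨?_, ?_⟩
    · rw [← integral_inner i1]
      refine integral_congr_ae (Eventually.of_forall fun x => ?_)
      simp only
      rw [real_inner_comm, real_inner_smul_left, inner_gradient_left]
    · rw [inner_neg_right, ← integral_inner i2]
      congr 1
      refine integral_congr_ae (Eventually.of_forall fun x => ?_)
      simp only
      rw [real_inner_comm, real_inner_smul_left]
  constructor
  · intro hz φ hφ e
    rw [← (key φ hφ e).1, ← (key φ hφ e).2]
    exact congrArg _ (hz φ hφ)
  · intro h φ hφ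
    refine ext_inner_left ℝ fun e => ?_
    rw [(key φ hφ e).1, (key φ hφ e).2]
    exact h φ hφ e

theorem IsTestFunction.memLp_smul {φ : Space N → ℝ} (hφ : IsTestFunction Ω φ) (e : Space N) :
    MemLp (fun x => φ x • e) 2 (volume.restrict Ω) :=
  ((hφ.contDiff.continuous.smul continuous_const).memLp_of_hasCompactSupport
    hφ.hasCompactSupport.smul_right).restrict Ω

theorem isClosed_sobolevH1 : IsClosed (sobolevH1 Ω : Set (L2 Ω × L2Vec Ω)) := by
  have : (sobolevH1 Ω : Set (L2 Ω × L2Vec Ω)) = ⋂ (φ : Space N → ℝ) (hφ : IsTestFunction Ω φ)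
      (e : Space N), {z | inner ℝ z.1 ((hφ.fderiv_apply e).memLp.toLp _)
        = - inner ℝ ((hφ.memLp_smul e).toLp _) z.2} := by
    ext z
    simp only [SetLike.mem_coe, mem_sobolevH1_iff, mem_iInter, mem_ofPred_eq]
    refine forall_congr' fun φ => forall_congr' fun hφ => forall_congr' fun e => ?_
    have e1 : inner ℝ z.1 ((hφ.fderiv_apply e).memLp.toLp _)
        = ∫ x in Ω, z.1 x * fderiv ℝ φ x e := by
      rw [← inner_toLp_toLp (Lp.memLp z.1) (hφ.fderiv_apply e).memLp, Lp.toLp_coeFn]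
    have e2 : inner ℝ ((hφ.memLp_smul e).toLp _) z.2 = ∫ x in Ω, φ x * inner ℝ (z.2 x) e := by
      rw [L2.inner_def]
      refine integral_congr_ae ?_
      filter_upwards [(hφ.memLp_smul e).coeFn_toLp] with x hx
      rw [hx, real_inner_smul_left, real_inner_comm]
    rw [e1, e2]
  rw [this]
  exact isClosed_iInter fun φ => isClosed_iInter fun hφ => isClosed_iInter fun e =>
    isClosed_eq (by fun_prop) (by fun_prop)

theorem IsTestFunction.setIntegral_eq {φ : Space N → ℝ} (hφ : IsTestFunction Ω φ)
    (f : Space N → ℝ) : ∫ x in Ω, f x * φ x = ∫ x, f x * φ x :=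
  setIntegral_eq_integral_of_forall_compl_eq_zero fun x hx => by rw [hφ.eq_zero hx, mul_zero]

theorem IsTestFunction.integral_mul_fderiv {φ ψ : Space N → ℝ} (hφ : IsTestFunction Ω φ)
    (hψ : IsTestFunction Ω ψ) (e : Space N) :
    ∫ x, φ x * fderiv ℝ ψ x e = - ∫ x, fderiv ℝ φ x e * ψ x := by
  refine integral_mul_fderiv_eq_neg_fderiv_mul_of_integrable ?_ ?_ ?_
    (fun x _ => hφ.differentiable x) (fun x _ => hψ.differentiable x)
  · exact ((hφ.fderiv_apply e).memLp_volume 2).integrable_mul (hψ.memLp_volume 2)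
  · exact (hφ.memLp_volume 2).integrable_mul ((hψ.fderiv_apply e).memLp_volume 2)
  · exact (hφ.memLp_volume 2).integrable_mul (hψ.memLp_volume 2)

theorem testFunction_mem_sobolevH1 {φ : Space N → ℝ} (hφ : IsTestFunction Ω φ) :
    ((hφ.memLp.toLp φ, hφ.memLp_gradient.toLp (gradient φ)) : L2 Ω × L2Vec Ω) ∈ sobolevH1 Ω := by
  rw [mem_sobolevH1_iff]
  intro ψ hψ e
  have e1 : ∫ x in Ω, hφ.memLp.toLp φ x * fderiv ℝ ψ x e = ∫ x, φ x * fderiv ℝ ψ x e := by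
    rw [← (hψ.fderiv_apply e).setIntegral_eq]
    refine integral_congr_ae ?_
    filter_upwards [hφ.memLp.coeFn_toLp] with x hx
    rw [hx]
  have e2 : ∫ x in Ω, ψ x * inner ℝ (hφ.memLp_gradient.toLp (gradient φ) x) e
      = ∫ x, fderiv ℝ φ x e * ψ x := by
    rw [← hψ.setIntegral_eq]
    refine integral_congr_ae ?_
    filter_upwards [hφ.memLp_gradient.coeFn_toLp] with x hx
    rw [hx, inner_gradient_left, mul_comm]
  simp only
  rw [e1, e2]
  exact hφ.integral_mul_fderiv hψ e

theorem sobolevH10_le_sobolevH1 : sobolevH10 Ω ≤ sobolevH1 Ω := by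
  refine Submodule.topologicalClosure_minimal _ ?_ isClosed_sobolevH1
  rw [Submodule.span_le]
  rintro _ ⟨φ, hφ, rfl⟩
  exact testFunction_mem_sobolevH1 hφ

theorem formDomain_le_sobolevH1 (bc : BoundaryCondition) : formDomain Ω bc ≤ sobolevH1 Ω := by
  cases bc
  · exact sobolevH10_le_sobolevH1
  · exact le_rfl

theorem isClosed_formDomain (bc : BoundaryCondition) :
    IsClosed (formDomain Ω bc : Set (L2 Ω × L2Vec Ω)) := by
  cases bc
  · exact Submodule.isClosed_topologicalClosure _
  · exact isClosed_sobolevH1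

theorem testFunction_mem_formDomain (bc : BoundaryCondition) {φ : Space N → ℝ}
    (hφ : IsTestFunction Ω φ) :
    ((hφ.memLp.toLp φ, hφ.memLp_gradient.toLp (gradient φ)) : L2 Ω × L2Vec Ω)
      ∈ formDomain Ω bc := by
  cases bc
  · exact Submodule.le_topologicalClosure _ (Submodule.subset_span ⟨φ, hφ, rfl⟩)
  · exact testFunction_mem_sobolevH1 hφ

end Sobolev

/-! ### Translation estimates in `H^1` -/

section Translation

/-- The translation is carried by the smooth factor, so differentiation under the integral requires
only integrability of `v`. -/
theorem hasDerivAt_integral_mul_comp_sub {v : Space N → ℝ} (hv : Integrable v)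
    {ψ : Space N → ℝ} (hψ : IsTestFunction Ω ψ) (z : Space N) (τ : ℝ) :
    HasDerivAt (fun τ : ℝ => ∫ y, v y * ψ (y - τ • z))
      (- ∫ y, v y * fderiv ℝ ψ (y - τ • z) z) τ := by
  obtain ⟨C, hC⟩ := (hψ.fderiv_apply z).contDiff.continuous.bounded_above_of_compact_support
    (hψ.fderiv_apply z).hasCompactSupport
  obtain ⟨C', hC'⟩ := hψ.contDiff.continuous.bounded_above_of_compact_support
    hψ.hasCompactSupport
  have hm : ∀ τ : ℝ, AEStronglyMeasurable (fun y => ψ (y - τ • z)) volume := fun τ =>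
    (hψ.contDiff.continuous.comp (by fun_prop)).aestronglyMeasurable
  have hm' : ∀ τ : ℝ, AEStronglyMeasurable (fun y => fderiv ℝ ψ (y - τ • z) z) volume := fun τ =>
    ((hψ.fderiv_apply z).contDiff.continuous.comp (by fun_prop)).aestronglyMeasurable
  rw [← integral_neg]
  refine (hasDerivAt_integral_of_dominated_loc_of_deriv_le (s := univ)
    (bound := fun y => ‖v y‖ * C) (F' := fun τ y => -(v y * fderiv ℝ ψ (y - τ • z) z))
    univ_mem ?_ ?_ ?_ ?_ ?_ ?_).2
  · exact Eventually.of_forall fun τ => hv.aestronglyMeasurable.mul (hm τ)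
  · exact hv.mul_bdd (hm τ) (Eventually.of_forall fun y => hC' _)
  · exact (hv.aestronglyMeasurable.mul (hm' τ)).neg
  · refine Eventually.of_forall fun y τ _ => ?_
    rw [norm_neg, norm_mul]
    exact mul_le_mul_of_nonneg_left (hC _) (norm_nonneg _)
  · exact hv.norm.mul_const C
  · refine Eventually.of_forall fun y τ _ => ?_
    have h1 : HasDerivAt (fun τ : ℝ => y - τ • z) (-z) τ := by
      simpa using ((hasDerivAt_id τ).smul_const z).const_sub y
    have h2 := ((hψ.differentiable (y - τ • z)).hasFDerivAt.comp_hasDerivAt τ h1).const_mul (v y)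
    simpa using h2

variable (hΩ : MeasurableSet Ω) (hfin : volume Ω ≠ ∞)

include hΩ in
theorem memLp_indicator (u : L2 Ω) : MemLp (Ω.indicator u) 2 volume :=
  (memLp_indicator_iff_restrict hΩ).2 (Lp.memLp u)

include hΩ hfin in
theorem integrable_indicator_of_memLp {u : Space N → ℝ} (hu : MemLp u 2 (volume.restrict Ω)) :
    Integrable (Ω.indicator u) volume := by
  rw [integrable_indicator_iff hΩ]
  have : IsFiniteMeasure (volume.restrict Ω) := ⟨by simpa using hfin.lt_top⟩
  exact hu.integrable (by norm_num)

include hΩ in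
theorem weakGradient_indicator {z : L2 Ω × L2Vec Ω} (hz : z ∈ sobolevH1 Ω) {φ : Space N → ℝ}
    (hφ : IsTestFunction Ω φ) (e : Space N) :
    - ∫ x, Ω.indicator z.1 x * fderiv ℝ φ x e = ∫ x in Ω, φ x * inner ℝ (z.2 x) e := by
  rw [← neg_eq_iff_eq_neg.2 (mem_sobolevH1_iff.1 hz φ hφ e), ← integral_indicator hΩ]
  congr 2
  ext x
  by_cases hx : x ∈ Ω <;> simp [hx]

theorem norm_inner_toLp_le (G : L2Vec Ω) (e : Space N) :
    ‖((Lp.memLp G).inner_const (𝕜 := ℝ) e).toLp _‖ ≤ ‖G‖ * ‖e‖ := by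
  rw [mul_comm]
  refine Lp.norm_le_mul_norm_of_ae_le_mul ?_
  filter_upwards [((Lp.memLp G).inner_const (𝕜 := ℝ) e).coeFn_toLp] with x hx
  rw [hx, mul_comm]
  exact norm_inner_le_norm _ _

include hΩ hfin in
-- After a change of variables the left side is the increment on `[0, 1]` of `τ ↦ ∫ u(y) ψ(y - τ e)
-- dy`. Each translate of `ψ` is still a test function in `Ω`, so the derivative is a pairing with
-- the weak gradient, and the mean value inequality applies.
theorem abs_integral_translate_sub_le {z : L2 Ω × L2Vec Ω} (hz : z ∈ sobolevH1 Ω)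
    {e : Space N} (hU : ∀ x ∈ U, ∀ τ ∈ Icc (0 : ℝ) 1, x + τ • e ∈ Ω)
    {ψ : Space N → ℝ} (hψ : IsTestFunction U ψ) :
    |∫ x, (Ω.indicator z.1 (x + e) - Ω.indicator z.1 x) * ψ x|
      ≤ ‖z.2‖ * ‖e‖ * ‖hψ.memLp.toLp ψ‖ := by
  have hv := integrable_indicator_of_memLp hΩ hfin (Lp.memLp z.1)
  obtain ⟨C', hC'⟩ := hψ.contDiff.continuous.bounded_above_of_compact_support
    hψ.hasCompactSupport
  have hm : ∀ τ : ℝ, AEStronglyMeasurable (fun y => ψ (y - τ • e)) volume := fun τ =>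
    (hψ.contDiff.continuous.comp (by fun_prop)).aestronglyMeasurable
  have hi : ∀ τ : ℝ, Integrable (fun y => Ω.indicator z.1 y * ψ (y - τ • e)) volume := fun τ =>
    hv.mul_bdd (hm τ) (Eventually.of_forall fun y => hC' _)
  have e1 : ∫ x, (Ω.indicator z.1 (x + e) - Ω.indicator z.1 x) * ψ x
      = (∫ y, Ω.indicator z.1 y * ψ (y - (1 : ℝ) • e))
        - ∫ y, Ω.indicator z.1 y * ψ (y - (0 : ℝ) • e) := by
    have h1 : ∫ y, Ω.indicator z.1 y * ψ (y - (1 : ℝ) • e)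
        = ∫ x, Ω.indicator z.1 (x + e) * ψ x := by
      rw [← integral_add_right_eq_self _ e]
      simp
    have h2 : Integrable (fun x => Ω.indicator z.1 (x + e) * ψ x) volume := by
      have := (hi 1).comp_add_right e
      simpa using this
    rw [h1, ← integral_sub h2 (hi 0)]
    simp [sub_mul]
  rw [e1, ← Real.norm_eq_abs]
  refine norm_image_sub_le_of_norm_deriv_le_segment_01'
    (f := fun τ : ℝ => ∫ y, Ω.indicator z.1 y * ψ (y - τ • e))
    (fun τ _ => (hasDerivAt_integral_mul_comp_sub hv hψ e τ).hasDerivWithinAt) fun τ hτ => ?_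
  have hφ : IsTestFunction Ω (fun y => ψ (y - τ • e)) :=
    hψ.comp_sub fun x hx => hU x hx τ (Ico_subset_Icc_self hτ)
  have e2 := weakGradient_indicator hΩ hz hφ e
  simp only [fderiv_comp_sub] at e2
  rw [e2, Real.norm_eq_abs]
  refine (abs_integral_mul_le hφ.memLp ((Lp.memLp z.2).inner_const (𝕜 := ℝ) e)).trans ?_
  rw [mul_comm]
  refine mul_le_mul (norm_inner_toLp_le _ _) ?_ (norm_nonneg _) (by positivity)
  refine abs_le_of_sq_le_sq' ?_ (norm_nonneg _) |>.2
  rw [norm_toLp_sq, norm_toLp_sq]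
  have h3 := hψ.setIntegral_eq ψ
  have h4 := hφ.setIntegral_eq (fun y => ψ (y - τ • e))
  simp only [← sq] at h3 h4
  rw [h3, h4, integral_sub_right_eq_self (fun y => ψ y ^ 2)]

include hΩ in
theorem memLp_translate_sub (u : L2 Ω) (e : Space N) :
    MemLp (fun x => Ω.indicator u (x + e) - Ω.indicator u x) 2 (volume.restrict U) := by
  have h1 := memLp_indicator hΩ u
  exact ((h1.comp_measurePreserving (measurePreserving_add_right volume e)).sub h1).restrict U

include hΩ hfin in
-- The preceding estimate by duality with the dense test functions of `U`. It underlies the chain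
-- rule, Nash's inequality and compactness; no regularity of the boundary enters beyond the
-- inclusion `hU`.
theorem norm_translate_sub_le {z : L2 Ω × L2Vec Ω} (hz : z ∈ sobolevH1 Ω) (hUo : IsOpen U)
    {e : Space N} (hU : ∀ x ∈ U, ∀ τ ∈ Icc (0 : ℝ) 1, x + τ • e ∈ Ω) :
    ‖(memLp_translate_sub (U := U) hΩ z.1 e).toLp _‖ ≤ ‖z.2‖ * ‖e‖ := by
  refine norm_le_of_forall_inner_le (dense_testSpace hUo) (by positivity) ?_
  rintro _ ⟨ψ, hψ, rfl⟩
  refine (le_abs_self _).trans ?_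
  rw [real_inner_comm, inner_toLp_toLp, hψ.setIntegral_eq]
  exact abs_integral_translate_sub_le hΩ hfin hz hU hψ

end Translation

end

section

variable {N : ℕ} {Ω U : Set (Space N)}

/-! ### Chain rule in the form domain -/

section ChainRule

/-- A smooth nondecreasing function vanishing at the origin with bounded first and second
derivatives. -/
structure IsSmoothCutoff (Φ : ℝ → ℝ) : Prop where
  contDiff : ContDiff ℝ (⊤ : ℕ∞) Φ
  map_zero : Φ 0 = 0
  deriv_nonneg : ∀ x, 0 ≤ deriv Φ x
  exists_deriv_le : ∃ B : ℝ≥0, ∀ x, ‖deriv Φ x‖₊ ≤ B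
  exists_taylor : ∃ C : ℝ, ∀ a b, |Φ b - Φ a - deriv Φ a * (b - a)| ≤ C * (b - a) ^ 2

namespace IsSmoothCutoff

variable {Φ : ℝ → ℝ} (hΦ : IsSmoothCutoff Φ)

include hΦ

theorem continuous_deriv : Continuous (deriv Φ) := hΦ.contDiff.continuous_deriv (by simp)

theorem differentiable : Differentiable ℝ Φ := hΦ.contDiff.differentiable (by simp)

theorem exists_lipschitz : ∃ B : ℝ≥0, LipschitzWith B Φ :=
  hΦ.exists_deriv_le.imp fun _ hB => lipschitzWith_of_nnnorm_deriv_le hΦ.differentiable hB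

theorem memLp (u : L2 Ω) : MemLp (fun x => Φ (u x)) 2 (volume.restrict Ω) := by
  obtain ⟨B, hB⟩ := hΦ.exists_lipschitz
  exact hB.comp_memLp hΦ.map_zero (Lp.memLp u)

theorem memLp_gradient (u : L2 Ω) (G : L2Vec Ω) :
    MemLp (fun x => deriv Φ (u x) • G x) 2 (volume.restrict Ω) := by
  obtain ⟨B, hB⟩ := hΦ.exists_deriv_le
  refine (Lp.memLp G).of_le_mul (c := B) ?_ (Eventually.of_forall fun x => ?_)
  · exact (hΦ.continuous_deriv.comp_aestronglyMeasurable (Lp.aestronglyMeasurable u)).smul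
      (Lp.aestronglyMeasurable G)
  · rw [norm_smul]
    exact mul_le_mul_of_nonneg_right (hB _) (norm_nonneg _)

/-- The pair `(Φ(u), Φ'(u) ∇u)`. -/
def pair (z : L2 Ω × L2Vec Ω) : L2 Ω × L2Vec Ω :=
  ((hΦ.memLp z.1).toLp _, (hΦ.memLp_gradient z.1 z.2).toLp _)

end IsSmoothCutoff

theorem slope_integral_mul_comp_sub {v : Space N → ℝ} (hv : Integrable v) {ψ : Space N → ℝ}
    (hψ : IsTestFunction U ψ) (e : Space N) (h : ℝ) :
    slope (fun τ : ℝ => ∫ y, v y * ψ (y - τ • e)) 0 h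
      = h⁻¹ * ∫ x, (v (x + h • e) - v x) * ψ x := by
  obtain ⟨C', hC'⟩ := hψ.contDiff.continuous.bounded_above_of_compact_support
    hψ.hasCompactSupport
  have hm : ∀ τ : ℝ, AEStronglyMeasurable (fun y => ψ (y - τ • e)) volume := fun τ =>
    (hψ.contDiff.continuous.comp (by fun_prop)).aestronglyMeasurable
  have hi : ∀ τ : ℝ, Integrable (fun y => v y * ψ (y - τ • e)) volume := fun τ =>
    hv.mul_bdd (hm τ) (Eventually.of_forall fun y => hC' _)
  have h1 : ∫ y, v y * ψ (y - h • e) = ∫ x, v (x + h • e) * ψ x := by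
    rw [← integral_add_right_eq_self _ (h • e)]
    simp
  have h2 : Integrable (fun x => v (x + h • e) * ψ x) volume := by
    have := (hi h).comp_add_right (h • e)
    simpa using this
  rw [slope_def_field, h1, ← integral_sub h2 (hi 0), sub_zero, div_eq_inv_mul]
  simp [sub_mul]

theorem tendsto_slope_integral {v : Space N → ℝ} (hv : Integrable v) {ψ : Space N → ℝ}
    (hψ : IsTestFunction U ψ) (e : Space N) :
    Tendsto (fun h : ℝ => h⁻¹ * ∫ x, (v (x + h • e) - v x) * ψ x) (𝓝[>] 0)
      (𝓝 (- ∫ y, v y * fderiv ℝ ψ y e)) := by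
  have h1 := (hasDerivAt_iff_tendsto_slope.1 (hasDerivAt_integral_mul_comp_sub hv hψ e 0)).mono_left
    (nhdsWithin_mono (0 : ℝ) (fun x hx => (ne_of_gt hx : x ≠ 0)) : 𝓝[>] (0 : ℝ) ≤ _)
  simp only [zero_smul, sub_zero] at h1
  refine h1.congr fun h => slope_integral_mul_comp_sub hv hψ e h

/-- Difference quotients converge weakly to the weak derivative. -/
theorem tendsto_integral_differenceQuotient (hΩ : MeasurableSet Ω) (hfin : volume Ω ≠ ∞)
    {z : L2 Ω × L2Vec Ω} (hz : z ∈ sobolevH1 Ω) (hUo : IsOpen U) {e : Space N} (hUΩ : U ⊆ Ω)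
    {h₀ : ℝ} (hh₀ : 0 < h₀)
    (hU : ∀ h ∈ Ioo 0 h₀, ∀ x ∈ U, ∀ τ ∈ Icc (0 : ℝ) 1, x + τ • h • e ∈ Ω)
    {w : Space N → ℝ} (hw : MemLp w 2 (volume.restrict U)) :
    Tendsto (fun h : ℝ => h⁻¹ * ∫ x in U, w x *
        (Ω.indicator z.1 (x + h • e) - Ω.indicator z.1 x)) (𝓝[>] 0)
      (𝓝 (∫ x in U, w x * inner ℝ (z.2 x) e)) := by
  have hG : MemLp (fun x => inner ℝ (z.2 x) e) 2 (volume.restrict U) :=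
    ((Lp.memLp z.2).inner_const (𝕜 := ℝ) e).mono_measure (Measure.restrict_mono hUΩ le_rfl)
  let W : ℝ → L2 U := fun h => h⁻¹ • (memLp_translate_sub (U := U) hΩ z.1 (h • e)).toLp _
  have hev : ∀ᶠ h : ℝ in 𝓝[>] 0, h ∈ Ioo 0 h₀ := Ioo_mem_nhdsGT hh₀
  have key := tendsto_inner_of_dense (l := 𝓝[>] (0 : ℝ)) (dense_testSpace hUo) (W := W)
    (g := hG.toLp _) (M := ‖z.2‖ * ‖e‖) ?_ ?_ (hw.toLp _)
  · rw [inner_toLp_toLp] at key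
    refine key.congr fun h => ?_
    simp only [W]
    rw [inner_smul_right, inner_toLp_toLp]
  · filter_upwards [hev] with h hh
    have := norm_translate_sub_le hΩ hfin hz hUo (hU h hh)
    simp only [W]
    rw [norm_smul, norm_inv, Real.norm_of_nonneg hh.1.le, inv_mul_le_iff₀ hh.1]
    refine this.trans (le_of_eq ?_)
    rw [norm_smul, Real.norm_of_nonneg hh.1.le]
    ring
  · rintro _ ⟨ψ, hψ, rfl⟩
    have h1 := tendsto_slope_integral (integrable_indicator_of_memLp hΩ hfin (Lp.memLp z.1)) hψ e
    rw [weakGradient_indicator hΩ hz (hψ.mono hUΩ) e] at h1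
    have e1 : ∫ x in Ω, ψ x * inner ℝ (z.2 x) e = inner ℝ (hψ.memLp.toLp ψ) (hG.toLp _) := by
      rw [inner_toLp_toLp]
      have := (hψ.mono hUΩ).setIntegral_eq (fun x => inner ℝ (z.2 x) e)
      simp only [mul_comm (inner ℝ _ _)] at this
      rw [this]
      have := hψ.setIntegral_eq (fun x => inner ℝ (z.2 x) e)
      simp only [mul_comm (inner ℝ _ _)] at this
      rw [this]
    rw [← e1]
    refine h1.congr fun h => ?_
    simp only [W]
    rw [inner_smul_right, real_inner_comm, inner_toLp_toLp, hψ.setIntegral_eq]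

/-- Difference quotients of `Φ(u)` equal `Φ'(u)` times those of `u`, up to a Taylor error quadratic
in the increment. The former tend to the distributional derivative, the latter weakly to `Φ'(u) ∂_e
u`. The test function has compact support, so the argument stays away from the boundary. -/
theorem IsSmoothCutoff.pair_mem_sobolevH1 {Φ : ℝ → ℝ} (hΦ : IsSmoothCutoff Φ) (hΩ : IsOpen Ω)
    (hfin : volume Ω ≠ ∞) {z : L2 Ω × L2Vec Ω} (hz : z ∈ sobolevH1 Ω) :
    hΦ.pair z ∈ sobolevH1 Ω := by
  rw [mem_sobolevH1_iff]
  intro φ hφ e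
  have hm := hΩ.measurableSet
  obtain ⟨δ, hδ, hδΩ⟩ :=
    hφ.hasCompactSupport.isCompact.exists_thickening_subset_open hΩ hφ.tsupport_subset
  -- Half of the distance is spent on the neighbourhood `V` of the support, the other half on
  -- translations of `V` inside `Ω`; this fixes `h₀`.
  let V := Metric.thickening (δ / 2) (tsupport φ)
  have hVo : IsOpen V := Metric.isOpen_thickening
  have hVΩ : V ⊆ Ω := (Metric.thickening_mono (by linarith) _).trans hδΩ
  have hφV : IsTestFunction V φ :=
    ⟨hφ.contDiff, hφ.hasCompactSupport, Metric.self_subset_thickening (by positivity) _⟩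
  let h₀ := δ / 2 / (‖e‖ + 1)
  have hh₀ : 0 < h₀ := by positivity
  have hV : ∀ h ∈ Ioo 0 h₀, ∀ x ∈ V, ∀ τ ∈ Icc (0 : ℝ) 1, x + τ • h • e ∈ Ω := by
    intro h hh x hx τ hτ
    refine hδΩ ?_
    rw [Metric.mem_thickening_iff] at hx ⊢
    obtain ⟨y, hy, hxy⟩ := hx
    refine ⟨y, hy, ?_⟩
    have h1 : ‖τ • h • e‖ < δ / 2 := by
      rw [norm_smul, norm_smul, Real.norm_of_nonneg hτ.1, Real.norm_of_nonneg hh.1.le]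
      have h2 : h * (‖e‖ + 1) < δ / 2 := (lt_div_iff₀ (by positivity)).1 hh.2
      calc τ * (h * ‖e‖) ≤ 1 * (h * ‖e‖) :=
            mul_le_mul_of_nonneg_right hτ.2 (mul_nonneg hh.1.le (norm_nonneg _))
        _ < δ / 2 := by nlinarith [hh.1]
    have h2 : dist (x + τ • h • e) x < δ / 2 := by simpa [dist_eq_norm] using h1
    linarith [dist_triangle (x + τ • h • e) x y]
  obtain ⟨C, hC⟩ := hΦ.exists_taylor
  obtain ⟨B, hB⟩ := hΦ.exists_deriv_le
  obtain ⟨A, hA⟩ := hφ.contDiff.continuous.bounded_above_of_compact_support hφ.hasCompactSupport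
  have hA0 : 0 ≤ A := (norm_nonneg _).trans (hA 0)
  have hC0 : 0 ≤ C := by
    have := (abs_nonneg _).trans (hC 0 1)
    simpa using this
  let u : Space N → ℝ := Ω.indicator z.1
  have hu : MemLp u 2 volume := memLp_indicator hm z.1
  have hum : AEStronglyMeasurable u volume := hu.aestronglyMeasurable
  have hv : Integrable (fun x => Φ (u x)) volume := by
    have := integrable_indicator_of_memLp hm hfin (hΦ.memLp z.1)
    refine this.congr (Eventually.of_forall fun x => ?_)
    by_cases hx : x ∈ Ω <;> simp [u, hx, hΦ.map_zero]
  let w : Space N → ℝ := fun x => φ x * deriv Φ (u x)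
  have hwm : AEStronglyMeasurable w volume :=
    hφ.contDiff.continuous.aestronglyMeasurable.mul
      (hΦ.continuous_deriv.comp_aestronglyMeasurable hum)
  have hw : MemLp w 2 (volume.restrict V) := by
    refine MemLp.restrict V ((hφ.memLp_volume 2).of_le_mul (c := B) hwm
      (Eventually.of_forall fun x => ?_))
    simp only [w]
    rw [norm_mul, mul_comm]
    exact mul_le_mul_of_nonneg_right (hB _) (norm_nonneg _)
  have lim1 := tendsto_slope_integral hv hφV e
  have lim2 := tendsto_integral_differenceQuotient hm hfin hz hVo hVΩ hh₀ hV hw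
  -- On `V` the squared increment of `u` has integral at most `(‖∇u‖ ‖e‖ h)²`, so the Taylor error
  -- divided by `h` is of order `h`.
  have lim3 : Tendsto (fun h : ℝ => h⁻¹ * ∫ x, (Φ (u (x + h • e)) - Φ (u x)) * φ x) (𝓝[>] 0)
      (𝓝 (∫ x in V, w x * inner ℝ (z.2 x) e)) := by
    refine tendsto_of_tendsto_of_dist lim2 ?_
    have lim4 : Tendsto (fun h : ℝ => A * C * (‖z.2‖ * ‖e‖) ^ 2 * h) (𝓝[>] 0) (𝓝 0) := by
      have : Tendsto (fun h : ℝ => A * C * (‖z.2‖ * ‖e‖) ^ 2 * h) (𝓝 0)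
          (𝓝 (A * C * (‖z.2‖ * ‖e‖) ^ 2 * 0)) := tendsto_id.const_mul _
      rw [mul_zero] at this
      exact this.mono_left nhdsWithin_le_nhds
    refine squeeze_zero' (Eventually.of_forall fun _ => dist_nonneg) ?_ lim4
    filter_upwards [Ioo_mem_nhdsGT hh₀] with h hh
    have hD := memLp_translate_sub (U := V) hm z.1 (h • e)
    have hDn := norm_translate_sub_le hm hfin hz hVo (hV h hh)
    have i1 : Integrable (fun x => w x * (u (x + h • e) - u x)) (volume.restrict V) :=
      hw.integrable_mul hD
    have i2 : Integrable (fun x => (Φ (u (x + h • e)) - Φ (u x)) * φ x) (volume.restrict V) :=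
      ((hv.comp_add_right (h • e)).sub hv).restrict.mul_bdd
        hφ.contDiff.continuous.aestronglyMeasurable (Eventually.of_forall hA)
    rw [dist_comm, Real.dist_eq, ← hφV.setIntegral_eq, ← mul_sub, ← integral_sub i2 i1, abs_mul,
      abs_inv, abs_of_pos hh.1, inv_mul_le_iff₀ hh.1, ← Real.norm_eq_abs]
    have hsq : ∫ x in V, (u (x + h • e) - u x) ^ 2 ≤ (‖z.2‖ * ‖e‖ * h) ^ 2 := by
      rw [← norm_toLp_sq hD]
      refine pow_le_pow_left₀ (norm_nonneg _) (hDn.trans (le_of_eq ?_)) 2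
      rw [norm_smul, Real.norm_of_nonneg hh.1.le]
      ring
    calc ‖∫ x in V, (Φ (u (x + h • e)) - Φ (u x)) * φ x - w x * (u (x + h • e) - u x)‖
        ≤ ∫ x in V, A * C * (u (x + h • e) - u x) ^ 2 := by
          refine norm_integral_le_of_norm_le (hD.integrable_sq.const_mul (A * C))
            (Eventually.of_forall fun x => ?_)
          have : (Φ (u (x + h • e)) - Φ (u x)) * φ x - w x * (u (x + h • e) - u x)
              = φ x * (Φ (u (x + h • e)) - Φ (u x) - deriv Φ (u x) * (u (x + h • e) - u x)) := by
            simp only [w]; ring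
          rw [this, norm_mul, mul_assoc]
          exact mul_le_mul (hA x) (hC _ _) (norm_nonneg _) hA0
      _ = A * C * ∫ x in V, (u (x + h • e) - u x) ^ 2 := integral_const_mul _ _
      _ ≤ A * C * (‖z.2‖ * ‖e‖ * h) ^ 2 := by gcongr
      _ = h * (A * C * (‖z.2‖ * ‖e‖) ^ 2 * h) := by ring
  have hlim := tendsto_nhds_unique lim1 lim3
  have e1 : ∫ x in Ω, (hΦ.pair z).1 x * fderiv ℝ φ x e = ∫ x, Φ (u x) * fderiv ℝ φ x e := by
    rw [← (hφ.fderiv_apply e).setIntegral_eq]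
    refine setIntegral_congr_ae hm ?_
    filter_upwards [(ae_restrict_iff' hm).1 (hΦ.memLp z.1).coeFn_toLp] with x hx hxΩ
    simp only [IsSmoothCutoff.pair, u]
    rw [hx hxΩ, indicator_of_mem hxΩ]
  have e2 : ∫ x in Ω, φ x * inner ℝ ((hΦ.pair z).2 x) e
      = ∫ x in V, w x * inner ℝ (z.2 x) e := by
    have e3 : ∫ x in V, w x * inner ℝ (z.2 x) e = ∫ x in Ω, w x * inner ℝ (z.2 x) e := by
      refine (setIntegral_eq_of_subset_of_forall_sdiff_eq_zero hm hVΩ fun x hx => ?_).symm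
      simp only [w]
      rw [hφV.eq_zero hx.2, zero_mul, zero_mul]
    rw [e3]
    refine setIntegral_congr_ae hm ?_
    filter_upwards [(ae_restrict_iff' hm).1 (hΦ.memLp_gradient z.1 z.2).coeFn_toLp] with x hx hxΩ
    simp only [IsSmoothCutoff.pair, w, u]
    rw [hx hxΩ, indicator_of_mem hxΩ, real_inner_smul_left]
    ring
  rw [e1, e2, ← hlim, neg_neg]

theorem norm_toLp_vec_sq {X E : Type*} [MeasurableSpace X] {μ : Measure X} [NormedAddCommGroup E]
    [InnerProductSpace ℝ E] {f : X → E} (hf : MemLp f 2 μ) :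
    ‖hf.toLp f‖ ^ 2 = ∫ x, ‖f x‖ ^ 2 ∂μ := by
  rw [← real_inner_self_eq_norm_sq, L2.inner_def]
  refine integral_congr_ae ?_
  filter_upwards [hf.coeFn_toLp] with x hx
  rw [hx, real_inner_self_eq_norm_sq]

/-- The gradient difference splits into `Φ'(u_n) (∇u_n - ∇u)`, small since `Φ'` is bounded, and
`(Φ'(u_n) - Φ'(u)) ∇u`, small by dominated convergence. The latter needs convergence almost
everywhere, hence a subsequence; this suffices for membership in a closed set. -/
theorem IsSmoothCutoff.exists_tendsto_pair {Φ : ℝ → ℝ} (hΦ : IsSmoothCutoff Φ)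
    {Z : ℕ → L2 Ω × L2Vec Ω} {z : L2 Ω × L2Vec Ω} (hZ : Tendsto Z atTop (𝓝 z)) :
    ∃ ns : ℕ → ℕ, Tendsto (fun n => hΦ.pair (Z (ns n))) atTop (𝓝 (hΦ.pair z)) := by
  obtain ⟨B, hB⟩ := hΦ.exists_deriv_le
  have hL : LipschitzWith B Φ := lipschitzWith_of_nnnorm_deriv_le hΦ.differentiable hB
  have h1 : Tendsto (fun n => (Z n).1) atTop (𝓝 z.1) := (continuous_fst.tendsto _).comp hZ
  have h2 : Tendsto (fun n => (Z n).2) atTop (𝓝 z.2) := (continuous_snd.tendsto _).comp hZ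
  obtain ⟨ns, hns, hae⟩ := (tendstoInMeasure_of_tendsto_Lp h1).exists_seq_tendsto_ae
  have h1' := h1.comp hns.tendsto_atTop
  have h2' := h2.comp hns.tendsto_atTop
  refine ⟨ns, Tendsto.prodMk_nhds ?_ ?_⟩
  · rw [tendsto_iff_norm_sub_tendsto_zero] at h1' ⊢
    have h3 := h1'.const_mul (B : ℝ)
    rw [mul_zero] at h3
    refine squeeze_zero (fun _ => norm_nonneg _) (fun n => ?_) h3
    refine Lp.norm_le_mul_norm_of_ae_le_mul ?_
    filter_upwards [(hΦ.memLp (Z (ns n)).1).coeFn_toLp, (hΦ.memLp z.1).coeFn_toLp,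
      Lp.coeFn_sub (hΦ.pair (Z (ns n))).1 (hΦ.pair z).1, Lp.coeFn_sub (Z (ns n)).1 z.1]
      with x e1 e2 e3 e4
    simp only [IsSmoothCutoff.pair, Function.comp] at e3 ⊢
    rw [e3, e4, Pi.sub_apply, Pi.sub_apply, e1, e2]
    simpa [Real.dist_eq] using hL.dist_le_mul ((Z (ns n)).1 x) (z.1 x)
  · have key : Tendsto (fun n => (hΦ.pair ((Z (ns n)).1, z.2)).2) atTop (𝓝 (hΦ.pair z).2) := by
      rw [tendsto_iff_norm_sub_tendsto_zero]
      have hD : ∀ n, MemLp (fun x => (deriv Φ ((Z (ns n)).1 x) - deriv Φ (z.1 x)) • z.2 x) 2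
          (volume.restrict Ω) := fun n => by
        simp only [sub_smul]
        exact (hΦ.memLp_gradient (Z (ns n)).1 z.2).sub (hΦ.memLp_gradient z.1 z.2)
      have e : ∀ n, ‖(hΦ.pair ((Z (ns n)).1, z.2)).2 - (hΦ.pair z).2‖ ^ 2
          = ∫ x in Ω, ‖(deriv Φ ((Z (ns n)).1 x) - deriv Φ (z.1 x)) • z.2 x‖ ^ 2 := fun n => by
        rw [← norm_toLp_vec_sq (hD n)]
        congr 2
        simp only [IsSmoothCutoff.pair]
        rw [← MemLp.toLp_sub]
        simp only [sub_smul]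
        rfl
      have lim : Tendsto (fun n => ‖(hΦ.pair ((Z (ns n)).1, z.2)).2 - (hΦ.pair z).2‖ ^ 2) atTop
          (𝓝 0) := by
        simp only [e]
        rw [show (0 : ℝ) = ∫ x in Ω, (0 : ℝ) by simp]
        refine tendsto_integral_of_dominated_convergence (fun x => (2 * B * ‖z.2 x‖) ^ 2)
          (fun n => (hD n).aestronglyMeasurable.norm.pow 2) ?_ (fun n => ?_) ?_
        · exact ((Lp.memLp z.2).norm.const_mul (2 * B : ℝ)).integrable_sq
        · refine Eventually.of_forall fun x => ?_
          rw [norm_pow, norm_norm, norm_smul]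
          have h3 : ‖deriv Φ ((Z (ns n)).1 x) - deriv Φ (z.1 x)‖ ≤ 2 * B := by
            have h4 : ‖deriv Φ ((Z (ns n)).1 x)‖ ≤ B := hB _
            have h5 : ‖deriv Φ (z.1 x)‖ ≤ B := hB _
            linarith [norm_sub_le (deriv Φ ((Z (ns n)).1 x)) (deriv Φ (z.1 x))]
          gcongr
        · filter_upwards [hae] with x hx
          have h3 : Tendsto (fun n => ‖(deriv Φ ((Z (ns n)).1 x) - deriv Φ (z.1 x)) • z.2 x‖ ^ 2)
              atTop (𝓝 (‖(deriv Φ (z.1 x) - deriv Φ (z.1 x)) • z.2 x‖ ^ 2)) :=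
            (((((hΦ.continuous_deriv.tendsto _).comp hx).sub_const _).smul_const _).norm).pow 2
          simpa using h3
      have := lim.sqrt
      simpa [Real.sqrt_sq (norm_nonneg _)] using this
    refine tendsto_of_tendsto_of_dist key ?_
    rw [tendsto_iff_norm_sub_tendsto_zero] at h2'
    have h3 := h2'.const_mul (B : ℝ)
    rw [mul_zero] at h3
    refine squeeze_zero (fun _ => dist_nonneg) (fun n => ?_) h3
    rw [dist_comm, dist_eq_norm]
    refine Lp.norm_le_mul_norm_of_ae_le_mul ?_
    filter_upwards [(hΦ.memLp_gradient (Z (ns n)).1 (Z (ns n)).2).coeFn_toLp,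
      (hΦ.memLp_gradient (Z (ns n)).1 z.2).coeFn_toLp,
      Lp.coeFn_sub (hΦ.pair (Z (ns n))).2 (hΦ.pair ((Z (ns n)).1, z.2)).2,
      Lp.coeFn_sub (Z (ns n)).2 z.2] with x e1 e2 e3 e4
    simp only [IsSmoothCutoff.pair, Function.comp] at e3 ⊢
    rw [e3, e4, Pi.sub_apply, Pi.sub_apply, e1, e2, ← smul_sub, norm_smul]
    exact mul_le_mul_of_nonneg_right (hB _) (norm_nonneg _)

theorem IsSmoothCutoff.pair_testFunction {Φ : ℝ → ℝ} (hΦ : IsSmoothCutoff Φ) {φ : Space N → ℝ}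
    (hφ : IsTestFunction Ω φ) :
    hΦ.pair (hφ.memLp.toLp φ, hφ.memLp_gradient.toLp (gradient φ))
      = ((hφ.comp hΦ.contDiff hΦ.map_zero).memLp.toLp _,
        (hφ.comp hΦ.contDiff hΦ.map_zero).memLp_gradient.toLp _) := by
  simp only [IsSmoothCutoff.pair]
  refine Prod.ext ?_ ?_
  · refine (MemLp.toLp_eq_toLp_iff (hΦ.memLp _)
      (hφ.comp hΦ.contDiff hΦ.map_zero).memLp).2 ?_
    filter_upwards [hφ.memLp.coeFn_toLp] with x hx
    rw [hx]
  · refine (MemLp.toLp_eq_toLp_iff (hΦ.memLp_gradient _ _)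
      (hφ.comp hΦ.contDiff hΦ.map_zero).memLp_gradient).2 ?_
    filter_upwards [hφ.memLp.coeFn_toLp, hφ.memLp_gradient.coeFn_toLp] with x hx hx'
    rw [hx, hx']
    refine (HasGradientAt.gradient ?_).symm
    rw [hasGradientAt_iff_hasFDerivAt, map_smul, toDual_gradient]
    exact (hΦ.differentiable (φ x)).hasDerivAt.comp_hasFDerivAt x
      (hφ.differentiable x).hasFDerivAt

/-- Test functions already form a vector space, so elements of `H^1_0` are limits of single pairs
`(φ, ∇φ)`, to which the classical chain rule applies. -/
theorem exists_testFunction_of_mem_span {z : L2 Ω × L2Vec Ω}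
    (hz : z ∈ Submodule.span ℝ {z : L2 Ω × L2Vec Ω | ∃ φ : Space N → ℝ,
      ∃ hφ : IsTestFunction Ω φ, z = (hφ.memLp.toLp φ, hφ.memLp_gradient.toLp (gradient φ))}) :
    ∃ φ : Space N → ℝ, ∃ hφ : IsTestFunction Ω φ,
      z = (hφ.memLp.toLp φ, hφ.memLp_gradient.toLp (gradient φ)) := by
  induction hz using Submodule.span_induction with
  | mem z hz => exact hz
  | zero =>
    have h0 : IsTestFunction Ω (fun _ => (0 : ℝ)) :=
      ⟨contDiff_const, HasCompactSupport.zero, by simp [tsupport]⟩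
    refine ⟨fun _ => 0, h0, Prod.ext ?_ ?_⟩
    · exact (Lp.eq_zero_iff_ae_eq_zero.2 h0.memLp.coeFn_toLp).symm
    · refine (Lp.eq_zero_iff_ae_eq_zero.2 ?_).symm
      filter_upwards [h0.memLp_gradient.coeFn_toLp] with x hx
      rw [hx, gradient_fun_const, Pi.zero_apply]
  | add y z _ _ hy hz =>
    obtain ⟨φ, hφ, rfl⟩ := hy
    obtain ⟨ψ, hψ, rfl⟩ := hz
    refine ⟨_, hφ.add hψ, Prod.ext (MemLp.toLp_add hφ.memLp hψ.memLp).symm ?_⟩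
    simp only [Prod.snd_add]
    rw [← MemLp.toLp_add, MemLp.toLp_eq_toLp_iff]
    refine Eventually.of_forall fun x => (HasGradientAt.gradient ?_).symm
    rw [hasGradientAt_iff_hasFDerivAt, Pi.add_apply, map_add, toDual_gradient, toDual_gradient]
    exact (hφ.differentiable x).hasFDerivAt.add (hψ.differentiable x).hasFDerivAt
  | smul c z _ hz =>
    obtain ⟨φ, hφ, rfl⟩ := hz
    refine ⟨_, hφ.smul c, Prod.ext (MemLp.toLp_const_smul c hφ.memLp).symm ?_⟩
    simp only [Prod.smul_snd]
    rw [← MemLp.toLp_const_smul, MemLp.toLp_eq_toLp_iff]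
    refine Eventually.of_forall fun x => (HasGradientAt.gradient ?_).symm
    rw [hasGradientAt_iff_hasFDerivAt, Pi.smul_apply, map_smul, toDual_gradient]
    exact (hφ.differentiable x).hasFDerivAt.const_mul c

/-- The chain rule: the form domain is stable under smooth cutoffs. -/
theorem IsSmoothCutoff.pair_mem_formDomain {Φ : ℝ → ℝ} (hΦ : IsSmoothCutoff Φ) (hΩ : IsOpen Ω)
    (hfin : volume Ω ≠ ∞) (bc : BoundaryCondition) {z : L2 Ω × L2Vec Ω}
    (hz : z ∈ formDomain Ω bc) : hΦ.pair z ∈ formDomain Ω bc := by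
  cases bc with
  | neumann => exact hΦ.pair_mem_sobolevH1 hΩ hfin hz
  | dirichlet =>
    obtain ⟨Z, hZ, hlim⟩ := mem_closure_iff_seq_limit.1 hz
    obtain ⟨ns, hns⟩ := hΦ.exists_tendsto_pair hlim
    refine (isClosed_formDomain .dirichlet).mem_of_tendsto hns (Eventually.of_forall fun n => ?_)
    obtain ⟨φ, hφ, e⟩ := exists_testFunction_of_mem_span (hZ (ns n))
    rw [e, hΦ.pair_testFunction hφ]
    exact testFunction_mem_formDomain .dirichlet (hφ.comp hΦ.contDiff hΦ.map_zero)

/-- A smooth substitute for the test function `(x - c)^+`: zero up to `c` and positive beyond. Its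
derivative is supported in `[c, c + 1]`, hence bounded and Lipschitz; `0 ≤ c` makes it vanish at the
origin. -/
theorem isSmoothCutoff_smoothTransition {c : ℝ} (hc : 0 ≤ c) :
    IsSmoothCutoff (fun x => Real.smoothTransition (x - c)) := by
  have hsm : ∀ n : WithTop ℕ∞, n ≤ (⊤ : ℕ∞) →
      ContDiff ℝ n (fun x => Real.smoothTransition (x - c)) := fun n hn =>
    (Real.smoothTransition.contDiff.comp (contDiff_id.sub contDiff_const)).of_le hn
  have hder : ∀ x ∉ Icc c (c + 1), deriv (fun x => Real.smoothTransition (x - c)) x = 0 := by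
    intro x hx
    rw [mem_Icc, not_and_or, not_le, not_le] at hx
    rcases hx with hx | hx
    · have : (fun x => Real.smoothTransition (x - c)) =ᶠ[𝓝 x] fun _ => 0 := by
        filter_upwards [Iio_mem_nhds hx] with y hy
        exact Real.smoothTransition.zero_of_nonpos (by linarith [mem_Iio.1 hy])
      rw [this.deriv_eq, deriv_const]
    · have : (fun x => Real.smoothTransition (x - c)) =ᶠ[𝓝 x] fun _ => 1 := by
        filter_upwards [Ioi_mem_nhds hx] with y hy
        exact Real.smoothTransition.one_of_one_le (by linarith [mem_Ioi.1 hy])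
      rw [this.deriv_eq, deriv_const]
  have hcs : HasCompactSupport (deriv (fun x => Real.smoothTransition (x - c))) :=
    HasCompactSupport.intro isCompact_Icc hder
  have hd1 : ContDiff ℝ 1 (deriv (fun x => Real.smoothTransition (x - c))) := by
    have := hsm 2 (WithTop.coe_le_coe.2 le_top)
    rw [show (2 : WithTop ℕ∞) = 1 + 1 by norm_num, contDiff_succ_iff_deriv] at this
    exact this.2.2
  have hdiff : Differentiable ℝ (fun x => Real.smoothTransition (x - c)) :=
    (hsm 1 (by exact_mod_cast le_top)).differentiable (by simp)
  obtain ⟨K, hK⟩ := hd1.lipschitzWith_of_hasCompactSupport hcs (by simp)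
  refine ⟨hsm _ le_rfl, Real.smoothTransition.zero_of_nonpos (by linarith), fun x => ?_, ?_, K,
    fun a b => ?_⟩
  · exact Monotone.deriv_nonneg (fun x y hxy => Real.smoothTransition.monotone (by linarith))
  · obtain ⟨B, hB⟩ := hd1.continuous.bounded_above_of_compact_support hcs
    exact ⟨B.toNNReal, fun x => NNReal.coe_le_coe.1 ((hB x).trans (Real.le_coe_toNNReal B))⟩
  · set Φ := fun x => Real.smoothTransition (x - c) with hΦ
    -- Taylor's estimate is the mean value inequality for `Φ(x) - Φ'(a) x`, whose derivative is at
    -- most `K |b - a|` between `a` and `b`.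
    have h1 : ∀ x ∈ uIcc a b, HasDerivWithinAt (fun x => Φ x - deriv Φ a * x)
        (deriv Φ x - deriv Φ a) (uIcc a b) x := fun x _ => by
      have h := ((hdiff x).hasDerivAt.sub
        ((hasDerivAt_id x).const_mul (deriv Φ a))).hasDerivWithinAt (s := uIcc a b)
      rw [mul_one] at h
      exact h
    have h2 : ∀ x ∈ uIcc a b, ‖deriv Φ x - deriv Φ a‖ ≤ K * |b - a| := fun x hx => by
      have h3 := hK.dist_le_mul x a
      rw [dist_eq_norm, Real.dist_eq] at h3
      exact h3.trans (mul_le_mul_of_nonneg_left (abs_sub_left_of_mem_uIcc hx) K.2)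
    have h3 := (convex_uIcc a b).norm_image_sub_le_of_norm_hasDerivWithin_le h1 h2
      left_mem_uIcc right_mem_uIcc
    rw [Real.norm_eq_abs, Real.norm_eq_abs, mul_assoc, abs_mul_abs_self] at h3
    calc |Φ b - Φ a - deriv Φ a * (b - a)|
        = |Φ b - deriv Φ a * b - (Φ a - deriv Φ a * a)| := by congr 1; ring
      _ ≤ K * (b - a) ^ 2 := by rw [sq]; exact h3

end ChainRule

end

section

variable {N : ℕ} {Ω U D : Set (Space N)}

/-! ### Averages over translated sets -/

section Average

/-- The mean of `f` over `x + D`. -/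
def shiftAverage (D : Set (Space N)) (f : Space N → ℝ) (x : Space N) : ℝ :=
  (volume.real D)⁻¹ * ∫ z in D, f (x + z)

theorem sq_integral_le {X : Type*} [MeasurableSpace X] {μ : Measure X} [IsFiniteMeasure μ]
    {f : X → ℝ} (hf : MemLp f 2 μ) : (∫ x, f x ∂μ) ^ 2 ≤ μ.real univ * ∫ x, f x ^ 2 ∂μ := by
  have h1 := abs_integral_mul_le hf (memLp_const (1 : ℝ))
  have h2 := pow_le_pow_left₀ (abs_nonneg _) h1 2
  rw [mul_pow, norm_toLp_sq, norm_toLp_sq, sq_abs] at h2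
  simpa [mul_comm] using h2

theorem measurable_shiftAverage {f : Space N → ℝ} (hf : Measurable f) :
    Measurable (shiftAverage D f) := by
  have : StronglyMeasurable (fun p : Space N × Space N => f (p.1 + p.2)) :=
    (hf.comp (measurable_fst.add measurable_snd)).stronglyMeasurable
  exact (this.integral_prod_right (ν := volume.restrict D)).measurable.const_mul _

theorem memLp_comp_add {p : ℝ≥0∞} {f : Space N → ℝ} (hf : MemLp f p volume) (x : Space N) :
    MemLp (fun z => f (x + z)) p volume :=
  hf.comp_measurePreserving (measurePreserving_add_left volume x)

theorem abs_shiftAverage_le {f : Space N → ℝ} (hf : Integrable f volume) (x : Space N) :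
    |shiftAverage D f x| ≤ (volume.real D)⁻¹ * ∫ y, |f y| := by
  rw [shiftAverage, abs_mul, abs_of_nonneg (by positivity : 0 ≤ (volume.real D)⁻¹)]
  refine mul_le_mul_of_nonneg_left ?_ (by positivity)
  calc |∫ z in D, f (x + z)| ≤ ∫ z in D, |f (x + z)| := abs_integral_le_integral_abs
    _ ≤ ∫ z, |f (x + z)| := setIntegral_le_integral (hf.comp_add_left x).abs
        (Eventually.of_forall fun _ => abs_nonneg _)
    _ = ∫ y, |f y| := integral_add_left_eq_self (fun y => |f y|) x

/-- Interpolation between two bounds for the average of `f`: its supremum is at most `‖f‖_1 / |D|`,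
and its `L^1` norm is at most `‖f‖_1`. -/
theorem integral_sq_shiftAverage_le {f : Space N → ℝ} (hfm : Measurable f)
    (hf : Integrable f volume) (hDf : volume D ≠ ∞) :
    ∫ x in U, shiftAverage D f x ^ 2 ≤ (volume.real D)⁻¹ * (∫ y, |f y|) ^ 2 := by
  rcases eq_or_ne (volume.real D) 0 with h0 | h0
  · simp [shiftAverage, h0]
  have hfin : IsFiniteMeasure (volume.restrict D) := ⟨by simpa using hDf.lt_top⟩
  have hF : Integrable (fun p : Space N × Space N => |f (p.1 + p.2)|)
      ((volume.restrict U).prod (volume.restrict D)) := by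
    refine (integrable_prod_iff' ?_).2 ⟨?_, ?_⟩
    · exact ((hfm.comp (measurable_fst.add measurable_snd)).abs).aestronglyMeasurable
    · exact Eventually.of_forall fun z => (hf.comp_add_right z).abs.restrict
    · refine Integrable.of_bound (C := ∫ y, |f y|) ?_ (Eventually.of_forall fun z => ?_)
      · exact ((hfm.comp (measurable_fst.add measurable_snd)).abs.norm.stronglyMeasurable
          |>.integral_prod_left').aestronglyMeasurable
      · rw [Real.norm_of_nonneg (integral_nonneg fun _ => norm_nonneg _)]
        simp only [Real.norm_eq_abs, abs_abs]
        calc ∫ x in U, |f (x + z)| ≤ ∫ x, |f (x + z)| :=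
              setIntegral_le_integral (hf.comp_add_right z).abs
                (Eventually.of_forall fun _ => abs_nonneg _)
          _ = ∫ y, |f y| := integral_add_right_eq_self (fun y => |f y|) z
  have h1 : ∫ x in U, (∫ z in D, |f (x + z)|) ≤ volume.real D * ∫ y, |f y| := by
    rw [integral_integral_swap hF]
    calc ∫ z in D, ∫ x in U, |f (x + z)| ≤ ∫ z in D, ∫ y, |f y| := by
          refine integral_mono_of_nonneg (Eventually.of_forall fun z =>
            integral_nonneg fun _ => abs_nonneg _) (integrable_const _)
            (Eventually.of_forall fun z => ?_)
          calc ∫ x in U, |f (x + z)| ≤ ∫ x, |f (x + z)| :=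
                setIntegral_le_integral (hf.comp_add_right z).abs
                  (Eventually.of_forall fun _ => abs_nonneg _)
            _ = ∫ y, |f y| := integral_add_right_eq_self (fun y => |f y|) z
      _ = volume.real D * ∫ y, |f y| := by simp
  have hI0 : 0 ≤ ∫ y, |f y| := integral_nonneg fun _ => abs_nonneg _
  calc ∫ x in U, shiftAverage D f x ^ 2
      ≤ ∫ x in U, ((volume.real D)⁻¹ * ∫ y, |f y|) *
          ((volume.real D)⁻¹ * ∫ z in D, |f (x + z)|) := by
        refine integral_mono_of_nonneg (Eventually.of_forall fun _ => sq_nonneg _)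
          ((hF.integral_prod_left.const_mul _).const_mul _) (Eventually.of_forall fun x => ?_)
        simp only
        rw [← sq_abs, sq]
        refine mul_le_mul (abs_shiftAverage_le hf x) ?_ (abs_nonneg _) (by positivity)
        rw [shiftAverage, abs_mul, abs_of_nonneg (by positivity : 0 ≤ (volume.real D)⁻¹)]
        exact mul_le_mul_of_nonneg_left abs_integral_le_integral_abs (by positivity)
    _ = ((volume.real D)⁻¹ * ∫ y, |f y|) * ((volume.real D)⁻¹ *
          ∫ x in U, ∫ z in D, |f (x + z)|) := by
        rw [integral_const_mul, integral_const_mul]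
    _ ≤ ((volume.real D)⁻¹ * ∫ y, |f y|) * ((volume.real D)⁻¹ *
          (volume.real D * ∫ y, |f y|)) := by gcongr
    _ = (volume.real D)⁻¹ * (∫ y, |f y|) ^ 2 := by
        field_simp

/-- The difference is a mean of increments; Cauchy–Schwarz in `z`, then Fubini, reduces it to the
bound `B` for each single shift. -/
theorem integral_sq_shiftAverage_sub_le {f : Space N → ℝ} (hfm : Measurable f)
    (hf : MemLp f 2 volume) (hD : MeasurableSet D) (hD0 : volume.real D ≠ 0) (hDf : volume D ≠ ∞)
    {B : ℝ} (hB : ∀ z ∈ D, ∫ x in U, (f (x + z) - f x) ^ 2 ≤ B) :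
    IntegrableOn (fun x => (shiftAverage D f x - f x) ^ 2) U ∧
      ∫ x in U, (shiftAverage D f x - f x) ^ 2 ≤ B := by
  have hfin : IsFiniteMeasure (volume.restrict D) := ⟨by simpa using hDf.lt_top⟩
  have hm : Measurable (fun p : Space N × Space N => (f (p.1 + p.2) - f p.1) ^ 2) :=
    ((hfm.comp (measurable_fst.add measurable_snd)).sub (hfm.comp measurable_fst)).pow_const 2
  have hz : ∀ z, Integrable (fun x => (f (x + z) - f x) ^ 2) (volume.restrict U) := fun z =>
    (((hf.comp_measurePreserving (measurePreserving_add_right volume z)).sub hf).restrict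
      U).integrable_sq
  have hF : Integrable (fun p : Space N × Space N => (f (p.1 + p.2) - f p.1) ^ 2)
      ((volume.restrict U).prod (volume.restrict D)) := by
    refine (integrable_prod_iff' hm.aestronglyMeasurable).2 ⟨Eventually.of_forall hz, ?_⟩
    refine Integrable.of_bound (C := B) ?_ ?_
    · exact (hm.norm.stronglyMeasurable.integral_prod_left').aestronglyMeasurable
    · refine (ae_restrict_iff' hD).2 (Eventually.of_forall fun z hzD => ?_)
      rw [Real.norm_of_nonneg (integral_nonneg fun _ => norm_nonneg _)]
      simpa [Real.norm_of_nonneg (sq_nonneg _)] using hB z hzD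
  have hle : ∀ x, (shiftAverage D f x - f x) ^ 2
      ≤ (volume.real D)⁻¹ * ∫ z in D, (f (x + z) - f x) ^ 2 := fun x => by
    have h1 : MemLp (fun z => f (x + z)) 2 (volume.restrict D) := (memLp_comp_add hf x).restrict D
    have h2 : MemLp (fun z => f (x + z) - f x) 2 (volume.restrict D) := h1.sub (memLp_const _)
    have h3 : shiftAverage D f x - f x = (volume.real D)⁻¹ * ∫ z in D, (f (x + z) - f x) := by
      rw [integral_sub (h1.integrable (by norm_num)) (integrable_const _), shiftAverage, mul_sub]
      simp [hD0]
    rw [h3, mul_pow, sq (volume.real D)⁻¹, mul_assoc]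
    refine mul_le_mul_of_nonneg_left ?_ (by positivity)
    rw [inv_mul_le_iff₀ (by positivity)]
    simpa using sq_integral_le h2
  have hI := hF.integral_prod_left.const_mul (volume.real D)⁻¹
  refine ⟨hI.mono' ?_ (Eventually.of_forall fun x => ?_), ?_⟩
  · exact (((measurable_shiftAverage hfm).sub hfm).pow_const 2).aestronglyMeasurable
  · rw [Real.norm_of_nonneg (sq_nonneg _)]
    exact hle x
  calc ∫ x in U, (shiftAverage D f x - f x) ^ 2
      ≤ ∫ x in U, (volume.real D)⁻¹ * ∫ z in D, (f (x + z) - f x) ^ 2 :=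
        integral_mono_of_nonneg (Eventually.of_forall fun _ => sq_nonneg _) hI
          (Eventually.of_forall hle)
    _ = (volume.real D)⁻¹ * ∫ z in D, ∫ x in U, (f (x + z) - f x) ^ 2 := by
        rw [integral_const_mul, integral_integral_swap hF]
    _ ≤ (volume.real D)⁻¹ * ∫ z in D, B := by
        refine mul_le_mul_of_nonneg_left ?_ (by positivity)
        exact setIntegral_mono_on hF.integral_prod_right (integrable_const _) hD hB
    _ = B := by simp [hD0]

end Average

/-! ### Cones of admissible displacements -/

section Cover

/-- Near an interior point every short displacement is admissible. Near a boundary point, moving in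
a direction close to `ν` raises the height above the Lipschitz graph faster than the graph itself
can rise. -/
theorem IsBoundedRegularOpen.exists_local_cone (hΩ : IsBoundedRegularOpen Ω) {x₀ : Space N}
    (hx₀ : x₀ ∈ closure Ω) : ∃ r : ℝ, 0 < r ∧ ∃ (a : Space N) (b : ℝ), 0 < b ∧
      ∀ x ∈ Ω ∩ Metric.ball x₀ r, ∀ z ∈ Metric.ball a b, ∀ τ ∈ Icc (0 : ℝ) 1, x + τ • z ∈ Ω := by
  by_cases hx : x₀ ∈ Ω
  · obtain ⟨ε, hε, hball⟩ := Metric.isOpen_iff.1 hΩ.isOpen x₀ hx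
    refine ⟨ε / 2, by positivity, 0, ε / 2, by positivity, fun x hx z hz τ hτ => hball ?_⟩
    rw [Metric.mem_ball, dist_eq_norm]
    have h1 : ‖x - x₀‖ < ε / 2 := by simpa [dist_eq_norm] using hx.2
    have h2 : ‖z‖ < ε / 2 := by simpa using hz
    have h3 : ‖τ • z‖ ≤ ‖z‖ := by
      rw [norm_smul, Real.norm_of_nonneg hτ.1]
      exact mul_le_of_le_one_left (norm_nonneg _) hτ.2
    calc ‖x + τ • z - x₀‖ = ‖(x - x₀) + τ • z‖ := by congr 1; abel
      _ ≤ ‖x - x₀‖ + ‖τ • z‖ := norm_add_le _ _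
      _ < ε := by linarith
  · have hfr : x₀ ∈ frontier Ω := by
      rw [frontier, hΩ.isOpen.interior_eq]
      exact ⟨hx₀, hx⟩
    obtain ⟨ν, hν, r, hr, K, g, hg, hgr⟩ := hΩ.boundary x₀ hfr
    -- For `z = a ν + ζ` with `‖ζ‖ < b`, the height grows by at least `τ (a - b)`, while the
    -- projection moves by at most `2 τ b`, so the graph rises by at most `2 K τ b`. Thus `2 K b + b
    -- ≤ a` suffices. Since `b ≤ a = r/4`, the displaced point stays in the ball of radius `r`.
    let a : ℝ := r / 4
    let b : ℝ := a / (2 * K + 2)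
    have ha : 0 < a := by positivity
    have hb : 0 < b := by positivity
    have hKb : 2 * K * b + 2 * b = a := by simp only [b]; field_simp
    have hba : b ≤ a := by nlinarith [K.2]
    refine ⟨r / 2, by positivity, a • ν, b, hb, fun x hx z hz τ hτ => ?_⟩
    obtain ⟨ζ, rfl⟩ : ∃ ζ, z = a • ν + ζ := ⟨z - a • ν, by abel⟩
    have hζ : ‖ζ‖ < b := by simpa [dist_eq_norm] using hz
    have hx1 : x ∈ Metric.ball x₀ r := Metric.ball_subset_ball (by linarith) hx.2
    have hxn : ‖x - x₀‖ < r / 2 := by simpa [dist_eq_norm] using hx.2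
    have hxg := (hgr x hx1).1 hx.1
    have hzn : ‖τ • (a • ν + ζ)‖ ≤ a + b := by
      rw [norm_smul, Real.norm_of_nonneg hτ.1]
      refine (mul_le_of_le_one_left (norm_nonneg _) hτ.2).trans ((norm_add_le _ _).trans ?_)
      rw [norm_smul, hν, Real.norm_of_nonneg ha.le]
      linarith
    have hy : x + τ • (a • ν + ζ) ∈ Metric.ball x₀ r := by
      rw [Metric.mem_ball, dist_eq_norm]
      calc ‖x + τ • (a • ν + ζ) - x₀‖ = ‖(x - x₀) + τ • (a • ν + ζ)‖ := by congr 1; abel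
        _ ≤ ‖x - x₀‖ + ‖τ • (a • ν + ζ)‖ := norm_add_le _ _
        _ < r := by
          have : a = r / 4 := rfl
          linarith
    refine (hgr _ hy).2 ?_
    have hνν : inner ℝ ν ν = (1 : ℝ) := by rw [real_inner_self_eq_norm_sq, hν]; norm_num
    have hin : inner ℝ ν (x + τ • (a • ν + ζ)) = inner ℝ ν x + τ * (a + inner ℝ ν ζ) := by
      rw [inner_add_right, real_inner_smul_right, inner_add_right, real_inner_smul_right, hνν,
        mul_one]
    have hνζ : |inner ℝ ν ζ| ≤ ‖ζ‖ := by
      simpa [hν] using abs_real_inner_le_norm ν ζ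
    have hproj : (x + τ • (a • ν + ζ)) - inner ℝ ν (x + τ • (a • ν + ζ)) • ν
        = (x - inner ℝ ν x • ν) + τ • (ζ - inner ℝ ν ζ • ν) := by
      rw [hin]
      module
    have hdist : g ((x - inner ℝ ν x • ν) + τ • (ζ - inner ℝ ν ζ • ν))
        ≤ g (x - inner ℝ ν x • ν) + τ * (2 * K * b) := by
      have h1 := hg.dist_le_mul ((x - inner ℝ ν x • ν) + τ • (ζ - inner ℝ ν ζ • ν))
        (x - inner ℝ ν x • ν)
      rw [Real.dist_eq, dist_eq_norm, add_sub_cancel_left, norm_smul,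
        Real.norm_of_nonneg hτ.1] at h1
      have h2 : ‖ζ - inner ℝ ν ζ • ν‖ ≤ 2 * b := by
        refine (norm_sub_le _ _).trans ?_
        rw [norm_smul, hν, mul_one, Real.norm_eq_abs]
        linarith
      have h3 : (K : ℝ) * (τ * ‖ζ - inner ℝ ν ζ • ν‖) ≤ K * (τ * (2 * b)) := by
        have := hτ.1
        gcongr
      nlinarith [le_abs_self (g ((x - inner ℝ ν x • ν) + τ • (ζ - inner ℝ ν ζ • ν))
        - g (x - inner ℝ ν x • ν))]
    rw [hproj, hin]
    have h4 : τ * (2 * K * b) ≤ τ * (a + inner ℝ ν ζ) := by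
      refine mul_le_mul_of_nonneg_left ?_ hτ.1
      linarith [neg_abs_le (inner ℝ ν ζ)]
    linarith

theorem IsBoundedRegularOpen.exists_cone_cover (hΩ : IsBoundedRegularOpen Ω) :
    ∃ (F : Finset (Space N)) (U : Space N → Set (Space N)) (a : Space N → Space N)
      (b : Space N → ℝ), (∀ i, IsOpen (U i)) ∧ (∀ i, U i ⊆ Ω) ∧ (∀ x ∈ Ω, ∃ i ∈ F, x ∈ U i) ∧
      (∀ i ∈ F, 0 < b i) ∧ ∀ i ∈ F, ∀ x ∈ U i, ∀ z ∈ Metric.ball (a i) (b i),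
        ∀ τ ∈ Icc (0 : ℝ) 1, x + τ • z ∈ Ω := by
  have hloc : ∀ x₀ : Space N, ∃ (r : ℝ) (a : Space N) (b : ℝ), x₀ ∈ closure Ω → 0 < r ∧ 0 < b ∧
      ∀ x ∈ Ω ∩ Metric.ball x₀ r, ∀ z ∈ Metric.ball a b, ∀ τ ∈ Icc (0 : ℝ) 1,
        x + τ • z ∈ Ω := fun x₀ => by
    by_cases hx : x₀ ∈ closure Ω
    · obtain ⟨r, hr, a, b, hb, h⟩ := hΩ.exists_local_cone hx
      exact ⟨r, a, b, fun _ => ⟨hr, hb, h⟩⟩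
    · exact ⟨0, 0, 0, fun h => absurd h hx⟩
  choose r a b h using hloc
  have hcomp : IsCompact (closure Ω) := hΩ.isBounded.isCompact_closure
  obtain ⟨F, hF, hcov⟩ := hcomp.elim_nhds_subcover (fun x => Metric.ball x (r x))
    (fun x hx => Metric.ball_mem_nhds x (h x hx).1)
  refine ⟨F, fun i => Ω ∩ Metric.ball i (r i), a, b, fun i => hΩ.isOpen.inter Metric.isOpen_ball,
    fun i => inter_subset_left, fun x hx => ?_, fun i hi => (h i (hF i hi)).2.1,
    fun i hi => (h i (hF i hi)).2.2⟩
  obtain ⟨i, hi, hxi⟩ := mem_iUnion₂.1 (hcov (subset_closure hx))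
  exact ⟨i, hi, hx, hxi⟩

end Cover

end

section

/-! ### Hilbert–Schmidt operators are compact -/

section HilbertSchmidt

variable {H F : Type*} [NormedAddCommGroup H] [InnerProductSpace ℝ H]
  [NormedAddCommGroup F] [NormedSpace ℝ F] [CompleteSpace F]

/-- A Hilbert–Schmidt operator is compact. -/
theorem isCompactOperator_of_summable {ι : Type*} (b : HilbertBasis ι ℝ H) (T : H →L[ℝ] F)
    (hT : Summable fun i => ‖T (b i)‖ ^ 2) : IsCompactOperator T := by
  let S : Finset ι → H →L[ℝ] F := fun s => ∑ i ∈ s, (innerSL ℝ (b i)).smulRight (T (b i))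
  have hS : ∀ s, IsCompactOperator (S s) := fun s => by
    classical
    induction s using Finset.induction_on with
    | empty => simpa [S] using isCompactOperator_zero
    | insert i s hi ih =>
      have h1 : IsCompactOperator ((innerSL ℝ (b i)).smulRight (T (b i))) := by
        have h2 : IsCompactOperator ((1 : ℝ →L[ℝ] ℝ).smulRight (T (b i))) :=
          isCompactOperator_of_locallyCompactSpace_rng _
        exact h2.comp_clm (innerSL ℝ (b i))
      have h3 : S (insert i s) = (innerSL ℝ (b i)).smulRight (T (b i)) + S s :=
        Finset.sum_insert hi
      rw [h3]
      exact h1.add ih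
  -- The finite rank truncations converge in operator norm: Cauchy–Schwarz bounds the remainder by
  -- the tail of `∑ ‖T b_i‖²` and by Bessel's inequality for `v`.
  refine isCompactOperator_of_tendsto (F := S) (l := atTop) ?_ (Eventually.of_forall hS)
  rw [tendsto_iff_norm_sub_tendsto_zero, Metric.tendsto_nhds]
  intro ε hε
  obtain ⟨s₀, hs₀⟩ := summable_iff_vanishing_norm.1 hT ((ε / 2) ^ 2) (by positivity)
  filter_upwards [eventually_ge_atTop s₀] with s hs
  rw [dist_zero_right, norm_norm]
  refine lt_of_le_of_lt (ContinuousLinearMap.opNorm_le_bound _ (by positivity : 0 ≤ ε / 2)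
    fun v => ?_) (half_lt_self hε)
  have hsum : HasSum (fun i => inner ℝ (b i) v • T (b i)) (T v) := by
    have := (b.hasSum_repr v).mapL T
    simpa [b.repr_apply_apply] using this
  have hlim : Tendsto (fun s' : Finset ι => ‖S s v - ∑ i ∈ s', inner ℝ (b i) v • T (b i)‖) atTop
      (𝓝 ‖S s v - T v‖) := (tendsto_const_nhds.sub hsum).norm
  refine le_of_tendsto hlim ?_
  filter_upwards [eventually_ge_atTop s] with s' hs'
  have hSv : S s v = ∑ i ∈ s, inner ℝ (b i) v • T (b i) := by
    simp [S]
  classical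
  rw [hSv, norm_sub_rev, ← Finset.sum_sdiff hs', add_sub_cancel_right]
  have h1 : ∑ i ∈ s' \ s, ‖T (b i)‖ ^ 2 ≤ (ε / 2) ^ 2 := by
    have := hs₀ (s' \ s) (Finset.disjoint_of_subset_right hs Finset.sdiff_disjoint)
    exact ((le_abs_self _).trans_lt this).le
  have h2 : ∑ i ∈ s' \ s, |inner ℝ (b i) v| ^ 2 ≤ ‖v‖ ^ 2 := by
    have := b.orthonormal.sum_inner_products_le (x := v) (s := s' \ s)
    simpa using this
  calc ‖∑ i ∈ s' \ s, inner ℝ (b i) v • T (b i)‖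
      ≤ ∑ i ∈ s' \ s, |inner ℝ (b i) v| * ‖T (b i)‖ := by
        refine (norm_sum_le _ _).trans (le_of_eq (Finset.sum_congr rfl fun i _ => ?_))
        rw [norm_smul, Real.norm_eq_abs]
    _ ≤ ε / 2 * ‖v‖ := by
        refine abs_le_of_sq_le_sq' ?_ (by positivity) |>.2
        refine (Finset.sum_mul_sq_le_sq_mul_sq _ _ _).trans ?_
        rw [mul_pow, mul_comm]
        exact mul_le_mul h1 h2 (Finset.sum_nonneg fun _ _ => by positivity) (by positivity)

variable {X : Type*} [MeasurableSpace X] {μ : Measure X} [IsFiniteMeasure μ]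

/-- A bounded measurable kernel defines a compact operator on `L^2` of a finite measure. -/
theorem exists_compact_kernelOperator {k : X → X → ℝ} (hk : Measurable (Function.uncurry k))
    {M : ℝ} (hM : ∀ x y, |k x y| ≤ M) :
    ∃ K : Lp ℝ 2 μ →L[ℝ] Lp ℝ 2 μ, IsCompactOperator K ∧
      ∀ u : Lp ℝ 2 μ, K u =ᵐ[μ] fun x => ∫ y, k x y * u y ∂μ := by
  have hkx : ∀ x, MemLp (k x) 2 μ := fun x =>
    MemLp.of_bound (hk.comp measurable_prodMk_left).aestronglyMeasurable M
      (Eventually.of_forall fun y => hM x y)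
  have hkn : ∀ x, ‖(hkx x).toLp (k x)‖ ^ 2 ≤ μ.real univ * M ^ 2 := fun x => by
    rw [norm_toLp_sq]
    calc ∫ y, k x y ^ 2 ∂μ ≤ ∫ _, M ^ 2 ∂μ :=
          integral_mono_of_nonneg (Eventually.of_forall fun _ => sq_nonneg _) (integrable_const _)
            (Eventually.of_forall fun y => sq_le_sq' (abs_le.1 (hM x y)).1 (abs_le.1 (hM x y)).2)
      _ = μ.real univ * M ^ 2 := by simp
  have hin : ∀ x (u : Lp ℝ 2 μ), ∫ y, k x y * u y ∂μ = inner ℝ ((hkx x).toLp (k x)) u :=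
    fun x u => by rw [← inner_toLp_toLp (hkx x) (Lp.memLp u), Lp.toLp_coeFn]
  let A : ℝ := Real.sqrt (μ.real univ * M ^ 2)
  have hb : ∀ x (u : Lp ℝ 2 μ), ‖∫ y, k x y * u y ∂μ‖ ≤ A * ‖u‖ := fun x u => by
    rw [hin]
    refine (norm_inner_le_norm _ _).trans (mul_le_mul_of_nonneg_right ?_ (norm_nonneg _))
    exact Real.le_sqrt_of_sq_le (hkn x)
  have hmeas : ∀ u : Lp ℝ 2 μ, AEStronglyMeasurable (fun x => ∫ y, k x y * u y ∂μ) μ := fun u => by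
    have : StronglyMeasurable (fun p : X × X => k p.1 p.2 * u p.2) :=
      (hk.mul ((Lp.stronglyMeasurable u).measurable.comp measurable_snd)).stronglyMeasurable
    exact (this.integral_prod_right (ν := μ)).aestronglyMeasurable
  have hmem : ∀ u : Lp ℝ 2 μ, MemLp (fun x => ∫ y, k x y * u y ∂μ) 2 μ := fun u =>
    MemLp.of_bound (hmeas u) (A * ‖u‖) (Eventually.of_forall fun x => hb x u)
  let L : Lp ℝ 2 μ →ₗ[ℝ] Lp ℝ 2 μ :=
    { toFun := fun u => (hmem u).toLp _
      map_add' := fun u v => by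
        rw [← MemLp.toLp_add, MemLp.toLp_eq_toLp_iff]
        refine Eventually.of_forall fun x => ?_
        simp only [hin, inner_add_right, Pi.add_apply]
      map_smul' := fun c u => by
        rw [RingHom.id_apply, ← MemLp.toLp_const_smul, MemLp.toLp_eq_toLp_iff]
        refine Eventually.of_forall fun x => ?_
        simp only [hin, inner_smul_right, Pi.smul_apply, smul_eq_mul] }
  have hL : ∀ u, ‖L u‖ ^ 2 = ∫ x, (∫ y, k x y * u y ∂μ) ^ 2 ∂μ := fun u => norm_toLp_sq (hmem u)
  have hLb : ∀ u, ‖L u‖ ≤ Real.sqrt (μ.real univ) * A * ‖u‖ := fun u => by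
    refine abs_le_of_sq_le_sq' ?_ (by positivity) |>.2
    rw [hL, mul_assoc, mul_pow, Real.sq_sqrt measureReal_nonneg]
    calc ∫ x, (∫ y, k x y * u y ∂μ) ^ 2 ∂μ ≤ ∫ _, (A * ‖u‖) ^ 2 ∂μ :=
          integral_mono_of_nonneg (Eventually.of_forall fun _ => sq_nonneg _) (integrable_const _)
            (Eventually.of_forall fun x => sq_le_sq' (abs_le.1 (hb x u)).1 (abs_le.1 (hb x u)).2)
      _ = μ.real univ * (A * ‖u‖) ^ 2 := by simp
  let K := L.mkContinuous _ hLb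
  refine ⟨K, ?_, fun u => (hmem u).coeFn_toLp⟩
  obtain ⟨w, b, -⟩ := exists_hilbertBasis ℝ (Lp ℝ 2 μ)
  refine isCompactOperator_of_summable b K ?_
  -- Summing `⟪k_x, b_i⟫²` under the integral, Bessel's inequality leaves `∫ ‖k_x‖² dx`, which is
  -- finite for a bounded kernel on a finite measure.
  refine summable_of_sum_le (c := μ.real univ * (μ.real univ * M ^ 2))
    (fun i => by positivity) fun s => ?_
  have e : ∀ i, ‖K (b i)‖ ^ 2 = ∫ x, inner ℝ ((hkx x).toLp (k x)) (b i) ^ 2 ∂μ := fun i => by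
    simp only [← hin]
    exact hL (b i)
  simp only [e]
  rw [← integral_finsetSum]
  · calc ∫ x, ∑ i ∈ s, inner ℝ ((hkx x).toLp (k x)) (b i) ^ 2 ∂μ ≤ ∫ _, μ.real univ * M ^ 2 ∂μ := by
          refine integral_mono_of_nonneg (Eventually.of_forall fun _ =>
            Finset.sum_nonneg fun _ _ => sq_nonneg _) (integrable_const _)
            (Eventually.of_forall fun x => ?_)
          refine le_trans ?_ (hkn x)
          have := b.orthonormal.sum_inner_products_le (x := (hkx x).toLp (k x)) (s := s)
          simpa [real_inner_comm] using this
      _ = μ.real univ * (μ.real univ * M ^ 2) := by simp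
  · intro i _
    simp only [← hin]
    exact (hmem (b i)).integrable_sq

end HilbertSchmidt

variable {N : ℕ} {Ω U D : Set (Space N)}

/-! ### Nash's inequality and compact approximation -/

section Patch

theorem real_volume_ball (c : Space N) {r : ℝ} (hr : 0 < r) :
    volume.real (Metric.ball c r) = r ^ N * volume.real (Metric.ball (0 : Space N) 1) := by
  rw [Measure.real, Measure.addHaar_ball_of_pos _ _ hr, ENNReal.toReal_mul,
    ENNReal.toReal_ofReal (by positivity), finrank_euclideanSpace_fin, Measure.real]

theorem real_volume_ball_pos (c : Space N) {r : ℝ} (hr : 0 < r) :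
    0 < volume.real (Metric.ball c r) :=
  ENNReal.toReal_pos (Metric.measure_ball_pos volume c hr).ne' measure_ball_lt_top.ne

theorem measurable_indicator (hΩ : MeasurableSet Ω) (u : L2 Ω) : Measurable (Ω.indicator u) :=
  (Lp.stronglyMeasurable u).measurable.indicator hΩ

/-- Displacements in the cone scaled by `t ≤ 1` remain admissible and have length at most `t (‖a‖ +
b)`, so the translation estimate bounds every increment entering the average. -/
theorem integral_sq_patch_le (hΩ : MeasurableSet Ω) (hfin : volume Ω ≠ ∞)
    {z : L2 Ω × L2Vec Ω} (hz : z ∈ sobolevH1 Ω) (hUo : IsOpen U) {a : Space N} {b : ℝ}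
    (hb : 0 < b)
    (hcone : ∀ x ∈ U, ∀ y ∈ Metric.ball a b, ∀ τ ∈ Icc (0 : ℝ) 1, x + τ • y ∈ Ω) {t : ℝ}
    (ht0 : 0 < t) (ht1 : t ≤ 1) :
    IntegrableOn (fun x => (shiftAverage (Metric.ball (t • a) (t * b)) (Ω.indicator z.1) x
        - Ω.indicator z.1 x) ^ 2) U ∧
      ∫ x in U, (shiftAverage (Metric.ball (t • a) (t * b)) (Ω.indicator z.1) x
        - Ω.indicator z.1 x) ^ 2 ≤ (t * (‖a‖ + b) * ‖z.2‖) ^ 2 := by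
  refine integral_sq_shiftAverage_sub_le (measurable_indicator hΩ z.1) (memLp_indicator hΩ z.1)
    measurableSet_ball (real_volume_ball_pos _ (by positivity)).ne' measure_ball_lt_top.ne ?_
  intro y hy
  have hy' : t⁻¹ • y ∈ Metric.ball a b := by
    rw [Metric.mem_ball, dist_eq_norm] at hy ⊢
    have : t⁻¹ • y - a = t⁻¹ • (y - t • a) := by
      rw [smul_sub, smul_smul, inv_mul_cancel₀ ht0.ne', one_smul]
    rw [this, norm_smul, norm_inv, Real.norm_of_nonneg ht0.le, inv_mul_lt_iff₀ ht0]
    exact hy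
  have hy2 : ‖y‖ ≤ t * (‖a‖ + b) := by
    rw [Metric.mem_ball, dist_eq_norm] at hy
    have h1 : ‖y‖ ≤ ‖y - t • a‖ + ‖t • a‖ := by
      simpa using norm_add_le (y - t • a) (t • a)
    rw [norm_smul, Real.norm_of_nonneg ht0.le] at h1
    linarith
  have hU : ∀ x ∈ U, ∀ τ ∈ Icc (0 : ℝ) 1, x + τ • y ∈ Ω := fun x hx τ hτ => by
    have := hcone x hx _ hy' (τ * t) ⟨mul_nonneg hτ.1 ht0.le, mul_le_one₀ hτ.2 ht0.le ht1⟩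
    rwa [smul_smul, mul_assoc, mul_inv_cancel₀ ht0.ne', mul_one] at this
  have h1 := norm_translate_sub_le hΩ hfin hz hUo hU
  rw [← norm_toLp_sq (memLp_translate_sub (U := U) hΩ z.1 y)]
  refine pow_le_pow_left₀ (norm_nonneg _) (h1.trans ?_) 2
  rw [mul_comm]
  gcongr

/-- **Nash's inequality** on bounded Lipschitz sets, at every scale `t`. -/
theorem IsBoundedRegularOpen.exists_nash (hΩ : IsBoundedRegularOpen Ω) :
    ∃ C : ℝ, 0 < C ∧ ∀ t : ℝ, 0 < t → t ≤ 1 → ∀ z ∈ sobolevH1 Ω,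
      ‖z.1‖ ^ 2 ≤ C * ((t ^ N)⁻¹ * (∫ x in Ω, |z.1 x|) ^ 2 + t ^ 2 * ‖z.2‖ ^ 2) := by
  obtain ⟨F, U, a, b, hUo, hUΩ, hcov, hb, hcone⟩ := hΩ.exists_cone_cover
  have hm := hΩ.isOpen.measurableSet
  have hfin : volume Ω ≠ ∞ := hΩ.isBounded.measure_lt_top.ne
  let β : Space N → ℝ := fun i => volume.real (Metric.ball (0 : Space N) (b i))
  -- Each patch contributes twice its averaging constant and twice its increment constant; the `1`
  -- ensures positivity even for an empty cover.
  refine ⟨1 + ∑ i ∈ F, (2 * (β i)⁻¹ + 2 * (‖a i‖ + b i) ^ 2), ?_, ?_⟩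
  · have : 0 ≤ ∑ i ∈ F, (2 * (β i)⁻¹ + 2 * (‖a i‖ + b i) ^ 2) :=
      Finset.sum_nonneg fun i _ => by positivity
    linarith
  intro t ht0 ht1 z hz
  set u := Ω.indicator z.1 with hu
  have hu2 : MemLp u 2 volume := memLp_indicator hm z.1
  have hu1 : Integrable u volume := integrable_indicator_of_memLp hm hfin (Lp.memLp z.1)
  have hI : ∫ y, |u y| = ∫ x in Ω, |z.1 x| := by
    rw [← integral_indicator hm]
    congr 1
    ext x
    by_cases hx : x ∈ Ω <;> simp [hu, hx]
  set I := ∫ x in Ω, |z.1 x| with hIdef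
  have hpatch : ∀ i ∈ F, ∫ x in U i, u x ^ 2
      ≤ (2 * (β i)⁻¹ + 2 * (‖a i‖ + b i) ^ 2) * ((t ^ N)⁻¹ * I ^ 2 + t ^ 2 * ‖z.2‖ ^ 2) := by
    intro i hi
    obtain ⟨h1, h2⟩ := integral_sq_patch_le hm hfin hz (hUo i) (hb i hi) (hcone i hi) ht0 ht1
    rw [← hu] at h1 h2
    set A := shiftAverage (Metric.ball (t • a i) (t * b i)) u with hA
    -- The averaging ball has radius `t b_i` and volume `t^N β_i`; this is the source of the factor
    -- `t^(-N)`.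
    have h3 := integral_sq_shiftAverage_le (U := U i) (D := Metric.ball (t • a i) (t * b i))
      (measurable_indicator hm z.1) hu1 measure_ball_lt_top.ne
    rw [← hu, ← hA, hI, real_volume_ball _ (mul_pos ht0 (hb i hi)), mul_pow, mul_assoc,
      ← real_volume_ball (0 : Space N) (hb i hi), mul_inv] at h3
    have hAm : AEStronglyMeasurable A (volume.restrict (U i)) :=
      (measurable_shiftAverage (measurable_indicator hm z.1)).aestronglyMeasurable
    have hd : MemLp (fun x => A x - u x) 2 (volume.restrict (U i)) :=
      (memLp_two_iff_integrable_sq (hAm.sub (hu2.restrict _).aestronglyMeasurable)).2 h1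
    have hA2 : Integrable (fun x => A x ^ 2) (volume.restrict (U i)) := by
      have := (hd.add (hu2.restrict (U i))).integrable_sq
      simpa using this
    calc ∫ x in U i, u x ^ 2 ≤ ∫ x in U i, (2 * (A x - u x) ^ 2 + 2 * A x ^ 2) := by
          refine integral_mono (hu2.restrict _).integrable_sq ((h1.const_mul 2).add
            (hA2.const_mul 2)) fun x => ?_
          simp only
          nlinarith [sq_nonneg (u x - 2 * A x)]
      _ = 2 * (∫ x in U i, (A x - u x) ^ 2) + 2 * ∫ x in U i, A x ^ 2 := by
          rw [integral_add (h1.const_mul 2) (hA2.const_mul 2), integral_const_mul,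
            integral_const_mul]
      _ ≤ 2 * (t * (‖a i‖ + b i) * ‖z.2‖) ^ 2 + 2 * ((t ^ N)⁻¹ * (β i)⁻¹ * I ^ 2) := by
          gcongr
      _ ≤ _ := by
          have e1 : 0 ≤ (β i)⁻¹ * (t ^ 2 * ‖z.2‖ ^ 2) := by positivity
          have e2 : 0 ≤ (‖a i‖ + b i) ^ 2 * ((t ^ N)⁻¹ * I ^ 2) := by positivity
          nlinarith
  have hX : 0 ≤ (t ^ N)⁻¹ * I ^ 2 + t ^ 2 * ‖z.2‖ ^ 2 := by positivity
  calc ‖z.1‖ ^ 2 = ∫ x in Ω, u x ^ 2 := by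
        rw [← Lp.toLp_coeFn z.1 (Lp.memLp z.1), norm_toLp_sq]
        refine setIntegral_congr_fun hm fun x hx => ?_
        simp [hu, hx]
    _ ≤ ∫ x in Ω, ∑ i ∈ F, (U i).indicator (fun x => u x ^ 2) x := by
        refine setIntegral_mono_on (hu2.restrict Ω).integrable_sq
          (integrable_finsetSum _ fun i _ => (hu2.integrable_sq.indicator
            (hUo i).measurableSet).restrict) hm fun x hx => ?_
        obtain ⟨i, hi, hxi⟩ := hcov x hx
        refine le_trans (le_of_eq ?_) (Finset.single_le_sum (f := fun i =>
          (U i).indicator (fun x => u x ^ 2) x) (fun j _ =>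
            indicator_nonneg (fun _ _ => sq_nonneg _) x) hi)
        simp [hxi]
    _ = ∑ i ∈ F, ∫ x in U i, u x ^ 2 := by
        rw [integral_finsetSum _ fun i _ => (hu2.integrable_sq.indicator
          (hUo i).measurableSet).restrict]
        refine Finset.sum_congr rfl fun i _ => ?_
        rw [integral_indicator (hUo i).measurableSet, Measure.restrict_restrict
          (hUo i).measurableSet, inter_eq_left.2 (hUΩ i)]
    _ ≤ ∑ i ∈ F, (2 * (β i)⁻¹ + 2 * (‖a i‖ + b i) ^ 2) *
          ((t ^ N)⁻¹ * I ^ 2 + t ^ 2 * ‖z.2‖ ^ 2) := Finset.sum_le_sum hpatch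
    _ ≤ _ := by
        rw [← Finset.sum_mul]
        exact mul_le_mul_of_nonneg_right (by linarith) hX

/-- On bounded Lipschitz sets the identity is approximated by compact operators on `H^1`. -/
theorem IsBoundedRegularOpen.exists_compact_approx (hΩ : IsBoundedRegularOpen Ω) {ε : ℝ}
    (hε : 0 < ε) : ∃ K : L2 Ω →L[ℝ] L2 Ω, IsCompactOperator K ∧
      ∀ z ∈ sobolevH1 Ω, ‖z.1 - K z.1‖ ≤ ε * ‖z.2‖ := by
  obtain ⟨F, U, a, b, hUo, hUΩ, hcov, hb, hcone⟩ := hΩ.exists_cone_cover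
  have hm := hΩ.isOpen.measurableSet
  have hfin : volume Ω ≠ ∞ := hΩ.isBounded.measure_lt_top.ne
  have : IsFiniteMeasure (volume.restrict Ω) := ⟨by simpa using hfin.lt_top⟩
  let S : ℝ := ∑ i ∈ F, (‖a i‖ + b i) ^ 2
  have hS : 0 ≤ S := Finset.sum_nonneg fun _ _ => sq_nonneg _
  -- Small enough that `t² S ≤ (t (S + 1))² ≤ ε²`, and at most `1` so that the scaled cones are
  -- admissible.
  let t : ℝ := min 1 (ε / (S + 1))
  have ht0 : 0 < t := lt_min one_pos (by positivity)
  have ht1 : t ≤ 1 := min_le_left _ _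
  have htε : t * (S + 1) ≤ ε := (le_div_iff₀ (by positivity)).1 (min_le_right _ _)
  let D : Space N → Set (Space N) := fun i => Metric.ball (t • a i) (t * b i)
  let χ : Space N → Space N → ℝ := fun i => (U i).indicator (fun _ => 1)
  have hχ0 : ∀ i x, 0 ≤ χ i x := fun i x => indicator_nonneg (fun _ _ => zero_le_one) x
  have hχm : ∀ i, Measurable (χ i) := fun i => measurable_const.indicator (hUo i).measurableSet
  let m : Space N → ℝ := fun x => ∑ i ∈ F, χ i x
  have hm0 : ∀ x, 0 ≤ m x := fun x => Finset.sum_nonneg fun i _ => hχ0 i x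
  have hmm : Measurable m := Finset.measurable_sum _ fun i _ => hχm i
  -- A merely measurable partition of unity suffices: the averages are glued together without being
  -- differentiated.
  let w : Space N → Space N → ℝ := fun i x => χ i x / m x
  have hw0 : ∀ i x, 0 ≤ w i x := fun i x => div_nonneg (hχ0 i x) (hm0 x)
  have hw1 : ∀ i ∈ F, ∀ x, w i x ≤ 1 := fun i hi x =>
    div_le_one_of_le₀ (Finset.single_le_sum (f := fun i => χ i x) (fun j _ => hχ0 j x) hi) (hm0 x)
  have hwm : ∀ i, Measurable (w i) := fun i => (hχm i).div hmm
  have hwU : ∀ i, ∀ x ∉ U i, w i x = 0 := fun i x hx => by simp [w, χ, hx]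
  have hwsum : ∀ x ∈ Ω, ∑ i ∈ F, w i x = 1 := fun x hx => by
    obtain ⟨i, hi, hxi⟩ := hcov x hx
    have h1 : 1 ≤ m x := by
      refine le_trans (le_of_eq ?_) (Finset.single_le_sum (f := fun i => χ i x)
        (fun j _ => hχ0 j x) hi)
      simp [χ, hxi]
    simp only [w]
    rw [← Finset.sum_div]
    exact div_self (by linarith : m x ≠ 0)
  let k : Space N → Space N → ℝ := fun x y =>
    ∑ i ∈ F, w i x * ((volume.real (D i))⁻¹ * (D i).indicator (fun _ => 1) (y - x))
  have hk : Measurable (Function.uncurry k) := by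
    refine Finset.measurable_sum _ fun i _ => ?_
    refine ((hwm i).comp measurable_fst).mul (Measurable.const_mul ?_ _)
    exact (measurable_const.indicator (s := D i) measurableSet_ball).comp
      (measurable_snd.sub measurable_fst)
  have hkM : ∀ x y, |k x y| ≤ ∑ i ∈ F, (volume.real (D i))⁻¹ := fun x y => by
    refine (Finset.abs_sum_le_sum_abs _ _).trans (Finset.sum_le_sum fun i hi => ?_)
    have h1 : (D i).indicator (fun _ => (1 : ℝ)) (y - x) ≤ 1 :=
      indicator_le_self' (fun _ _ => zero_le_one) _
    have h2 : 0 ≤ (D i).indicator (fun _ => (1 : ℝ)) (y - x) :=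
      indicator_nonneg (fun _ _ => zero_le_one) _
    rw [abs_of_nonneg (mul_nonneg (hw0 i x) (mul_nonneg (by positivity) h2))]
    calc w i x * ((volume.real (D i))⁻¹ * (D i).indicator (fun _ => 1) (y - x))
        ≤ 1 * ((volume.real (D i))⁻¹ * 1) :=
          mul_le_mul (hw1 i hi x) (mul_le_mul_of_nonneg_left h1 (by positivity))
            (mul_nonneg (by positivity) h2) zero_le_one
      _ = _ := by ring
  obtain ⟨K, hKc, hK⟩ := exists_compact_kernelOperator (μ := volume.restrict Ω) hk hkM
  refine ⟨K, hKc, fun z hz => ?_⟩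
  set u := Ω.indicator z.1 with hu
  have hu2 : MemLp u 2 volume := memLp_indicator hm z.1
  have hu1 : Integrable u volume := integrable_indicator_of_memLp hm hfin (Lp.memLp z.1)
  let A : Space N → Space N → ℝ := fun i => shiftAverage (D i) u
  have hKu : ∀ x, ∫ y in Ω, k x y * z.1 y = ∑ i ∈ F, w i x * A i x := fun x => by
    have e1 : ∫ y in Ω, k x y * z.1 y = ∫ y, ∑ i ∈ F, w i x * ((volume.real (D i))⁻¹ *
        ((D i).indicator (fun _ => 1) (y - x) * u y)) := by
      rw [← integral_indicator hm]
      congr 1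
      ext y
      by_cases hy : y ∈ Ω <;> simp [hu, hy, k, Finset.sum_mul, mul_assoc]
    have hi : ∀ i, Integrable (fun y => (D i).indicator (fun _ => (1 : ℝ)) (y - x) * u y)
        volume := fun i => by
      refine hu1.bdd_mul (c := 1) ?_ (Eventually.of_forall fun y => ?_)
      · exact ((measurable_const.indicator (s := D i) measurableSet_ball).comp
          (measurable_id.sub_const x)).aestronglyMeasurable
      · rw [Real.norm_of_nonneg (indicator_nonneg (fun _ _ => zero_le_one) _)]
        exact indicator_le_self' (fun _ _ => zero_le_one) _
    rw [e1, integral_finsetSum _ fun i _ => ((hi i).const_mul _).const_mul _]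
    refine Finset.sum_congr rfl fun i _ => ?_
    rw [integral_const_mul, integral_const_mul]
    congr 2
    rw [← integral_add_left_eq_self _ x, ← integral_indicator measurableSet_ball]
    congr 1
    ext y
    by_cases hy : y ∈ D i <;> simp [hy, D]
  have hpatch : ∀ i ∈ F, IntegrableOn (fun x => (A i x - u x) ^ 2) (U i) ∧
      ∫ x in U i, (A i x - u x) ^ 2 ≤ (t * (‖a i‖ + b i) * ‖z.2‖) ^ 2 := fun i hi =>
    integral_sq_patch_le hm hfin hz (hUo i) (hb i hi) (hcone i hi) ht0 ht1
  have hind : ∀ i ∈ F, Integrable (fun x => (U i).indicator (fun x => (A i x - u x) ^ 2) x)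
      (volume.restrict Ω) := fun i hi =>
    ((integrable_indicator_iff (hUo i).measurableSet).2 (hpatch i hi).1).restrict
  refine abs_le_of_sq_le_sq' ?_ (by positivity) |>.2
  have e0 : ‖z.1 - K z.1‖ ^ 2 = ∫ x in Ω, (∑ i ∈ F, w i x * (A i x - u x)) ^ 2 := by
    rw [← Lp.toLp_coeFn (z.1 - K z.1) (Lp.memLp _), norm_toLp_sq]
    refine setIntegral_congr_ae hm ?_
    filter_upwards [(ae_restrict_iff' hm).1 (Lp.coeFn_sub z.1 (K z.1)),
      (ae_restrict_iff' hm).1 (hK z.1)] with x h1 h2 hx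
    rw [h1 hx, Pi.sub_apply, h2 hx, hKu x]
    have : ∑ i ∈ F, w i x * (A i x - u x) = ∑ i ∈ F, w i x * A i x - z.1 x := by
      simp only [mul_sub, Finset.sum_sub_distrib]
      rw [← Finset.sum_mul, hwsum x hx, one_mul]
      simp [hu, hx]
    rw [this]
    ring
  rw [e0]
  -- Convexity of the square with weights `w i x` of sum `1`, then `w i x ≤ 1` on `U i` and `w i x =
  -- 0` off it.
  calc ∫ x in Ω, (∑ i ∈ F, w i x * (A i x - u x)) ^ 2
      ≤ ∫ x in Ω, ∑ i ∈ F, (U i).indicator (fun x => (A i x - u x) ^ 2) x := by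
        refine integral_mono_of_nonneg (Eventually.of_forall fun _ => sq_nonneg _)
          (integrable_finsetSum _ hind) ((ae_restrict_iff' hm).2 (Eventually.of_forall
            fun x hx => ?_))
        refine (Real.pow_arith_mean_le_arith_mean_pow_of_even F (fun i => w i x)
          (fun i => A i x - u x) (fun i _ => hw0 i x) (hwsum x hx) even_two).trans
            (Finset.sum_le_sum fun i hi => ?_)
        by_cases hxi : x ∈ U i
        · rw [indicator_of_mem hxi]
          exact mul_le_of_le_one_left (sq_nonneg _) (hw1 i hi x)
        · rw [hwU i x hxi, indicator_of_notMem hxi, zero_mul]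
    _ = ∑ i ∈ F, ∫ x in U i, (A i x - u x) ^ 2 := by
        rw [integral_finsetSum _ hind]
        refine Finset.sum_congr rfl fun i _ => ?_
        rw [integral_indicator (hUo i).measurableSet, Measure.restrict_restrict
          (hUo i).measurableSet, inter_eq_left.2 (hUΩ i)]
    _ ≤ ∑ i ∈ F, (t * (‖a i‖ + b i) * ‖z.2‖) ^ 2 :=
        Finset.sum_le_sum fun i hi => (hpatch i hi).2
    _ = t ^ 2 * S * ‖z.2‖ ^ 2 := by
        simp only [S, mul_pow, Finset.mul_sum, Finset.sum_mul]
    _ ≤ (t * (S + 1)) ^ 2 * ‖z.2‖ ^ 2 := by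
        refine mul_le_mul_of_nonneg_right ?_ (sq_nonneg _)
        rw [mul_pow]
        exact mul_le_mul_of_nonneg_left (by nlinarith) (sq_nonneg _)
    _ ≤ ε ^ 2 * ‖z.2‖ ^ 2 := by gcongr
    _ = (ε * ‖z.2‖) ^ 2 := by ring

end Patch

end

section

/-! ### Variational resolvent -/

section Resolvent

variable {H K : Type*} [NormedAddCommGroup H] [InnerProductSpace ℝ H] [CompleteSpace H]
  [NormedAddCommGroup K] [InnerProductSpace ℝ K] [CompleteSpace K]

/-- The variational solution of `r u + L u = r f`, together with its gradient, depends continuously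
and linearly on `f`. -/
theorem exists_resolventPair {V : Submodule ℝ (H × K)} (hV : IsClosed (V : Set (H × K)))
    {r : ℝ} (hr : 0 < r) : ∃ S : H →L[ℝ] H × K, (∀ f, S f ∈ V) ∧
      ∀ f, ∀ v ∈ V, r * inner ℝ (S f).1 v.1 + inner ℝ (S f).2 v.2 = r * inner ℝ f v.1 := by
  -- Rescaling the first factor by `√r` turns the energy `r ‖u‖² + ‖∇u‖²` into the Hilbert norm of
  -- the product. The solution is then the orthogonal projection of `(√r f, 0)` onto the rescaled
  -- space `W`.
  let c : ℝ := Real.sqrt r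
  have hc : 0 < c := Real.sqrt_pos.2 hr
  have hcc : c * c = r := Real.mul_self_sqrt hr.le
  let L : WithLp 2 (H × K) →L[ℝ] H × K :=
    (c⁻¹ • WithLp.fstL 2 ℝ H K).prod (WithLp.sndL 2 ℝ H K)
  let W : Submodule ℝ (WithLp 2 (H × K)) := V.comap L.toLinearMap
  have hW : IsClosed (W : Set (WithLp 2 (H × K))) := hV.preimage L.continuous
  have : CompleteSpace W := hW.completeSpace_coe
  let ι : H →L[ℝ] WithLp 2 (H × K) :=
    (WithLp.prodContinuousLinearEquiv 2 ℝ H K).symm.toContinuousLinearMap.comp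
      ((c • ContinuousLinearMap.id ℝ H).prod 0)
  refine ⟨L.comp (W.starProjection.comp ι), fun f => ?_, fun f v hv => ?_⟩
  · exact W.starProjection_apply_mem (ι f)
  · let v' : WithLp 2 (H × K) := WithLp.toLp 2 (c • v.1, v.2)
    have hv' : v' ∈ W := by
      change L v' ∈ V
      have : L v' = v := by
        refine Prod.ext ?_ rfl
        change c⁻¹ • c • v.1 = v.1
        rw [smul_smul, inv_mul_cancel₀ hc.ne', one_smul]
      rwa [this]
    have h1 := W.starProjection_inner_eq_zero (ι f) v' hv'
    rw [inner_sub_left, sub_eq_zero] at h1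
    have h2 : inner ℝ (ι f) v' = r * inner ℝ f v.1 := by
      rw [WithLp.prod_inner_apply]
      change inner ℝ (c • f) (c • v.1) + inner ℝ (0 : K) v.2 = _
      rw [real_inner_smul_left, real_inner_smul_right, inner_zero_left, ← hcc]
      ring
    rw [h2] at h1
    rw [h1, WithLp.prod_inner_apply]
    change r * inner ℝ (c⁻¹ • (W.starProjection (ι f)).fst) v.1
      + inner ℝ (W.starProjection (ι f)).snd v.2 = inner ℝ (W.starProjection (ι f)).fst (c • v.1)
        + inner ℝ (W.starProjection (ι f)).snd v.2
    rw [real_inner_smul_left, real_inner_smul_right, ← hcc]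
    field_simp

end Resolvent

/-! ### Spectral resolution of the Laplacian and maximum principle -/

section SpectralFamily

/-- Mutually orthogonal subspaces with dense span, all trivial for negative indices, form a spectral
family. -/
theorem isSpectralFamily_starProjection {H : Type*} [NormedAddCommGroup H]
    [InnerProductSpace ℝ H] [CompleteSpace H] (E : ℝ → Submodule ℝ H)
    [∀ a, CompleteSpace (E a)]
    (horth : ∀ a b, a ≠ b → ∀ u ∈ E a, ∀ v ∈ E b, inner ℝ u v = (0 : ℝ))
    (htot : (⨆ a, E a)ᗮ = ⊥) (hneg : ∀ a < 0, ∀ u ∈ E a, u = 0) :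
    IsSpectralFamily (fun a => (E a).starProjection) := by
  have hmem : ∀ a u, (E a).starProjection u ∈ E a := fun a u => (E a).starProjection_apply_mem u
  have hself : ∀ a, ∀ u ∈ E a, (E a).starProjection u = u := fun a u hu =>
    (E a).starProjection_eq_self_iff.2 hu
  have hzero : ∀ a b, a ≠ b → ∀ u ∈ E b, (E a).starProjection u = 0 := fun a b hab u hu => by
    rw [Submodule.starProjection_apply_eq_zero_iff, Submodule.mem_orthogonal]
    exact fun w hw => horth a b hab w hw u hu
  have hF : OrthogonalFamily ℝ (fun a => E a) fun a => (E a).subtypeₗᵢ := by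
    rintro a b hab ⟨u, hu⟩ ⟨v, hv⟩
    exact horth a b hab u hu v hv
  have hHS : IsHilbertSum ℝ (fun a => E a) fun a => (E a).subtypeₗᵢ :=
    IsHilbertSum.mkInternal E hF
      (by rw [(Submodule.topologicalClosure_eq_top_iff).2 htot])
  refine ⟨fun a u v => Submodule.inner_starProjection_left_eq_right _ u v,
    fun a u => hself a _ (hmem a u), fun a b u hab => hzero a b hab _ (hmem b u), fun u => ?_,
    fun a u ha => hneg a ha _ (hmem a u)⟩
  have h1 := hHS.hasSum_linearIsometryEquiv_symm (hHS.linearIsometryEquiv u)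
  rw [LinearIsometryEquiv.symm_apply_apply] at h1
  have h2 : ∀ a, (E a).starProjection u = (hHS.linearIsometryEquiv u a : H) := fun a => by
    have h3 := h1.mapL (E a).starProjection
    refine h3.unique ?_
    have h4 := hasSum_single (f := fun b => (E a).starProjection
      ((E b).subtypeₗᵢ (hHS.linearIsometryEquiv u b))) a (fun b hba =>
        hzero a b hba.symm _ (hHS.linearIsometryEquiv u b).2)
    rwa [hself a _ (by exact (hHS.linearIsometryEquiv u a).2)] at h4
  simp only [h2]
  exact h1

variable {N : ℕ} {Ω : Set (Space N)}

theorem IsBoundedRegularOpen.measure_ne_top (hΩ : IsBoundedRegularOpen Ω) : volume Ω ≠ ∞ :=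
  hΩ.isBounded.measure_lt_top.ne

theorem IsBoundedRegularOpen.isFiniteMeasure (hΩ : IsBoundedRegularOpen Ω) :
    IsFiniteMeasure (volume.restrict Ω) := ⟨by simpa using hΩ.measure_ne_top.lt_top⟩

/-- The energy identity bounds the gradient of the solution by `‖f‖`, so composing with compact
approximations of the identity on `H^1` converges to the resolvent in operator norm. -/
theorem isCompactOperator_resolvent (hΩ : IsBoundedRegularOpen Ω) (bc : BoundaryCondition)
    {S : L2 Ω →L[ℝ] L2 Ω × L2Vec Ω} (hS : ∀ f, S f ∈ formDomain Ω bc)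
    (hS' : ∀ f, ∀ v ∈ formDomain Ω bc,
      1 * inner ℝ (S f).1 v.1 + inner ℝ (S f).2 v.2 = 1 * inner ℝ f v.1) :
    IsCompactOperator ((ContinuousLinearMap.fst ℝ _ _).comp S) := by
  have hn : ∀ f, ‖(S f).2‖ ≤ ‖f‖ := fun f => by
    have h1 := hS' f _ (hS f)
    rw [real_inner_self_eq_norm_sq, real_inner_self_eq_norm_sq, one_mul, one_mul] at h1
    have h2 := real_inner_le_norm f (S f).1
    refine abs_le_of_sq_le_sq' ?_ (norm_nonneg _) |>.2
    nlinarith [sq_nonneg (‖(S f).1‖ - ‖f‖)]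
  choose! T hTc hT using fun n : ℕ =>
    hΩ.exists_compact_approx (ε := 1 / ((n : ℝ) + 1)) (by positivity)
  refine isCompactOperator_of_tendsto (l := atTop)
    (F := fun n => (T n).comp ((ContinuousLinearMap.fst ℝ _ _).comp S)) ?_
    (Eventually.of_forall fun n => (hTc n).comp_clm _)
  rw [tendsto_iff_norm_sub_tendsto_zero]
  refine squeeze_zero (fun _ => norm_nonneg _) (fun n => ?_)
    tendsto_one_div_add_atTop_nhds_zero_nat
  refine ContinuousLinearMap.opNorm_le_bound _ (by positivity) fun f => ?_
  have h1 := hT n (S f) (formDomain_le_sobolevH1 bc (hS f))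
  rw [norm_sub_rev] at h1
  exact h1.trans (mul_le_mul_of_nonneg_left (hn f) (by positivity))

theorem eigenspace_inner_eq_zero {bc : BoundaryCondition} {a b : ℝ} (hab : a ≠ b) {u v : L2 Ω}
    (hu : u ∈ eigenspace Ω bc a) (hv : v ∈ eigenspace Ω bc b) : inner ℝ u v = (0 : ℝ) := by
  obtain ⟨G, hG, hG'⟩ := hu
  obtain ⟨G₂, hG₂, hG₂'⟩ := hv
  have h1 := hG' _ hG₂
  have h2 := hG₂' _ hG
  simp only at h1 h2
  rw [real_inner_comm, h1, real_inner_comm u v] at h2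
  have h3 : (a - b) * inner ℝ u v = 0 := by linarith
  exact (mul_eq_zero.1 h3).resolve_left (sub_ne_zero.2 hab)

theorem eigenspace_eq_zero_of_neg {bc : BoundaryCondition} {a : ℝ} (ha : a < 0) {u : L2 Ω}
    (hu : u ∈ eigenspace Ω bc a) : u = 0 := by
  obtain ⟨G, hG, hG'⟩ := hu
  have h1 := hG' _ hG
  simp only [real_inner_self_eq_norm_sq] at h1
  by_contra h
  have h2 : 0 < ‖u‖ := norm_pos_iff.2 h
  nlinarith [sq_nonneg ‖G‖, pow_pos h2 2]

/-- Eigenvectors of `-Δ` for `a` are those fixed by `(1 + a) (1 - Δ)^(-1)`. A bounded operator thus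
replaces the unbounded one, which gives closed eigenspaces and access to the compact spectral
theorem. -/
theorem mem_eigenspace_iff {bc : BoundaryCondition}
    {S : L2 Ω →L[ℝ] L2 Ω × L2Vec Ω} (hS : ∀ f, S f ∈ formDomain Ω bc)
    (hS' : ∀ f, ∀ v ∈ formDomain Ω bc,
      1 * inner ℝ (S f).1 v.1 + inner ℝ (S f).2 v.2 = 1 * inner ℝ f v.1) {a : ℝ} {e : L2 Ω} :
    e ∈ eigenspace Ω bc a ↔ (1 + a) • (S e).1 = e := by
  constructor
  · rintro ⟨G, hG, hG'⟩
    refine ext_inner_right ℝ fun f => ?_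
    have h1 := hS' f _ hG
    have h2 := hG' _ (hS f)
    have h3 := hS' f _ (hS e)
    have h4 := hS' e _ (hS f)
    simp only [one_mul] at h1 h3 h4
    rw [real_inner_smul_left]
    have h5 : inner ℝ (S e).1 f = inner ℝ e (S f).1 := by
      linarith [real_inner_comm (S e).1 (S f).1, real_inner_comm (S e).2 (S f).2,
        real_inner_comm (S e).1 f]
    rw [h5]
    linarith [real_inner_comm (S f).1 e, real_inner_comm (S f).2 G, real_inner_comm e f]
  · intro h
    refine ⟨(1 + a) • (S e).2, ?_, fun z hz => ?_⟩
    · have h1 := (formDomain Ω bc).smul_mem (1 + a) (hS e)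
      have h2 : (1 + a) • S e = (e, (1 + a) • (S e).2) := Prod.ext h rfl
      rwa [h2] at h1
    · have h1 := hS' e z hz
      simp only [one_mul] at h1
      have h2 : inner ℝ e z.1 = (1 + a) * inner ℝ (S e).1 z.1 := by
        rw [← real_inner_smul_left, h]
      rw [real_inner_smul_left]
      linear_combination (1 + a) * h1 + h2

theorem isClosed_eigenspace (bc : BoundaryCondition) (a : ℝ) :
    IsClosed (eigenspace Ω bc a : Set (L2 Ω)) := by
  obtain ⟨S, hS, hS'⟩ := exists_resolventPair (isClosed_formDomain (Ω := Ω) bc) one_pos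
  have : (eigenspace Ω bc a : Set (L2 Ω)) = {e | (1 + a) • (S e).1 = e} := by
    ext e
    exact mem_eigenspace_iff hS hS'
  rw [this]
  exact isClosed_eq (by fun_prop) (by fun_prop)

theorem topologicalClosure_eigenspace (bc : BoundaryCondition) (a : ℝ) :
    (eigenspace Ω bc a).topologicalClosure = eigenspace Ω bc a :=
  (isClosed_eigenspace bc a).submodule_topologicalClosure_eq

/-- The spectral theorem for the compact symmetric resolvent: an eigenvalue `ν ≠ 0` corresponds to
`a = ν⁻¹ - 1`, and `ν = 0` is excluded by injectivity. -/
theorem orthogonal_iSup_eigenspace (hΩ : IsBoundedRegularOpen Ω) (bc : BoundaryCondition) :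
    (⨆ a, eigenspace Ω bc a)ᗮ = ⊥ := by
  obtain ⟨S, hS, hS'⟩ := exists_resolventPair (isClosed_formDomain (Ω := Ω) bc) one_pos
  let R : L2 Ω →L[ℝ] L2 Ω := (ContinuousLinearMap.fst ℝ _ _).comp S
  have hR : IsCompactOperator R := isCompactOperator_resolvent hΩ bc hS hS'
  have hsymm : (R : L2 Ω →ₗ[ℝ] L2 Ω).IsSymmetric := fun f g => by
    have h1 := hS' f _ (hS g)
    have h2 := hS' g _ (hS f)
    rw [real_inner_comm (S f).1 (S g).1, real_inner_comm (S f).2 (S g).2] at h2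
    change inner ℝ (S f).1 g = inner ℝ f (S g).1
    rw [real_inner_comm]
    linarith
  have htop := ContinuousLinearMap.orthogonalComplement_iSup_eigenspaces_eq_bot hR hsymm
  -- A zero solution has zero gradient by the energy identity, so the equation makes `e` orthogonal
  -- to every test function.
  have hinj : ∀ e, R e = 0 → e = 0 := fun e he => by
    have he' : (S e).1 = 0 := he
    have h1 := hS' e _ (hS e)
    rw [he', inner_zero_left, inner_zero_right, mul_zero, zero_add, inner_self_eq_zero] at h1
    have h2 : ∀ v ∈ formDomain Ω bc, inner ℝ e v.1 = (0 : ℝ) := fun v hv => by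
      have := hS' e v hv
      rw [he', h1] at this
      simpa using this.symm
    have h3 : e ∈ (testSpace Ω)ᗮ := by
      rw [Submodule.mem_orthogonal]
      rintro _ ⟨φ, hφ, rfl⟩
      rw [real_inner_comm]
      exact h2 _ (testFunction_mem_formDomain bc hφ)
    have h4 : (testSpace Ω)ᗮ = ⊥ := by
      rw [← Submodule.topologicalClosure_eq_top_iff, ←
        Submodule.dense_iff_topologicalClosure_eq_top]
      exact dense_testSpace hΩ.isOpen
    rwa [h4, Submodule.mem_bot] at h3
  rw [eq_bot_iff, ← htop]
  refine Submodule.orthogonal_le (iSup_le fun ν => ?_)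
  intro e he
  rw [Module.End.mem_eigenspace_iff] at he
  have he' : (S e).1 = ν • e := he
  rcases eq_or_ne ν 0 with hν | hν
  · have : e = 0 := hinj e (by change (S e).1 = 0; rw [he', hν, zero_smul])
    rw [this]
    exact Submodule.zero_mem _
  · refine Submodule.mem_iSup_of_mem (ν⁻¹ - 1) ((mem_eigenspace_iff hS hS').2 ?_)
    rw [he', smul_smul]
    simp [hν]

theorem isSpectralFamily_eigenprojection (hΩ : IsBoundedRegularOpen Ω) (bc : BoundaryCondition) :
    IsSpectralFamily (eigenprojection Ω bc) := by
  refine isSpectralFamily_starProjection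
    (fun a => (eigenspace Ω bc a).topologicalClosure) ?_ ?_ ?_
  · simp only [topologicalClosure_eigenspace]
    exact fun a b hab u hu v hv => eigenspace_inner_eq_zero hab hu hv
  · simp only [topologicalClosure_eigenspace]
    exact orthogonal_iSup_eigenspace hΩ bc
  · simp only [topologicalClosure_eigenspace]
    exact fun a ha u hu => eigenspace_eq_zero_of_neg ha hu

theorem eigenprojection_mem (bc : BoundaryCondition) (a : ℝ) (u : L2 Ω) :
    eigenprojection Ω bc a u ∈ eigenspace Ω bc a := by
  rw [← topologicalClosure_eigenspace]
  exact Submodule.starProjection_apply_mem _ _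

/-- The resolvent is sub-Markovian. -/
theorem supBound_resolvent (hΩ : IsBoundedRegularOpen Ω) (bc : BoundaryCondition) {r : ℝ}
    (hr : 0 < r) : SupBound (eigenprojection Ω bc) 1 (fun a => r / (r + a)) where
  nonneg a ha := by positivity
  le a ha := by
    rw [div_le_one (by positivity)]
    linarith
  ae_le g c hc hg := by
    have hP := isSpectralFamily_eigenprojection hΩ bc
    have := hΩ.isFiniteMeasure
    obtain ⟨S, hS, hS'⟩ := exists_resolventPair (isClosed_formDomain (Ω := Ω) bc) hr
    have hb : ∀ a : ℝ, 0 ≤ a → |r / (r + a)| ≤ 1 := fun a ha => by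
      rw [abs_of_nonneg (by positivity), div_le_one (by positivity)]
      linarith
    -- The multiplier is identified with the variational solution by testing the latter against
    -- eigenvectors, where the gradient term becomes `a` times the `L^2` pairing.
    have hu : spectralCalculus (eigenprojection Ω bc) (fun a => r / (r + a)) g = (S g).1 := by
      refine hP.calculus_eq hb fun a ha => ?_
      refine ext_inner_right ℝ fun w => ?_
      rw [real_inner_smul_left, hP.symm, hP.symm]
      obtain ⟨G, hG, hG'⟩ := eigenprojection_mem (Ω := Ω) bc a w
      have h1 := hS' g _ hG
      have h2 := hG' _ (hS g)
      simp only at h1 h2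
      rw [real_inner_comm G, h2, real_inner_comm (S g).1] at h1
      rw [real_inner_comm]
      have h3 : r + a ≠ 0 := by positivity
      field_simp
      rw [real_inner_comm (S g).1]
      linarith
    rw [hu, one_mul]
    set u := (S g).1 with hudef
    have hΦ := isSmoothCutoff_smoothTransition hc
    set Φ : ℝ → ℝ := fun x => Real.smoothTransition (x - c) with hΦdef
    have hv := hΦ.pair_mem_formDomain hΩ.isOpen hΩ.measure_ne_top bc (hS g)
    have h1 := hS' g _ hv
    have h2 : 0 ≤ inner ℝ (S g).2 (hΦ.pair (S g)).2 := by
      rw [L2.inner_def]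
      refine integral_nonneg_of_ae ?_
      filter_upwards [(hΦ.memLp_gradient (S g).1 (S g).2).coeFn_toLp] with x hx
      simp only [IsSmoothCutoff.pair, Pi.zero_apply]
      rw [hx, real_inner_smul_right, real_inner_self_eq_norm_sq]
      exact mul_nonneg (hΦ.deriv_nonneg _) (sq_nonneg _)
    -- Testing with `Φ(u)` produces the gradient term `∫ Φ'(u) |∇u|² ≥ 0`, which is dropped.
    -- Together with `g ≤ c` this gives `∫ (u - c) Φ(u) ≤ 0`; the integrand is nonnegative, hence
    -- zero, and `Φ(u) > 0` where `u > c`.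
    have h3 : inner ℝ u (hΦ.pair (S g)).1 ≤ inner ℝ g (hΦ.pair (S g)).1 := by
      have : r * inner ℝ u (hΦ.pair (S g)).1 ≤ r * inner ℝ g (hΦ.pair (S g)).1 := by linarith
      exact le_of_mul_le_mul_left this hr
    have e : ∀ f : L2 Ω, inner ℝ f (hΦ.pair (S g)).1 = ∫ x in Ω, f x * Φ (u x) := fun f => by
      rw [← inner_toLp_toLp (Lp.memLp f) (hΦ.memLp u), Lp.toLp_coeFn]
      rfl
    rw [e, e] at h3
    have hΦ0 : ∀ y, 0 ≤ Φ y := fun y => Real.smoothTransition.nonneg _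
    have hi : ∀ f : L2 Ω, Integrable (fun x => f x * Φ (u x)) (volume.restrict Ω) := fun f =>
      (Lp.memLp f).integrable_mul (hΦ.memLp u)
    have hi1 : Integrable (fun x => c * Φ (u x)) (volume.restrict Ω) :=
      ((hΦ.memLp u).integrable (by norm_num)).const_mul c
    have h4 : ∫ x in Ω, g x * Φ (u x) ≤ ∫ x in Ω, c * Φ (u x) := by
      refine integral_mono_ae (hi g) hi1 ?_
      filter_upwards [hg] with x hx
      exact mul_le_mul_of_nonneg_right hx (hΦ0 _)
    have hnn : ∀ x, 0 ≤ (u x - c) * Φ (u x) := fun x => by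
      rcases le_total (u x) c with h | h
      · have : Φ (u x) = 0 := Real.smoothTransition.zero_of_nonpos (by linarith)
        rw [this, mul_zero]
      · exact mul_nonneg (by linarith) (hΦ0 _)
    have hi2 : Integrable (fun x => (u x - c) * Φ (u x)) (volume.restrict Ω) := by
      have := (hi u).sub hi1
      simp only [sub_mul]
      exact this
    have h5 : ∫ x in Ω, (u x - c) * Φ (u x) = 0 := by
      refine le_antisymm ?_ (integral_nonneg hnn)
      simp only [sub_mul]
      rw [integral_sub (hi u) hi1]
      linarith
    rw [integral_eq_zero_iff_of_nonneg hnn hi2] at h5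
    filter_upwards [h5] with x hx
    by_contra hlt
    push Not at hlt
    have h6 : 0 < Φ (u x) := Real.smoothTransition.pos_of_pos (by linarith)
    have h7 : 0 < (u x - c) * Φ (u x) := mul_pos (by linarith) h6
    simp only [Pi.zero_apply] at hx
    linarith

end SpectralFamily

end

/-! ### Smoothing estimates for the semigroup on `L^2` -/

section

theorem continuous_integral_abs {X : Type*} [MeasurableSpace X] {μ : Measure X}
    [IsFiniteMeasure μ] : Continuous fun v : Lp ℝ 2 μ => ∫ x, |v x| ∂μ := by
  have h1 : Continuous fun v : Lp ℝ 2 μ => |v| := continuous_id.sup continuous_neg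
  have h2 : Continuous fun v : Lp ℝ 2 μ =>
      inner ℝ |v| ((memLp_const (μ := μ) (p := 2) (1 : ℝ)).toLp _) := h1.inner continuous_const
  refine h2.congr fun v => ?_
  rw [inner_eq_integral]
  refine integral_congr_ae ?_
  filter_upwards [Lp.coeFn_abs v, (memLp_const (μ := μ) (p := 2) (1 : ℝ)).coeFn_toLp] with x h3 h4
  rw [h3, h4, mul_one]

/-- Iterating leaves `2 b + M 2^(-n)`. The a priori bound `M` is needed only to start and disappears
in the limit, which is why the final constant depends on `b` alone. -/
theorem le_of_le_add_half {z : ℝ → ℝ} {T M b : ℝ} (hb : 0 ≤ b)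
    (hM : ∀ t, 0 < t → t ≤ T → z t ≤ M)
    (h : ∀ t, 0 < t → t ≤ T → z t ≤ b + z (t / 2) / 2) {t : ℝ} (ht : 0 < t) (htT : t ≤ T) :
    z t ≤ 2 * b := by
  have key : ∀ n : ℕ, ∀ t, 0 < t → t ≤ T → z t ≤ 2 * b + M * (1 / 2) ^ n := by
    intro n
    induction n with
    | zero =>
      intro t ht htT
      have := hM t ht htT
      simp only [pow_zero, mul_one]
      linarith
    | succ n ih =>
      intro t ht htT
      have h1 := h t ht htT
      have h2 := ih (t / 2) (by linarith) (by linarith)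
      rw [pow_succ]
      linarith
  have hlim : Tendsto (fun n : ℕ => 2 * b + M * (1 / 2 : ℝ) ^ n) atTop (𝓝 (2 * b + M * 0)) :=
    ((tendsto_pow_atTop_nhds_zero_of_lt_one (by norm_num) (by norm_num)).const_mul M).const_add _
  rw [mul_zero, add_zero] at hlim
  exact ge_of_tendsto' hlim fun n => key n t ht htT

/-- The inequality `y ≤ exp y` at `y = s c a^s`, raised to the power `1/s`. -/
theorem le_rpow_mul_exp {s c a : ℝ} (hs : 0 < s) (hc : 0 < c) (ha : 0 ≤ a) :
    a ≤ (s * c) ^ (-s⁻¹) * Real.exp (c * a ^ s) := by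
  have h1 : s * c * a ^ s ≤ Real.exp (s * c * a ^ s) := by
    linarith [Real.add_one_le_exp (s * c * a ^ s)]
  have h0 : 0 < s * c := by positivity
  have h2 := Real.rpow_le_rpow (by positivity) h1 (inv_nonneg.2 hs.le)
  rw [Real.mul_rpow h0.le (by positivity), Real.rpow_rpow_inv ha hs.ne', ← Real.exp_mul] at h2
  rw [Real.rpow_neg h0.le, inv_mul_eq_div, le_div_iff₀ (by positivity), mul_comm]
  refine h2.trans_eq ?_
  congr 1
  field_simp

section Semigroup

variable {N : ℕ} {Ω : Set (Space N)} {bc : BoundaryCondition} {s d : ℝ}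

/-- Gradients of eigenvectors for different eigenvalues are orthogonal, since the weak equation
turns their product into an `L^2` product. -/
theorem exists_gradient_sum (hΩ : IsBoundedRegularOpen Ω) (g : L2 Ω) (f : ℝ → ℝ) (F : Finset ℝ) :
    ∃ G : L2Vec Ω, (∑ a ∈ F, f a • eigenprojection Ω bc a g, G) ∈ formDomain Ω bc ∧
      ‖G‖ ^ 2 = ∑ a ∈ F, f a ^ 2 * a * ‖eigenprojection Ω bc a g‖ ^ 2 := by
  have hP := isSpectralFamily_eigenprojection hΩ bc
  choose G hG hG' using fun a => eigenprojection_mem (Ω := Ω) bc a g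
  have hmem : (∑ a ∈ F, f a • eigenprojection Ω bc a g, ∑ a ∈ F, f a • G a)
      ∈ formDomain Ω bc := by
    have h1 : ∑ a ∈ F, f a • (eigenprojection Ω bc a g, G a) ∈ formDomain Ω bc :=
      Submodule.sum_mem _ fun a _ => Submodule.smul_mem _ _ (hG a)
    have h2 : ∑ a ∈ F, f a • (eigenprojection Ω bc a g, G a)
        = (∑ a ∈ F, f a • eigenprojection Ω bc a g, ∑ a ∈ F, f a • G a) := by
      refine Prod.ext ?_ ?_
      · rw [Prod.fst_sum]; rfl
      · rw [Prod.snd_sum]; rfl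
    rwa [h2] at h1
  refine ⟨_, hmem, ?_⟩
  rw [← real_inner_self_eq_norm_sq, sum_inner]
  refine Finset.sum_congr rfl fun a ha => ?_
  rw [real_inner_smul_left, hG' a _ hmem, inner_sum, Finset.sum_eq_single a]
  · rw [real_inner_smul_right, real_inner_self_eq_norm_sq]
    ring
  · intro b _ hba
    rw [real_inner_smul_right, hP.symm, hP.orth a b g hba.symm, inner_zero_right, mul_zero]
  · exact fun h => absurd ha h

/-- The hypothesis on `f` and `h` says `‖∇ f(L) g‖² ≤ q ‖h(L) g‖²`. Nash's inequality is applied to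
finite partial sums, which lie in the form domain, and both sides pass to the limit. -/
theorem exists_calculus_nash (hΩ : IsBoundedRegularOpen Ω) (bc : BoundaryCondition) :
    ∃ C : ℝ, 0 < C ∧ ∀ τ : ℝ, 0 < τ → τ ≤ 1 → ∀ (f h : ℝ → ℝ) (M q : ℝ),
      (∀ a, 0 ≤ a → |f a| ≤ M) → (∀ a, 0 ≤ a → |h a| ≤ M) → 0 ≤ q →
      (∀ a, 0 ≤ a → f a ^ 2 * a ≤ q * h a ^ 2) → ∀ g : L2 Ω,
      ‖spectralCalculus (eigenprojection Ω bc) f g‖ ^ 2 ≤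
        C * ((τ ^ N)⁻¹ * (∫ x in Ω, |spectralCalculus (eigenprojection Ω bc) f g x|) ^ 2
          + τ ^ 2 * (q * ‖spectralCalculus (eigenprojection Ω bc) h g‖ ^ 2)) := by
  have hP := isSpectralFamily_eigenprojection hΩ bc
  have := hΩ.isFiniteMeasure
  obtain ⟨C, hC, hnash⟩ := hΩ.exists_nash
  refine ⟨C, hC, fun τ hτ hτ1 f h M q hf hh hq hfh g => ?_⟩
  have hsum := hP.hasSum_calculus hf g
  have key : ∀ F : Finset ℝ, ‖∑ a ∈ F, f a • eigenprojection Ω bc a g‖ ^ 2 ≤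
      C * ((τ ^ N)⁻¹ *
        (∫ x in Ω, |(∑ a ∈ F, f a • eigenprojection Ω bc a g : L2 Ω) x|) ^ 2
          + τ ^ 2 * (q * ‖spectralCalculus (eigenprojection Ω bc) h g‖ ^ 2)) := by
    intro F
    obtain ⟨G, hG, hGn⟩ := exists_gradient_sum (bc := bc) hΩ g f F
    refine (hnash τ hτ hτ1 _ (formDomain_le_sobolevH1 bc hG)).trans ?_
    have h1 : ‖G‖ ^ 2 ≤ q * ‖spectralCalculus (eigenprojection Ω bc) h g‖ ^ 2 := by
      rw [hGn]
      calc ∑ a ∈ F, f a ^ 2 * a * ‖eigenprojection Ω bc a g‖ ^ 2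
          ≤ ∑ a ∈ F, q * (h a ^ 2 * ‖eigenprojection Ω bc a g‖ ^ 2) := by
            refine Finset.sum_le_sum fun a _ => ?_
            rcases lt_or_ge a 0 with ha | ha
            · rw [hP.neg a g ha]; simp
            · rw [← mul_assoc]
              exact mul_le_mul_of_nonneg_right (hfh a ha) (sq_nonneg _)
        _ = q * ∑ a ∈ F, h a ^ 2 * ‖eigenprojection Ω bc a g‖ ^ 2 := (Finset.mul_sum _ _ _).symm
        _ ≤ _ := mul_le_mul_of_nonneg_left
            (sum_le_hasSum F (fun a _ => by positivity) (hP.norm_sq_calculus hh g)) hq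
    gcongr
  have hcont := (continuous_integral_abs (μ := volume.restrict Ω))
  refine le_of_tendsto_of_tendsto' (hsum.norm.pow 2)
    ((((((hcont.tendsto _).comp hsum).pow 2).const_mul _).add_const _).const_mul C) key

theorem supBound_semigroup (hΩ : IsBoundedRegularOpen Ω) (bc : BoundaryCondition) (hs0 : 0 < s)
    (hs1 : s < 1) (hd : 0 < d) {t : ℝ} (ht : 0 ≤ t) :
    SupBound (eigenprojection Ω bc) 1 (fun a => Real.exp (-(t * (d * a ^ s)))) := by
  have := SupBound.exp_neg_rpow (isSpectralFamily_eigenprojection hΩ bc)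
    (fun r hr => supBound_resolvent hΩ bc hr) hs0 hs1 (mul_nonneg ht hd.le)
  simpa only [mul_assoc] using this

variable (hΩ : IsBoundedRegularOpen Ω) (hs0 : 0 < s) (hs1 : s < 1) (hd : 0 < d)

include hΩ hs0 hs1 hd

theorem semigroupL2_add_right {t : ℝ} (ht : 0 ≤ t) (u v : L2 Ω) :
    semigroupL2 Ω bc s d t (u + v) = semigroupL2 Ω bc s d t u + semigroupL2 Ω bc s d t v :=
  (isSpectralFamily_eigenprojection hΩ bc).calculus_add_right
    (supBound_semigroup hΩ bc hs0 hs1 hd ht).abs_le u v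

theorem semigroupL2_neg {t : ℝ} (ht : 0 ≤ t) (u : L2 Ω) :
    semigroupL2 Ω bc s d t (-u) = -semigroupL2 Ω bc s d t u := by
  have := (isSpectralFamily_eigenprojection hΩ bc).calculus_smul_right
    (supBound_semigroup hΩ bc hs0 hs1 hd ht).abs_le (-1) u
  rwa [neg_one_smul, neg_one_smul] at this

theorem inner_semigroupL2 {t : ℝ} (ht : 0 ≤ t) (u v : L2 Ω) :
    inner ℝ (semigroupL2 Ω bc s d t u) v = inner ℝ u (semigroupL2 Ω bc s d t v) :=
  (isSpectralFamily_eigenprojection hΩ bc).inner_calculus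
    (supBound_semigroup hΩ bc hs0 hs1 hd ht).abs_le u v

theorem semigroupL2_add {t t' : ℝ} (ht : 0 ≤ t) (ht' : 0 ≤ t') (u : L2 Ω) :
    semigroupL2 Ω bc s d (t + t') u
      = semigroupL2 Ω bc s d t (semigroupL2 Ω bc s d t' u) := by
  have := (isSpectralFamily_eigenprojection hΩ bc).calculus_mul
    (supBound_semigroup hΩ bc hs0 hs1 hd ht).abs_le
    (supBound_semigroup hΩ bc hs0 hs1 hd ht').abs_le u
  have e : (fun a : ℝ => Real.exp (-(t * (d * a ^ s))) * Real.exp (-(t' * (d * a ^ s))))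
      = fun a => Real.exp (-((t + t') * (d * a ^ s))) := by
    funext a
    rw [← Real.exp_add]
    congr 1
    ring
  rw [e] at this
  exact this

theorem norm_semigroupL2_le {t : ℝ} (ht : 0 ≤ t) (u : L2 Ω) :
    ‖semigroupL2 Ω bc s d t u‖ ≤ ‖u‖ := by
  have := (isSpectralFamily_eigenprojection hΩ bc).norm_calculus_le
    (supBound_semigroup hΩ bc hs0 hs1 hd ht).abs_le u
  rwa [one_mul] at this

theorem semigroupL2_ae_abs_le {t : ℝ} (ht : 0 ≤ t) {u : L2 Ω} {c : ℝ} (hc : 0 ≤ c)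
    (hu : ∀ᵐ x ∂volume.restrict Ω, |u x| ≤ c) :
    ∀ᵐ x ∂volume.restrict Ω, |semigroupL2 Ω bc s d t u x| ≤ c := by
  have h := supBound_semigroup hΩ bc hs0 hs1 hd ht
  have h1 := h.ae_le u c hc (hu.mono fun x hx => (le_abs_self _).trans hx)
  have h2 := h.ae_le (-u) c hc (by
    filter_upwards [hu, Lp.coeFn_neg u] with x hx hx'
    rw [hx', Pi.neg_apply]
    exact (neg_le_abs _).trans hx)
  have h3 := Lp.coeFn_neg (semigroupL2 Ω bc s d t u)
  rw [← semigroupL2_neg hΩ hs0 hs1 hd ht] at h3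
  filter_upwards [h1, h2, h3] with x h1 h2 h3
  rw [one_mul] at h1 h2
  change semigroupL2 Ω bc s d t u x ≤ c at h1
  change semigroupL2 Ω bc s d t (-u) x ≤ c at h2
  rw [h3, Pi.neg_apply] at h2
  exact abs_le.2 ⟨by linarith, h1⟩

/-- The semigroup is a contraction in `L^1`. -/
theorem integral_abs_semigroupL2_le {t : ℝ} (ht : 0 ≤ t) (u : L2 Ω) :
    ∫ x in Ω, |semigroupL2 Ω bc s d t u x| ≤ ∫ x in Ω, |u x| := by
  have := hΩ.isFiniteMeasure
  set v := semigroupL2 Ω bc s d t u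
  have hvm : Measurable v := (Lp.stronglyMeasurable v).measurable
  -- Duality: the `L^1` norm of `v` is its pairing with the sign of `v`, and the symmetric semigroup
  -- keeps that sign function bounded by `1`.
  have hsm : Measurable fun x => if 0 ≤ v x then (1 : ℝ) else -1 :=
    Measurable.ite (measurableSet_le measurable_const hvm) measurable_const measurable_const
  have hb : ∀ x, |if 0 ≤ v x then (1 : ℝ) else -1| ≤ 1 := fun x => by
    split_ifs <;> simp
  have hφ : MemLp (fun x => if 0 ≤ v x then (1 : ℝ) else -1) 2 (volume.restrict Ω) :=
    MemLp.of_bound hsm.aestronglyMeasurable 1 (Eventually.of_forall hb)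
  have h1 : ∫ x in Ω, |v x| = inner ℝ v (hφ.toLp _) := by
    rw [inner_eq_integral]
    refine integral_congr_ae ?_
    filter_upwards [hφ.coeFn_toLp] with x hx
    rw [hx]
    split_ifs with h
    · rw [abs_of_nonneg h, mul_one]
    · rw [abs_of_neg (not_le.1 h)]; ring
  rw [h1]
  refine (inner_semigroupL2 hΩ hs0 hs1 hd ht u _).trans_le ?_
  rw [inner_eq_integral]
  have h2 := semigroupL2_ae_abs_le (bc := bc) hΩ hs0 hs1 hd ht zero_le_one (u := hφ.toLp _) (by
    filter_upwards [hφ.coeFn_toLp] with x hx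
    rw [hx]
    exact hb x)
  refine integral_mono_ae ((Lp.memLp u).integrable_mul (Lp.memLp _))
    ((Lp.memLp u).integrable (by norm_num)).abs ?_
  filter_upwards [h2] with x hx
  calc u x * semigroupL2 Ω bc s d t (hφ.toLp _) x
      ≤ |u x * semigroupL2 Ω bc s d t (hφ.toLp _) x| := le_abs_self _
    _ = |u x| * |semigroupL2 Ω bc s d t (hφ.toLp _) x| := abs_mul _ _
    _ ≤ |u x| * 1 := mul_le_mul_of_nonneg_left hx (abs_nonneg _)
    _ = |u x| := mul_one _

/-- The smoothing estimate from `L^1` to `L^2`. -/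
theorem exists_norm_sq_semigroupL2_le {T : ℝ} (hT : 0 < T) :
    ∃ K : ℝ, 0 < K ∧ ∀ t, 0 < t → t ≤ T → ∀ g : L2 Ω,
      ‖semigroupL2 Ω bc s d t g‖ ^ 2 ≤ K * t ^ (-(N / (2 * s))) * (∫ x in Ω, |g x|) ^ 2 := by
  obtain ⟨C, hC, hnash⟩ := exists_calculus_nash hΩ bc
  set β : ℝ := N / (2 * s) with hβ
  have hβ0 : 0 ≤ β := by positivity
  set κ : ℝ := (s * d) ^ (-s⁻¹) with hκ
  have hκ0 : 0 < κ := by positivity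
  -- `δ` is small enough that the scale `τ = δ t^(1/(2s))` is admissible in Nash's inequality up to
  -- time `T`, and that the gradient term takes the factor `1/2` after passing from `t^β` to
  -- `(t/2)^β`.
  obtain ⟨δ, hδ, hδ1, hδ2⟩ : ∃ δ : ℝ, 0 < δ ∧ δ * T ^ (1 / (2 * s)) ≤ 1 ∧
      C * δ ^ 2 * κ * 2 ^ β ≤ 1 / 2 := by
    have l1 : Tendsto (fun δ : ℝ => δ * T ^ (1 / (2 * s))) (𝓝[>] 0) (𝓝 0) := by
      refine Tendsto.mono_left ?_ nhdsWithin_le_nhds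
      have : Continuous fun δ : ℝ => δ * T ^ (1 / (2 * s)) := by fun_prop
      simpa using this.tendsto 0
    have l2 : Tendsto (fun δ : ℝ => C * δ ^ 2 * κ * 2 ^ β) (𝓝[>] 0) (𝓝 0) := by
      refine Tendsto.mono_left ?_ nhdsWithin_le_nhds
      have : Continuous fun δ : ℝ => C * δ ^ 2 * κ * 2 ^ β := by fun_prop
      simpa using this.tendsto 0
    obtain ⟨δ, h1, h2, h3⟩ := ((l1.eventually_le_const one_pos).and
      ((l2.eventually_le_const (u := 1 / 2) (by norm_num)).and self_mem_nhdsWithin)).exists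
    exact ⟨δ, h3, h1, h2⟩
  refine ⟨2 * (C * (δ ^ N)⁻¹), by positivity, fun t ht htT g => ?_⟩
  set A := ∫ x in Ω, |g x| with hA
  have hstep : ∀ t, 0 < t → t ≤ T → t ^ β * ‖semigroupL2 Ω bc s d t g‖ ^ 2 ≤
      C * (δ ^ N)⁻¹ * A ^ 2 + (t / 2) ^ β * ‖semigroupL2 Ω bc s d (t / 2) g‖ ^ 2 / 2 := by
    intro t ht htT
    set τ := δ * t ^ (1 / (2 * s)) with hτ
    have hτ0 : 0 < τ := by positivity
    have hτ1 : τ ≤ 1 := (mul_le_mul_of_nonneg_left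
      (Real.rpow_le_rpow ht.le htT (by positivity)) hδ.le).trans hδ1
    have hτN : τ ^ N = δ ^ N * t ^ β := by
      rw [hτ, mul_pow, ← Real.rpow_natCast (t ^ (1 / (2 * s))), ← Real.rpow_mul ht.le, hβ]
      congr 2
      field_simp
    have hτ2 : τ ^ 2 = δ ^ 2 * t ^ s⁻¹ := by
      rw [hτ, mul_pow, ← Real.rpow_natCast (t ^ (1 / (2 * s))), ← Real.rpow_mul ht.le]
      congr 2
      push_cast
      field_simp
    -- Half of the decay of `exp(-t d a^s)²` absorbs the factor `a` of the gradient, at the cost of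
    -- `κ t^(-1/s)`; the other half is the squared symbol at time `t/2`. As `τ² = δ² t^(1/s)`, the
    -- powers of `t` cancel.
    have h1 := hnash τ hτ0 hτ1 (fun a => Real.exp (-(t * (d * a ^ s))))
      (fun a => Real.exp (-(t / 2 * (d * a ^ s)))) 1 (κ * t ^ (-s⁻¹))
      (supBound_semigroup hΩ bc hs0 hs1 hd ht.le).abs_le
      (supBound_semigroup hΩ bc hs0 hs1 hd (by positivity)).abs_le (by positivity)
      (fun a ha => by
        have h2 := le_rpow_mul_exp (c := d * t) hs0 (by positivity) ha
        have h3 : (s * (d * t)) ^ (-s⁻¹) = κ * t ^ (-s⁻¹) := by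
          rw [← mul_assoc, Real.mul_rpow (by positivity) ht.le]
        rw [h3] at h2
        calc Real.exp (-(t * (d * a ^ s))) ^ 2 * a
            ≤ Real.exp (-(t * (d * a ^ s))) ^ 2 *
              (κ * t ^ (-s⁻¹) * Real.exp (d * t * a ^ s)) :=
              mul_le_mul_of_nonneg_left h2 (by positivity)
          _ = κ * t ^ (-s⁻¹) * Real.exp (-(t / 2 * (d * a ^ s))) ^ 2 := by
              rw [← Real.exp_nat_mul, ← Real.exp_nat_mul, mul_left_comm, ← Real.exp_add]
              congr 2
              push_cast
              ring) g
    have h2 := integral_abs_semigroupL2_le (bc := bc) hΩ hs0 hs1 hd ht.le g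
    change ‖semigroupL2 Ω bc s d t g‖ ^ 2 ≤ C * ((τ ^ N)⁻¹ *
      (∫ x in Ω, |semigroupL2 Ω bc s d t g x|) ^ 2
        + τ ^ 2 * (κ * t ^ (-s⁻¹) * ‖semigroupL2 Ω bc s d (t / 2) g‖ ^ 2)) at h1
    have h3 : (∫ x in Ω, |semigroupL2 Ω bc s d t g x|) ^ 2 ≤ A ^ 2 :=
      pow_le_pow_left₀ (integral_nonneg fun _ => abs_nonneg _) h2 2
    have hts : t ^ s⁻¹ * t ^ (-s⁻¹) = 1 := by
      rw [← Real.rpow_add ht, add_neg_cancel, Real.rpow_zero]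
    have ht2 : t ^ β = 2 ^ β * (t / 2) ^ β := by
      rw [← Real.mul_rpow (by norm_num) (by positivity)]
      congr 1
      ring
    set y := ‖semigroupL2 Ω bc s d t g‖ ^ 2
    set y' := ‖semigroupL2 Ω bc s d (t / 2) g‖ ^ 2 with hy'
    have hy0 : 0 ≤ y' := by positivity
    have htβ : 0 < t ^ β := by positivity
    calc t ^ β * y ≤ t ^ β * (C * ((τ ^ N)⁻¹ * A ^ 2 + τ ^ 2 * (κ * t ^ (-s⁻¹) * y'))) := by
          refine mul_le_mul_of_nonneg_left (h1.trans ?_) htβ.le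
          gcongr
      _ = C * (δ ^ N)⁻¹ * A ^ 2 + C * δ ^ 2 * κ * 2 ^ β * ((t / 2) ^ β * y') := by
          rw [hτN, hτ2, mul_inv]
          have e : t ^ β * (C * ((δ ^ N)⁻¹ * (t ^ β)⁻¹ * A ^ 2
              + δ ^ 2 * t ^ s⁻¹ * (κ * t ^ (-s⁻¹) * y')))
              = (t ^ β * (t ^ β)⁻¹) * (C * (δ ^ N)⁻¹ * A ^ 2)
                + C * δ ^ 2 * κ * (t ^ s⁻¹ * t ^ (-s⁻¹)) * (t ^ β * y') := by ring
          rw [e, mul_inv_cancel₀ htβ.ne', hts, one_mul, ht2]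
          ring
      _ ≤ C * (δ ^ N)⁻¹ * A ^ 2 + 1 / 2 * ((t / 2) ^ β * y') := by
          gcongr
      _ = _ := by ring
  have h4 := le_of_le_add_half (z := fun t => t ^ β * ‖semigroupL2 Ω bc s d t g‖ ^ 2) (T := T)
    (M := T ^ β * ‖g‖ ^ 2) (b := C * (δ ^ N)⁻¹ * A ^ 2) (by positivity)
    (fun t ht htT => by
      have := norm_semigroupL2_le (bc := bc) hΩ hs0 hs1 hd ht.le g
      gcongr) hstep ht htT
  have h5 : 0 < t ^ β := by positivity
  rw [Real.rpow_neg ht.le, mul_right_comm, ← div_eq_mul_inv, le_div_iff₀ h5]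
  linarith

/-- The smoothing estimate from `L^1` to `L^∞`. -/
theorem exists_semigroupL2_ae_abs_le_integral {T : ℝ} (hT : 0 < T) :
    ∃ K : ℝ, 0 < K ∧ ∀ t, 0 < t → t ≤ T → ∀ g : L2 Ω, ∀ᵐ x ∂volume.restrict Ω,
      |semigroupL2 Ω bc s d t g x| ≤ K * t ^ (-(N / (2 * s))) * ∫ y in Ω, |g y| := by
  have := hΩ.isFiniteMeasure
  obtain ⟨K, hK, hK'⟩ := exists_norm_sq_semigroupL2_le (bc := bc) hΩ hs0 hs1 hd hT
  set β : ℝ := N / (2 * s) with hβ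
  refine ⟨K * 2 ^ β, by positivity, fun t ht htT => ?_⟩
  have hhalf : (t / 2) ^ (-β) = 2 ^ β * t ^ (-β) := by
    rw [Real.div_rpow ht.le (by norm_num), Real.rpow_neg (by norm_num : (0 : ℝ) ≤ 2), div_inv_eq_mul,
      mul_comm]
  -- Splitting `T(t)` into `T(t/2) T(t/2)` and moving one factor to `φ` uses the `L^1` to `L^2`
  -- bound twice.
  have hinner : ∀ g φ : L2 Ω, inner ℝ (semigroupL2 Ω bc s d t g) φ ≤
      K * 2 ^ β * t ^ (-β) * (∫ y in Ω, |g y|) * ∫ y in Ω, |φ y| := by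
    intro g φ
    have e : semigroupL2 Ω bc s d t g
        = semigroupL2 Ω bc s d (t / 2) (semigroupL2 Ω bc s d (t / 2) g) := by
      rw [← semigroupL2_add hΩ hs0 hs1 hd (by positivity) (by positivity), add_halves]
    rw [e, inner_semigroupL2 hΩ hs0 hs1 hd (by positivity)]
    refine (real_inner_le_norm _ _).trans ?_
    have h1 := hK' (t / 2) (by positivity) (by linarith) g
    have h2 := hK' (t / 2) (by positivity) (by linarith) φ
    rw [hhalf] at h1 h2
    have n1 : 0 ≤ ∫ y in Ω, |g y| := integral_nonneg fun _ => abs_nonneg _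
    have n2 : 0 ≤ ∫ y in Ω, |φ y| := integral_nonneg fun _ => abs_nonneg _
    refine abs_le_of_sq_le_sq' ?_ (by positivity) |>.2
    calc (‖semigroupL2 Ω bc s d (t / 2) g‖ * ‖semigroupL2 Ω bc s d (t / 2) φ‖) ^ 2
        = ‖semigroupL2 Ω bc s d (t / 2) g‖ ^ 2 * ‖semigroupL2 Ω bc s d (t / 2) φ‖ ^ 2 := by ring
      _ ≤ (K * (2 ^ β * t ^ (-β)) * (∫ y in Ω, |g y|) ^ 2)
          * (K * (2 ^ β * t ^ (-β)) * (∫ y in Ω, |φ y|) ^ 2) := by gcongr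
      _ = _ := by ring
  have hle : ∀ g : L2 Ω, ∀ᵐ x ∂volume.restrict Ω, semigroupL2 Ω bc s d t g x ≤
      K * 2 ^ β * t ^ (-β) * ∫ y in Ω, |g y| := by
    intro g
    refine ae_le_of_forall_setIntegral_le ((Lp.memLp _).integrable (by norm_num))
      (integrable_const _) fun A hA _ => ?_
    have hφ : MemLp (A.indicator fun _ => (1 : ℝ)) 2 (volume.restrict Ω) :=
      (memLp_const 1).indicator hA
    have h1 := hinner g (hφ.toLp _)
    have h2 : inner ℝ (semigroupL2 Ω bc s d t g) (hφ.toLp _)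
        = ∫ x in A, semigroupL2 Ω bc s d t g x ∂volume.restrict Ω := by
      rw [inner_eq_integral, ← integral_indicator hA]
      refine integral_congr_ae ?_
      filter_upwards [hφ.coeFn_toLp] with x hx
      rw [hx]
      by_cases hxA : x ∈ A <;> simp [hxA]
    have h3 : ∫ y in Ω, |hφ.toLp _ y| = ∫ x in A, (1 : ℝ) ∂volume.restrict Ω := by
      rw [← integral_indicator hA]
      refine integral_congr_ae ?_
      filter_upwards [hφ.coeFn_toLp] with x hx
      rw [hx]
      by_cases hxA : x ∈ A <;> simp [hxA]
    rw [h2, h3, ← integral_const_mul] at h1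
    simpa only [mul_one] using h1
  intro g
  have h1 := hle (-g)
  have h2 : ∫ y in Ω, |(-g : L2 Ω) y| = ∫ y in Ω, |g y| := by
    refine integral_congr_ae ?_
    filter_upwards [Lp.coeFn_neg g] with x hx
    rw [hx, Pi.neg_apply, abs_neg]
  rw [h2, semigroupL2_neg hΩ hs0 hs1 hd ht.le] at h1
  filter_upwards [hle g, h1, Lp.coeFn_neg (semigroupL2 Ω bc s d t g)] with x h3 h4 h5
  rw [h5, Pi.neg_apply] at h4
  exact abs_le.2 ⟨by linarith, h3⟩

/-- The smoothing estimate from `L^p` to `L^∞`. -/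
theorem exists_semigroupL2_ae_abs_le {T : ℝ} (hT : 0 < T) {p : ℝ} (hp : 1 ≤ p) :
    ∃ K : ℝ, 0 < K ∧ ∀ t, 0 < t → t ≤ T → ∀ g : L2 Ω,
      Integrable (fun x => |g x| ^ p) (volume.restrict Ω) → ∀ᵐ x ∂volume.restrict Ω,
        |semigroupL2 Ω bc s d t g x| ≤
          K * t ^ (-(N / (2 * s * p))) * (∫ y in Ω, |g y| ^ p) ^ p⁻¹ := by
  have := hΩ.isFiniteMeasure
  obtain ⟨K, hK, hK'⟩ := exists_semigroupL2_ae_abs_le_integral (bc := bc) hΩ hs0 hs1 hd hT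
  set β : ℝ := N / (2 * s) with hβ
  have hp0 : 0 < p := by linarith
  refine ⟨1 + K, by positivity, fun t ht htT g hg => ?_⟩
  set m := ∫ y in Ω, |g y| ^ p with hm
  have hm0 : 0 ≤ m := integral_nonneg fun _ => by positivity
  rcases hm0.eq_or_lt with hz | hpos
  · rw [← hz, Real.zero_rpow (by positivity), mul_zero]
    have h1 : (fun x => |g x| ^ p) =ᵐ[volume.restrict Ω] 0 :=
      (integral_eq_zero_iff_of_nonneg (fun _ => by positivity) hg).1 hz.symm
    refine semigroupL2_ae_abs_le hΩ hs0 hs1 hd ht.le le_rfl ?_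
    filter_upwards [h1] with x hx
    exact ((Real.rpow_eq_zero (abs_nonneg _) hp0.ne').1 hx).le
  -- Truncation level. The part of `g` below `a` is handled by the `L^∞` contraction, the part above
  -- by the `L^1` bound with `‖·‖_1 ≤ a^(1-p) m`; the choice `a^p = t^(-β) m` makes both
  -- contributions multiples of `a`.
  set a := (t ^ (-β) * m) ^ p⁻¹ with ha
  have ha0 : 0 < a := by positivity
  have hgm : Measurable g := (Lp.stronglyMeasurable g).measurable
  let A : Set (Space N) := {x | |g x| ≤ a}
  have hA : MeasurableSet A := measurableSet_le hgm.abs measurable_const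
  have h1 : MemLp (A.indicator g) 2 (volume.restrict Ω) := (Lp.memLp g).indicator hA
  have h2 : MemLp (Aᶜ.indicator g) 2 (volume.restrict Ω) := (Lp.memLp g).indicator hA.compl
  have hsum : g = h1.toLp _ + h2.toLp _ := by
    rw [← MemLp.toLp_add]
    simp only [indicator_self_add_compl, Lp.toLp_coeFn]
  have b1 := semigroupL2_ae_abs_le (bc := bc) (t := t) hΩ hs0 hs1 hd ht.le ha0.le
    (u := h1.toLp _) (by
      filter_upwards [h1.coeFn_toLp] with x hx
      rw [hx]
      by_cases hxA : x ∈ A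
      · rw [indicator_of_mem hxA]; exact hxA
      · rw [indicator_of_notMem hxA, abs_zero]; exact ha0.le)
  have b2 := hK' t ht htT (h2.toLp _)
  have b3 : ∫ y in Ω, |h2.toLp _ y| ≤ a ^ (1 - p) * m := by
    rw [hm, ← integral_const_mul]
    refine integral_mono_ae (((Lp.memLp _).integrable (by norm_num)).abs) (hg.const_mul _) ?_
    filter_upwards [h2.coeFn_toLp] with x hx
    rw [hx]
    by_cases hxA : x ∈ A
    · rw [indicator_of_notMem (by simpa using hxA), abs_zero]
      positivity
    · rw [indicator_of_mem hxA]
      have hlt : a < |g x| := not_le.1 hxA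
      have hgx : 0 < |g x| := ha0.trans hlt
      calc |g x| = |g x| ^ (1 - p) * |g x| ^ p := by
            rw [← Real.rpow_add hgx]; simp
        _ ≤ a ^ (1 - p) * |g x| ^ p := mul_le_mul_of_nonneg_right
            (Real.rpow_le_rpow_of_nonpos ha0 hlt.le (by linarith)) (by positivity)
  have hap : a ^ p = t ^ (-β) * m := by
    rw [ha, Real.rpow_inv_rpow (by positivity) hp0.ne']
  have haeq : a = t ^ (-(N / (2 * s * p))) * m ^ p⁻¹ := by
    rw [ha, Real.mul_rpow (by positivity) hm0, ← Real.rpow_mul ht.le, hβ]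
    congr 2
    field_simp
  have b4 : K * t ^ (-β) * ∫ y in Ω, |h2.toLp _ y| ≤ K * a := by
    calc K * t ^ (-β) * ∫ y in Ω, |h2.toLp _ y| ≤ K * t ^ (-β) * (a ^ (1 - p) * m) := by gcongr
      _ = K * (a ^ (1 - p) * a ^ p) := by rw [hap]; ring
      _ = K * a := by rw [← Real.rpow_add ha0]; simp
  have hadd := semigroupL2_add_right (bc := bc) hΩ hs0 hs1 hd ht.le (h1.toLp _) (h2.toLp _)
  rw [← hsum] at hadd
  filter_upwards [b1, b2, Lp.coeFn_add (semigroupL2 Ω bc s d t (h1.toLp _))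
    (semigroupL2 Ω bc s d t (h2.toLp _))] with x c1 c2 c3
  rw [hadd, c3, Pi.add_apply]
  refine (abs_add_le _ _).trans ?_
  rw [mul_assoc, ← haeq, add_mul, one_mul]
  exact add_le_add c1 (c2.trans b4)

end Semigroup

end

section

/-! ### Order structure of `L^p` and bounds for Bochner integrals -/

section Lattice

variable {X : Type*} [MeasurableSpace X] {μ : Measure X} {p : ℝ≥0∞}

theorem toLpOrZero_of_memLp {f : X → ℝ} (hf : MemLp f p μ) : toLpOrZero p μ f = hf.toLp f :=
  dif_pos hf

theorem isOrderedModule_Lp : IsOrderedModule ℝ (Lp ℝ p μ) :=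
  .of_smul_nonneg fun c hc f hf => by
    rw [← Lp.coeFn_nonneg] at hf ⊢
    filter_upwards [hf, Lp.coeFn_smul c f] with x h1 h2
    rw [h2]
    exact mul_nonneg hc h1

theorem norm_eq_integral_rpow [Fact (1 ≤ p)] (hp : p ≠ ∞) (v : Lp ℝ p μ) :
    ‖v‖ = (∫ x, |v x| ^ p.toReal ∂μ) ^ p.toReal⁻¹ := by
  have hp0 : p ≠ 0 := (zero_lt_one.trans_le (Fact.out : 1 ≤ p)).ne'
  rw [Lp.norm_def, (Lp.memLp v).eLpNorm_eq_integral_rpow_norm hp0 hp,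
    ENNReal.toReal_ofReal (Real.rpow_nonneg (integral_nonneg fun _ => by positivity) _)]
  rfl

variable [IsFiniteMeasure μ]

variable (μ p) in
/-- The constant function `1` in `L^p`. -/
def oneLp : Lp ℝ p μ := (memLp_const (1 : ℝ)).toLp _

/-- Written as an order relation in `L^p`, an almost everywhere bound passes through limits and
vector-valued integrals without choosing representatives. -/
theorem abs_le_smul_oneLp_iff {v : Lp ℝ p μ} {c : ℝ} :
    |v| ≤ c • oneLp μ p ↔ ∀ᵐ x ∂μ, |v x| ≤ c := by
  rw [← Lp.coeFn_le]
  have h1 := Lp.coeFn_abs v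
  have h2 := Lp.coeFn_smul c (oneLp μ p)
  have h3 : oneLp μ p =ᵐ[μ] fun _ => 1 := MemLp.coeFn_toLp _
  refine ⟨fun h => ?_, fun h => ?_⟩
  · filter_upwards [h, h1, h2, h3] with x h h1 h2 h3
    rw [h1, h2, Pi.smul_apply, h3, smul_eq_mul, mul_one] at h
    exact h
  · filter_upwards [h, h1, h2, h3] with x h h1 h2 h3
    rw [h1, h2, Pi.smul_apply, h3, smul_eq_mul, mul_one]
    exact h

theorem abs_integral_le_smul_oneLp [Fact (1 ≤ p)] {α : Type*} [MeasurableSpace α] {ν : Measure α}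
    {F : α → Lp ℝ p μ} {φ : α → ℝ} (hφ : Integrable φ ν) (hφ0 : ∀ᵐ t ∂ν, 0 ≤ φ t)
    (h : ∀ᵐ t ∂ν, |F t| ≤ φ t • oneLp μ p) :
    |∫ t, F t ∂ν| ≤ (∫ t, φ t ∂ν) • oneLp μ p := by
  have := isOrderedModule_Lp (μ := μ) (p := p)
  by_cases hF : Integrable F ν
  · rw [← integral_smul_const]
    refine abs_le'.2 ⟨integral_mono_ae hF (hφ.smul_const _) ?_, ?_⟩
    · filter_upwards [h] with t ht
      exact (le_abs_self _).trans ht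
    · rw [← integral_neg]
      refine integral_mono_ae hF.neg (hφ.smul_const _) ?_
      filter_upwards [h] with t ht
      exact (neg_le_abs _).trans ht
  -- A non-integrable curve has integral `0`, which satisfies the bound; so measurability of `τ ↦
  -- T(t - τ) h(τ)` never has to be established.
  · rw [integral_undef hF, abs_le_smul_oneLp_iff]
    filter_upwards [Lp.coeFn_zero ℝ p μ] with x hx
    rw [hx, Pi.zero_apply, abs_zero]
    exact integral_nonneg_of_ae hφ0

theorem denseRange_memLp_two [Fact (1 ≤ p)] (hp : p ≠ ∞) :
    DenseRange (Subtype.val : {g : Lp ℝ p μ // MemLp g 2 μ} → Lp ℝ p μ) := by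
  rw [denseRange_subtype_val]
  refine (Lp.simpleFunc.dense (E := ℝ) (μ := μ) hp).mono fun f hf => ?_
  exact (SimpleFunc.memLp_of_isFiniteMeasure (Lp.simpleFunc.toSimpleFunc ⟨f, hf⟩) 2 μ).ae_eq
    (Lp.simpleFunc.toSimpleFunc_eq_toFun ⟨f, hf⟩)

end Lattice

/-! ### Extension of the semigroup to `L^p` -/

section Extension

variable {N : ℕ} {Ω : Set (Space N)} {bc : BoundaryCondition} {s d : ℝ}
  {p : ℝ≥0∞} [Fact (1 ≤ p)]

/-- The restriction of the semigroup to `L^2 ∩ L^p`, with values in `L^p`. -/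
def semigroupRestrict (Ω : Set (Space N)) (bc : BoundaryCondition) (s d : ℝ) (p : ℝ≥0∞) (t : ℝ)
    (g : {g : Lp ℝ p (volume.restrict Ω) // MemLp g 2 (volume.restrict Ω)}) :
    Lp ℝ p (volume.restrict Ω) :=
  toLpOrZero p (volume.restrict Ω)
    (semigroupL2 Ω bc s d t (toLpOrZero 2 (volume.restrict Ω) g.1))

variable (hΩ : IsBoundedRegularOpen Ω) (hs0 : 0 < s) (hs1 : s < 1) (hd : 0 < d)

include hΩ hs0 hs1 hd

/-- The smoothing estimate from `L^p` to `L^∞` for the semigroup on `L^p`, and the contraction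
property in `L^∞`. -/
theorem exists_semigroupLp_ae_abs_le (hp : p ≠ ∞) {T : ℝ} (hT : 0 < T) :
    ∃ K : ℝ, 0 < K ∧ ∀ t, 0 < t → t ≤ T → ∀ f : Lp ℝ p (volume.restrict Ω),
      (∀ᵐ x ∂volume.restrict Ω, |semigroupLp Ω bc s d p t f x| ≤
        K * t ^ (-(N / (2 * s * p.toReal))) * ‖f‖) ∧
      ∀ c, 0 ≤ c → (∀ᵐ x ∂volume.restrict Ω, |f x| ≤ c) →
        ∀ᵐ x ∂volume.restrict Ω, |semigroupLp Ω bc s d p t f x| ≤ c := by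
  have := hΩ.isFiniteMeasure
  have hp1 : 1 ≤ p := Fact.out
  have hp0 : p ≠ 0 := (zero_lt_one.trans_le hp1).ne'
  obtain ⟨K, hK, hK'⟩ := exists_semigroupL2_ae_abs_le (bc := bc) hΩ hs0 hs1 hd hT
    (p := p.toReal) (by simpa using ENNReal.toReal_mono hp hp1)
  refine ⟨K, hK, fun t ht htT f => ?_⟩
  set k := K * t ^ (-(N / (2 * s * p.toReal))) with hk
  have hk0 : 0 < k := by positivity
  set S := semigroupRestrict Ω bc s d p t
  have hbd : ∀ g : {g : Lp ℝ p (volume.restrict Ω) // MemLp g 2 (volume.restrict Ω)},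
      ∀ᵐ x ∂volume.restrict Ω,
      |semigroupL2 Ω bc s d t (toLpOrZero 2 (volume.restrict Ω) g.1) x| ≤ k * ‖g.1‖ := by
    intro g
    rw [toLpOrZero_of_memLp g.2]
    have h1 : (fun x => |g.2.toLp _ x| ^ p.toReal) =ᵐ[volume.restrict Ω]
        fun x => ‖g.1 x‖ ^ p.toReal := by
      filter_upwards [g.2.coeFn_toLp] with x hx
      rw [hx, Real.norm_eq_abs]
    have h2 := hK' t ht htT (g.2.toLp _)
      (((Lp.memLp g.1).integrable_norm_rpow hp0 hp).congr h1.symm)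
    rw [integral_congr_ae h1] at h2
    rw [norm_eq_integral_rpow hp]
    exact h2
  have hmem : ∀ g : {g : Lp ℝ p (volume.restrict Ω) // MemLp g 2 (volume.restrict Ω)},
      MemLp (semigroupL2 Ω bc s d t (toLpOrZero 2 (volume.restrict Ω) g.1)) p
      (volume.restrict Ω) := fun g =>
    MemLp.of_bound (Lp.aestronglyMeasurable _) _ (hbd g)
  have hS : ∀ g, S g =ᵐ[volume.restrict Ω]
      semigroupL2 Ω bc s d t (toLpOrZero 2 (volume.restrict Ω) g.1) := fun g => by
    simp only [S, semigroupRestrict]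
    rw [toLpOrZero_of_memLp (hmem g)]
    exact MemLp.coeFn_toLp _
  have hSbd : ∀ g, ∀ᵐ x ∂volume.restrict Ω, |S g x| ≤ k * ‖g.1‖ := fun g => by
    filter_upwards [hS g, hbd g] with x h1 h2
    rwa [h1]
  have hSsub : ∀ g g', S g - S g' = S ⟨g.1 - g'.1, (g.2.sub g'.2).ae_eq (Lp.coeFn_sub _ _).symm⟩ := by
    intro g g'
    set g'' : {g : Lp ℝ p (volume.restrict Ω) // MemLp g 2 (volume.restrict Ω)} :=
      ⟨g.1 - g'.1, (g.2.sub g'.2).ae_eq (Lp.coeFn_sub _ _).symm⟩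
    have h0 : toLpOrZero 2 (volume.restrict Ω) g.1
        = toLpOrZero 2 (volume.restrict Ω) g''.1 + toLpOrZero 2 (volume.restrict Ω) g'.1 := by
      rw [toLpOrZero_of_memLp g.2, toLpOrZero_of_memLp g''.2, toLpOrZero_of_memLp g'.2,
        ← MemLp.toLp_add]
      refine MemLp.toLp_congr _ _ ?_
      filter_upwards [Lp.coeFn_sub g.1 g'.1] with x hx
      simp only [g'', Pi.add_apply]
      rw [hx, Pi.sub_apply, sub_add_cancel]
    have h1 := hS g
    rw [h0, semigroupL2_add_right hΩ hs0 hs1 hd ht.le] at h1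
    refine Lp.ext ?_
    filter_upwards [Lp.coeFn_sub (S g) (S g'), h1, hS g', hS g'', Lp.coeFn_add
      (semigroupL2 Ω bc s d t (toLpOrZero 2 (volume.restrict Ω) g''.1))
      (semigroupL2 Ω bc s d t (toLpOrZero 2 (volume.restrict Ω) g'.1))] with x h2 h3 h4 h5 h6
    rw [h2, Pi.sub_apply, h3, h4, h5, h6, Pi.add_apply, add_sub_cancel_right]
  -- On a finite measure the pointwise bound by `k ‖g‖` gives an `L^p` bound, and additivity turns
  -- it into a Lipschitz bound on the dense subspace. Hence the limit that defines `semigroupLp`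
  -- exists.
  set L : ℝ := (measureUnivNNReal (volume.restrict Ω) : ℝ) ^ p.toReal⁻¹ * k with hL
  have hL0 : 0 ≤ L := by positivity
  have hLip : LipschitzWith L.toNNReal S := by
    refine LipschitzWith.of_dist_le_mul fun g g' => ?_
    rw [dist_eq_norm, hSsub, Real.coe_toNNReal _ hL0, Subtype.dist_eq, dist_eq_norm, hL, mul_assoc]
    exact Lp.norm_le_of_ae_bound (by positivity) (hSbd _)
  have hlim : Tendsto S (comap Subtype.val (𝓝 f)) (𝓝 (semigroupLp Ω bc s d p t f)) :=
    tendsto_nhds_limUnder (uniformly_extend_exists (isUniformInducing_val _)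
      (denseRange_memLp_two hp) hLip.uniformContinuous f)
  have hne : (comap (Subtype.val : {g : Lp ℝ p (volume.restrict Ω) //
      MemLp g 2 (volume.restrict Ω)} → _) (𝓝 f)).NeBot :=
    mem_closure_iff_comap_neBot.1 (denseRange_subtype_val.1 (denseRange_memLp_two hp) f)
  constructor
  · rw [← abs_le_smul_oneLp_iff]
    have habs : Continuous fun v : Lp ℝ p (volume.restrict Ω) => |v| :=
      continuous_id.sup continuous_neg
    have h2 : Tendsto (fun g : {g : Lp ℝ p (volume.restrict Ω) // MemLp g 2 (volume.restrict Ω)} =>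
        (k * ‖g.1‖) • oneLp (volume.restrict Ω) p) (comap Subtype.val (𝓝 f))
        (𝓝 ((k * ‖f‖) • oneLp (volume.restrict Ω) p)) :=
      ((tendsto_comap.norm).const_mul k).smul_const _
    exact le_of_tendsto_of_tendsto' ((habs.tendsto _).comp hlim) h2
      fun g => abs_le_smul_oneLp_iff.2 (hSbd g)
  -- A bounded `f` lies in `L^2`, where the extension agrees with the original operator; the `L^2`
  -- contraction statement therefore applies directly.
  · intro c hc hf
    have hf2 : MemLp f 2 (volume.restrict Ω) := MemLp.of_bound (Lp.aestronglyMeasurable _) c hf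
    have h1 : Tendsto S (comap Subtype.val (𝓝 f)) (𝓝 (S ⟨f, hf2⟩)) := by
      have := hLip.continuous.tendsto ⟨f, hf2⟩
      rwa [nhds_subtype_eq_comap] at this
    rw [tendsto_nhds_unique hlim h1]
    have h2 := semigroupL2_ae_abs_le (bc := bc) (t := t) hΩ hs0 hs1 hd ht.le hc
      (u := toLpOrZero 2 (volume.restrict Ω) f) (by
        rw [toLpOrZero_of_memLp hf2]
        filter_upwards [hf2.coeFn_toLp, hf] with x h3 h4
        rwa [h3])
    filter_upwards [h2, hS ⟨f, hf2⟩] with x h3 h4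
    rwa [h4]

end Extension

end

/-! ### Duhamel's formula and Hölder's inequality in time -/

section

theorem integrableOn_sub_rpow {r t : ℝ} (hr : r < 1) (ht : 0 ≤ t) :
    IntegrableOn (fun τ => (t - τ) ^ (-r)) (Ioo 0 t) := by
  have h1 := (intervalIntegral.intervalIntegrable_rpow' (a := 0) (b := t) (r := -r)
    (by linarith)).comp_sub_left t
  rw [sub_zero, sub_self] at h1
  exact ((intervalIntegrable_iff_integrableOn_Ioo_of_le ht).1 h1.symm)

theorem integral_sub_rpow {r t : ℝ} (hr : r < 1) (ht : 0 ≤ t) :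
    ∫ τ in Ioo 0 t, (t - τ) ^ (-r) = t ^ (1 - r) / (1 - r) := by
  rw [← integral_Ioc_eq_integral_Ioo, ← intervalIntegral.integral_of_le ht,
    intervalIntegral.integral_comp_sub_left (fun x => x ^ (-r)) t, sub_self, sub_zero,
    integral_rpow (Or.inl (by linarith)), Real.zero_rpow (by linarith), sub_zero,
    show -r + 1 = 1 - r by ring]

/-- Hölder's inequality for the convolution with `t ^ (-γ)`. -/
theorem integrable_and_integral_sub_rpow_mul_le {p q γ t T : ℝ} (hpq : p.HolderConjugate q)
    (hγq : γ * q < 1) (ht : 0 < t) (htT : t ≤ T) {m : ℝ → ℝ} (hm0 : ∀ τ, 0 ≤ m τ)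
    (hm : IntegrableOn m (Ioo 0 T)) :
    IntegrableOn (fun τ => (t - τ) ^ (-γ) * m τ ^ p⁻¹) (Ioo 0 t) ∧
      ∫ τ in Ioo 0 t, (t - τ) ^ (-γ) * m τ ^ p⁻¹ ≤
        (T ^ (1 - γ * q) / (1 - γ * q)) ^ (1 / q) * (∫ τ in Ioo 0 T, m τ) ^ p⁻¹ := by
  have hp := hpq.pos
  have hq := hpq.symm.pos
  have hsub : Ioo 0 t ⊆ Ioo 0 T := Ioo_subset_Ioo_right htT
  have hmt : IntegrableOn m (Ioo 0 t) := hm.mono_set hsub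
  have e1 : ∀ τ ∈ Ioo 0 t, ((t - τ) ^ (-γ)) ^ q = (t - τ) ^ (-(γ * q)) := fun τ hτ => by
    rw [← Real.rpow_mul (by linarith [hτ.2]), neg_mul]
  have e2 : ∀ τ, (m τ ^ p⁻¹) ^ p = m τ := fun τ => Real.rpow_inv_rpow (hm0 τ) hp.ne'
  have hmeas1 : AEStronglyMeasurable (fun τ => (t - τ) ^ (-γ)) (volume.restrict (Ioo 0 t)) :=
    ((measurable_const.sub measurable_id).pow_const _).aestronglyMeasurable
  have hmeas2 : AEStronglyMeasurable (fun τ => m τ ^ p⁻¹) (volume.restrict (Ioo 0 t)) :=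
    (hmt.aestronglyMeasurable.aemeasurable.pow_const _).aestronglyMeasurable
  have hL1 : MemLp (fun τ => (t - τ) ^ (-γ)) (ENNReal.ofReal q) (volume.restrict (Ioo 0 t)) := by
    rw [← integrable_norm_rpow_iff hmeas1 (by simpa using hq) ENNReal.ofReal_ne_top,
      ENNReal.toReal_ofReal hq.le]
    refine (integrableOn_sub_rpow hγq ht.le).congr_fun (fun τ hτ => ?_) measurableSet_Ioo
    simp only [Real.norm_eq_abs]
    rw [abs_of_nonneg (Real.rpow_nonneg (by linarith [hτ.2]) _), e1 τ hτ]
  have hL2 : MemLp (fun τ => m τ ^ p⁻¹) (ENNReal.ofReal p) (volume.restrict (Ioo 0 t)) := by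
    rw [← integrable_norm_rpow_iff hmeas2 (by simpa using hp) ENNReal.ofReal_ne_top,
      ENNReal.toReal_ofReal hp.le]
    refine hmt.congr_fun (fun τ _ => ?_) measurableSet_Ioo
    simp only [Real.norm_eq_abs]
    rw [abs_of_nonneg (Real.rpow_nonneg (hm0 τ) _), e2]
  have hconj := hpq.symm.ennrealOfReal
  refine ⟨hL1.integrable_mul hL2, ?_⟩
  have hH := integral_mul_le_Lp_mul_Lq_of_nonneg (μ := volume.restrict (Ioo 0 t)) hpq.symm
    (by
      filter_upwards [ae_restrict_mem measurableSet_Ioo] with τ hτ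
      exact Real.rpow_nonneg (by linarith [hτ.2]) _)
    (Eventually.of_forall fun τ => Real.rpow_nonneg (hm0 τ) _) hL1 hL2
  refine hH.trans ?_
  rw [setIntegral_congr_fun measurableSet_Ioo e1, integral_sub_rpow hγq ht.le]
  simp only [e2]
  rw [one_div p]
  have h1 : 0 < 1 - γ * q := by linarith
  have h2 : ∫ τ in Ioo 0 t, m τ ≤ ∫ τ in Ioo 0 T, m τ :=
    setIntegral_mono_set hm (Eventually.of_forall hm0) hsub.eventuallyLE
  have h3 : 0 ≤ ∫ τ in Ioo 0 t, m τ := integral_nonneg hm0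
  have hp' : 0 ≤ p⁻¹ := by positivity
  have hT : 0 < T := ht.trans_le htT
  gcongr

section Duhamel

variable {N : ℕ} {Ω : Set (Space N)} {bc : BoundaryCondition} {s d T : ℝ}
  {p : ℝ≥0∞} [Fact (1 ≤ p)]

theorem volume_restrict_cylinder : volume.restrict (cylinder Ω T)
    = (volume.restrict (Ioo 0 T)).prod (volume.restrict Ω) := by
  rw [Measure.prod_restrict, ← Measure.volume_eq_prod]
  rfl

/-- By Fubini almost every slice of `h` belongs to `L^p(Ω)`, so the default value `0` of
`toLpOrZero` matters only on a null set of times. -/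
theorem ae_norm_toLpOrZero_slice (hp : p ≠ ∞) {h : ℝ × Space N → ℝ}
    (hh : MemLp h p (volume.restrict (cylinder Ω T))) :
    ∀ᵐ τ ∂volume.restrict (Ioo 0 T), ‖toLpOrZero p (volume.restrict Ω) (fun x => h (τ, x))‖
      = (∫ x in Ω, ‖h (τ, x)‖ ^ p.toReal) ^ p.toReal⁻¹ := by
  have hp0 : p ≠ 0 := (zero_lt_one.trans_le (Fact.out : 1 ≤ p)).ne'
  rw [volume_restrict_cylinder] at hh
  filter_upwards [(hh.integrable_norm_rpow hp0 hp).prod_right_ae,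
    hh.aestronglyMeasurable.prodMk_left] with τ h1 h2
  have h3 : MemLp (fun x => h (τ, x)) p (volume.restrict Ω) :=
    (integrable_norm_rpow_iff h2 hp0 hp).1 h1
  rw [toLpOrZero_of_memLp h3, Lp.norm_toLp, h3.eLpNorm_eq_integral_rpow_norm hp0 hp,
    ENNReal.toReal_ofReal (Real.rpow_nonneg (integral_nonneg fun _ => by positivity) _)]

variable (hΩ : IsBoundedRegularOpen Ω) (hs0 : 0 < s) (hs1 : s < 1) (hd : 0 < d)

include hΩ hs0 hs1 hd

theorem exists_weakSolution_bound (hT : 0 < T) (hp : p ≠ ∞)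
    (hp' : (N + 2 * s) / (2 * s) < p.toReal) :
    ∃ C : ℝ, 0 < C ∧ ∀ (w₀ : Space N → ℝ) (h w : ℝ × Space N → ℝ),
      MemLp w₀ ∞ (volume.restrict Ω) → MemLp h p (volume.restrict (cylinder Ω T)) →
      IsWeakSolution Ω bc s d T p w₀ h w → ∀ t ∈ Ioo 0 T, ∀ᵐ x ∂volume.restrict Ω,
        |w (t, x)| ≤ (eLpNorm w₀ ∞ (volume.restrict Ω)).toReal +
          C * (eLpNorm h p (volume.restrict (cylinder Ω T))).toReal := by
  have := hΩ.isFiniteMeasure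
  have hp0 : p ≠ 0 := (zero_lt_one.trans_le (Fact.out : 1 ≤ p)).ne'
  obtain ⟨K, hK, hK'⟩ := exists_semigroupLp_ae_abs_le (bc := bc) hΩ hs0 hs1 hd hp hT
  set P := p.toReal with hP
  have hNs : (N + 2 * s) / (2 * s) = N / (2 * s) + 1 := by field_simp
  rw [hNs] at hp'
  have hN0 : (0 : ℝ) ≤ N / (2 * s) := by positivity
  have hP1 : 1 < P := by linarith
  set γ : ℝ := N / (2 * s * P) with hγ
  set q : ℝ := P.conjExponent with hq
  have hpq : P.HolderConjugate q := Real.HolderConjugate.conjExponent hP1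
  -- Here `γ q = (N / (2 s)) / (p - 1)`, so integrability of `(t - τ)^(-γ q)` is exactly the
  -- condition `N / (2 s) + 1 < p`.
  have hγq : γ * q < 1 := by
    have h1 : γ * q = N / (2 * s) / (P - 1) := by
      have : P - 1 ≠ 0 := by linarith
      rw [hγ, hq, Real.conjExponent]
      field_simp
    rw [h1, div_lt_one (by linarith)]
    linarith
  set B := (T ^ (1 - γ * q) / (1 - γ * q)) ^ (1 / q) with hB
  have hγq' : 0 < 1 - γ * q := by linarith
  have hB0 : 0 < B := by positivity
  refine ⟨K * B, by positivity, fun w₀ h w hw₀ hh hw t ht => ?_⟩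
  have htIcc : t ∈ Icc 0 T := ⟨ht.1.le, ht.2.le⟩
  set c₀ := (eLpNorm w₀ ∞ (volume.restrict Ω)).toReal with hc₀
  have hc₀0 : 0 ≤ c₀ := ENNReal.toReal_nonneg
  have hw₀p : MemLp w₀ p (volume.restrict Ω) := hw₀.mono_exponent le_top
  have h1 : |semigroupLp Ω bc s d p t (toLpOrZero p (volume.restrict Ω) w₀)|
      ≤ c₀ • oneLp (volume.restrict Ω) p := by
    rw [abs_le_smul_oneLp_iff]
    refine (hK' t ht.1 ht.2.le _).2 c₀ hc₀0 ?_
    rw [toLpOrZero_of_memLp hw₀p]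
    filter_upwards [hw₀p.coeFn_toLp, ae_le_eLpNormEssSup (f := w₀)] with x h2 h3
    rw [h2, ← Real.norm_eq_abs, ← toReal_enorm, hc₀, eLpNorm_exponent_top]
    exact ENNReal.toReal_mono (by rw [← eLpNorm_exponent_top]; exact hw₀.eLpNorm_ne_top) h3
  set m : ℝ → ℝ := fun τ => ∫ x in Ω, ‖h (τ, x)‖ ^ P with hm
  have hm0 : ∀ τ, 0 ≤ m τ := fun τ => integral_nonneg fun _ => by positivity
  have hint : Integrable (fun z => ‖h z‖ ^ P) ((volume.restrict (Ioo 0 T)).prod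
      (volume.restrict Ω)) := by
    rw [← volume_restrict_cylinder]
    exact hh.integrable_norm_rpow hp0 hp
  have hmi : IntegrableOn m (Ioo 0 T) := hint.integral_prod_left
  have hnorm : (∫ τ in Ioo 0 T, m τ) ^ P⁻¹
      = (eLpNorm h p (volume.restrict (cylinder Ω T))).toReal := by
    rw [hh.eLpNorm_eq_integral_rpow_norm hp0 hp, volume_restrict_cylinder,
      integral_prod _ hint,
      ENNReal.toReal_ofReal (Real.rpow_nonneg (integral_nonneg hm0) _)]
  obtain ⟨hφi, hφ⟩ := integrable_and_integral_sub_rpow_mul_le hpq hγq ht.1 ht.2.le hm0 hmi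
  rw [hnorm] at hφ
  have h2 : |∫ τ in (0 : ℝ)..t, semigroupLp Ω bc s d p (t - τ)
      (toLpOrZero p (volume.restrict Ω) (fun x => h (τ, x)))|
      ≤ (K * ∫ τ in Ioo 0 t, (t - τ) ^ (-γ) * m τ ^ P⁻¹) • oneLp (volume.restrict Ω) p := by
    rw [intervalIntegral.integral_of_le ht.1.le, integral_Ioc_eq_integral_Ioo,
      ← integral_const_mul]
    refine abs_integral_le_smul_oneLp (hφi.const_mul K) ?_ ?_
    · filter_upwards [ae_restrict_mem measurableSet_Ioo] with τ hτ
      have : 0 < t - τ := by linarith [hτ.2]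
      have := Real.rpow_nonneg (hm0 τ) P⁻¹
      positivity
    · filter_upwards [ae_restrict_mem measurableSet_Ioo,
        ae_restrict_of_ae_restrict_of_subset (Ioo_subset_Ioo_right ht.2.le)
          (ae_norm_toLpOrZero_slice hp hh)] with τ hτ hn
      rw [abs_le_smul_oneLp_iff]
      have h3 := (hK' (t - τ) (by linarith [hτ.2]) (by linarith [hτ.1, ht.2])
        (toLpOrZero p (volume.restrict Ω) (fun x => h (τ, x)))).1
      rw [hn, mul_assoc] at h3
      exact h3
  rw [abs_le_smul_oneLp_iff] at h1 h2
  have hmild := hw.mild t ⟨ht.1.le, ht.2⟩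
  rw [toLpOrZero_of_memLp (hw.memLp t htIcc)] at hmild
  have h3 := (hw.memLp t htIcc).coeFn_toLp
  rw [hmild] at h3
  filter_upwards [h1, h2, h3, Lp.coeFn_add (semigroupLp Ω bc s d p t
    (toLpOrZero p (volume.restrict Ω) w₀)) (∫ τ in (0 : ℝ)..t, semigroupLp Ω bc s d p (t - τ)
      (toLpOrZero p (volume.restrict Ω) (fun x => h (τ, x))))] with x h1 h2 h3 h4
  rw [← h3, h4, Pi.add_apply]
  refine (abs_add_le _ _).trans (add_le_add h1 (h2.trans ?_))
  rw [mul_assoc]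
  exact mul_le_mul_of_nonneg_left hφ hK.le

end Duhamel

/-- Bounds on all time slices pass to the cylinder by Fubini, which requires a measurable
exceptional set, hence a measurable representative of `w`. -/
theorem eLpNorm_top_cylinder_le {N : ℕ} {Ω : Set (Space N)} {T : ℝ} {w : ℝ × Space N → ℝ}
    (hw : AEStronglyMeasurable w (volume.restrict (cylinder Ω T))) {c : ℝ}
    (h : ∀ t ∈ Ioo 0 T, ∀ᵐ x ∂volume.restrict Ω, |w (t, x)| ≤ c) :
    eLpNorm w ∞ (volume.restrict (cylinder Ω T)) ≤ ENNReal.ofReal c := by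
  rw [eLpNorm_exponent_top]
  refine eLpNormEssSup_le_of_ae_bound ?_
  rw [volume_restrict_cylinder] at hw ⊢
  have hmeas : MeasurableSet {z | ‖hw.mk w z‖ ≤ c} :=
    measurableSet_le hw.stronglyMeasurable_mk.measurable.norm measurable_const
  have h1 : ∀ᵐ z ∂(volume.restrict (Ioo 0 T)).prod (volume.restrict Ω), ‖hw.mk w z‖ ≤ c := by
    rw [Measure.ae_prod_iff_ae_ae hmeas]
    filter_upwards [Measure.ae_ae_of_ae_prod hw.ae_eq_mk,
      ae_restrict_mem measurableSet_Ioo] with t h2 h3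
    filter_upwards [h2, h t h3] with x h4 h5
    rwa [← h4]
  filter_upwards [h1, hw.ae_eq_mk] with z h2 h3
  rwa [h3]

end

end SpectralFractional

end

theorem theorem2p1 {N : ℕ} (hN : 1 ≤ N) (Ω : Set (SpectralFractional.Space N))
    (hΩ : SpectralFractional.IsBoundedRegularOpen Ω)
    (bc : SpectralFractional.BoundaryCondition)
    (s : ℝ) (hs0 : 0 < s) (hs1 : s < 1) (d : ℝ) (hd : 0 < d) (T : ℝ) (hT : 0 < T)
    (p : ℝ≥0∞) [Fact (1 ≤ p)] (hp_top : p ≠ ∞)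
    (hp : ENNReal.ofReal ((N + 2 * s) / (2 * s)) < p) :
    ∃ C : ℝ, 0 < C ∧
      ∀ (w₀ : SpectralFractional.Space N → ℝ) (h w : ℝ × SpectralFractional.Space N → ℝ),
        MemLp w₀ ∞ (volume.restrict Ω) →
        MemLp h p (volume.restrict (SpectralFractional.cylinder Ω T)) →
        SpectralFractional.IsWeakSolution Ω bc s d T p w₀ h w →
        eLpNorm w ∞ (volume.restrict (SpectralFractional.cylinder Ω T)) ≤
          eLpNorm w₀ ∞ (volume.restrict Ω) +
            ENNReal.ofReal C *
              eLpNorm h p (volume.restrict (SpectralFractional.cylinder Ω T)) := by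
  have hp' : (N + 2 * s) / (2 * s) < p.toReal := by
    rwa [ENNReal.ofReal_lt_iff_lt_toReal (by positivity) hp_top] at hp
  obtain ⟨C, hC, hbound⟩ := SpectralFractional.exists_weakSolution_bound (bc := bc) hΩ hs0 hs1 hd
    hT hp_top hp'
  refine ⟨C, hC, fun w₀ h w hw₀ hh hw => ?_⟩
  refine (SpectralFractional.eLpNorm_top_cylinder_le hw.aestronglyMeasurable
    (hbound w₀ h w hw₀ hh hw)).trans_eq ?_
  rw [ENNReal.ofReal_add ENNReal.toReal_nonneg (by positivity), ENNReal.ofReal_mul hC.le,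
    ENNReal.ofReal_toReal hw₀.eLpNorm_ne_top, ENNReal.ofReal_toReal hh.eLpNorm_ne_top]
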